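/- **Theorem (Zilber's skew-field lemma).** *Conventions.* Let $L$ be a first-order language, $\kappa > |L| + \aleph_0$ a regular cardinal, and $M$ a $\kappa$-saturated $L$-structure. "Definable" means definable in $M$ with parameters, "bounded" means of cardinality $<\kappa$, "unbounded" means of cardinality $\geq\kappa$, and a type-definable set is an intersection of fewer than $\kappa$ definable sets. (One may take $M$ saturated of inaccessible cardinality $\kappa$.) Interpretable sets are the sets of imaginaries definable with parameters: definable subsets of $M^n/E$ with $E$ a $\emptyset$-definable equivalence relation. Assume that $M$ is *finite-dimensional*: there is a function $\dim$ from interpretable sets to $\mathbb{N}\cup\{-\infty\}$ such that - if the finite tuples $a, a'$ have the same type over $\emptyset$, then $\dim\varphi(x,a)=\dim\varphi(x,a')$ for every formula $\varphi(x,y)$; - $\dim X=0$ if and only if $X$ is finite and non-empty, and $\dim\emptyset=-\infty$; - $\dim(X\cup Y)=\max(\dim X,\dim Y)$; - if $f\colon X\to Y$ is an interpretable map, $d \in \mathbb{N}$, and $\dim f^{-1}(y)\ge d$ for all $y\in Y$, then $\dim X\ge\dim Y+d$. (This holds in every model $M$ of a finite-dimensional theory.) Let $V$ be a definable abelian group (the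 underlying set is a definable subset of some $M^n$ and the addition is definable), and let $\operatorname{DefEnd}(V)$ be its ring of definable endomorphisms. A definable subgroup of $V$ (in particular $V$ itself) is *connected* if it has no proper definable subgroup of finite index. A set $S \subseteq\operatorname{DefEnd}(V)$ is *invariant* if it is a union of fewer than $\kappa$ type-definable families, i.e. of sets $\{s_z : z\in Z\}$ where $Z$ is a type-definable set of tuples and the graph of $s_z$ is defined by $\Phi(z,x,y)$ for a fixed formula $\Phi$ with parameters. *Statement.* Let $V$ be connected and let $S,T\subseteq\operatorname{DefEnd}(V)$ be two invariant subrings such that: - $V$ is $S$-irreducible: the only definable, connected, $S$-invariant subgroups of $V$ are $0$ and $V$; - $T$ is the centraliser of $S$ in $\operatorname{DefEnd}(V)$, and $S$ is the centraliser of $T$ in $\operatorname{DefEnd}(V)$; - $S$ and $T$ are infinite; - $S$ or $T$ is unbounded. Then there are a definable skew-field $\mathbb{K}$ (a definable subset of some $M^m$ with definable addition and multiplication) and a definable scalar multiplication $\mathbb{K}\times V\to V$ making $V$ a $\mathbb{K}$-vector space of finite linear dimension, such that $S=\operatorname{End}_{\mathbb{K}}(V)$, the ring of all $\mathbb{K}$-linear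 endomorphisms of $V$, and $T=\mathbb{K}\cdot\mathrm{Id}_V$, the ring of scalar multiplications. Moreover $S$ and $T$ are definable: each is in bijection with a definable set $P\subseteq M^k$ so that the evaluation map $P\times V\to V$ is definable. -/

import Mathlib

universe u v w

namespace ZilberLemma

open FirstOrder FirstOrder.Language Cardinal

section General

variable (L : FirstOrder.Language.{u, v}) {M : Type w} [L.Structure M]

/-- Definable, with arbitrary parameters from the model. -/
def IsDef {α : Type*} (X : Set (α → M)) : Prop :=
  (Set.univ : Set M).Definable L X

/-- A map between two definable sets is definable when its graph is. -/
def IsDefMap {α β : Type*} {X : Set (α → M)} {Y : Set (β → M)} (f : X → Y) : Prop :=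
  IsDef L {w : α ⊕ β → M | ∃ x : X, w = Sum.elim (x : α → M) (f x : β → M)}

/-- A map in two variables between definable sets is definable when its graph is. -/
def IsDefMap₂ {α β γ : Type*} {X : Set (α → M)} {Y : Set (β → M)} {Z : Set (γ → M)}
    (f : X → Y → Z) : Prop :=
  IsDef L {w : α ⊕ (β ⊕ γ) → M | ∃ (x : X) (y : Y),
    w = Sum.elim (x : α → M) (Sum.elim (y : β → M) (f x y : γ → M))}

variable (M) in
/-- `M` is `κ`-saturated: every finitely satisfiable set of formulas, in finitely many variables
and with fewer than `κ` parameters, is realised in `M`. -/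
def IsSaturated (κ : Cardinal.{w}) : Prop :=
  ∀ A : Set M, #A < κ → ∀ (n : ℕ) (p : Set (L[[A]].Formula (Fin n))),
    (∀ q : Finset (L[[A]].Formula (Fin n)), (q : Set (L[[A]].Formula (Fin n))) ⊆ p →
      ∃ a : Fin n → M, ∀ φ ∈ q, φ.Realize a) →
    ∃ a : Fin n → M, ∀ φ ∈ p, φ.Realize a

/-- Type-definable: an intersection of fewer than `κ` definable sets. -/
def IsTypeDef (κ : Cardinal.{w}) {α : Type*} (X : Set (α → M)) : Prop :=
  ∃ (ι : Type w) (D : ι → Set (α → M)), #ι < κ ∧ (∀ i, IsDef L (D i)) ∧ X = ⋂ i, D i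

/-- Two tuples of `M` have the same complete type over the empty set. -/
def SameType {k : ℕ} (a b : Fin k → M) : Prop :=
  ∀ ψ : L.Formula (Fin k), ψ.Realize a ↔ ψ.Realize b

variable (M) in
/-- A sort of imaginaries: the quotient of a power of `M` by an equivalence relation that is
definable without parameters. -/
structure ImagSort where
  arity : ℕ
  eqv : Setoid (Fin arity → M)
  definable : (∅ : Set M).Definable L
    {w : Fin arity ⊕ Fin arity → M | eqv (w ∘ Sum.inl) (w ∘ Sum.inr)}

variable {L}

/-- The elements of a sort of imaginaries. -/
def ImagSort.Elt (σ : ImagSort L M) : Type w := Quotient σ.eqv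

/-- The class of a tuple. -/
def ImagSort.cls (σ : ImagSort L M) (a : Fin σ.arity → M) : σ.Elt := Quotient.mk σ.eqv a

/-- An interpretable set: a set of imaginaries in some sort, definable with parameters. -/
def IsInterpretable {σ : ImagSort L M} (X : Set σ.Elt) : Prop :=
  IsDef L {a : Fin σ.arity → M | σ.cls a ∈ X}

/-- A map between interpretable sets is interpretable when its graph is. -/
def IsInterpretableMap {σ τ : ImagSort L M} {X : Set σ.Elt} {Y : Set τ.Elt} (f : X → Y) : Prop :=
  IsDef L {w : Fin σ.arity ⊕ Fin τ.arity → M |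
    ∃ x : X, (x : σ.Elt) = σ.cls (w ∘ Sum.inl) ∧ (f x : τ.Elt) = τ.cls (w ∘ Sum.inr)}

/-- A (fine, integer-valued) dimension function on the interpretable sets of `M`; the value `⊥`
stands for `-∞`. Values at non-interpretable sets are irrelevant. -/
structure IsDimension (dim : ∀ σ : ImagSort L M, Set σ.Elt → WithBot ℕ) : Prop where
  invariance : ∀ (σ : ImagSort L M) (k : ℕ) (φ : L.Formula (Fin σ.arity ⊕ Fin k))
    (a b : Fin k → M), SameType L a b →
    dim σ (σ.cls '' {x | φ.Realize (Sum.elim x a)}) =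
      dim σ (σ.cls '' {x | φ.Realize (Sum.elim x b)})
  algebraicity : ∀ (σ : ImagSort L M) (X : Set σ.Elt), IsInterpretable X →
    (dim σ X = 0 ↔ X.Finite ∧ X.Nonempty)
  empty : ∀ σ : ImagSort L M, dim σ ∅ = ⊥
  union : ∀ (σ : ImagSort L M) (X Y : Set σ.Elt), IsInterpretable X → IsInterpretable Y →
    dim σ (X ∪ Y) = max (dim σ X) (dim σ Y)
  fibration : ∀ (σ τ : ImagSort L M) (X : Set σ.Elt) (Y : Set τ.Elt),
    IsInterpretable X → IsInterpretable Y →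
    ∀ f : X → Y, IsInterpretableMap f → ∀ d : ℕ,
    (∀ y : Y, (d : WithBot ℕ) ≤ dim σ (Subtype.val '' (f ⁻¹' {y}))) →
    dim τ Y + (d : WithBot ℕ) ≤ dim σ X

variable (L M) in
/-- Finite-dimensionality, tested on the interpretable sets of the (saturated) model `M`. Every
model `M` of a finite-dimensional theory has this property. -/
def IsFiniteDimensional : Prop :=
  ∃ dim : ∀ σ : ImagSort L M, Set σ.Elt → WithBot ℕ, IsDimension dim

end General

section Groups

variable (L : FirstOrder.Language.{u, v}) {M : Type w} [L.Structure M]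
variable {n : ℕ} {V : Set (Fin n → M)} [AddCommGroup V]

/-- A definable subgroup. -/
def IsDefSubgroup (W : AddSubgroup V) : Prop :=
  IsDef L (Subtype.val '' (W : Set V))

/-- Connected: without definable proper subgroup of finite index. -/
def IsConnectedSubgroup (W : AddSubgroup V) : Prop :=
  ∀ H : AddSubgroup V, H ≤ W → IsDefSubgroup L H → H.relIndex W ≠ 0 → H = W

/-- `DefEnd(V)`, the definable endomorphisms of `V`. -/
def defEnd (V : Set (Fin n → M)) [AddCommGroup V] : Set (AddMonoid.End V) :=
  {f | IsDefMap L (fun x : V => f x)}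

/-- The centraliser of `S` in `DefEnd(V)`. -/
def defCentralizer (S : Set (AddMonoid.End V)) : Set (AddMonoid.End V) :=
  {f | f ∈ defEnd L V ∧ ∀ s ∈ S, s * f = f * s}

/-- `V` is irreducible under `S`: the definable, connected, `S`-invariant subgroups are trivial. -/
def IsIrreducibleUnder (S : Set (AddMonoid.End V)) : Prop :=
  ∀ W : AddSubgroup V, IsDefSubgroup L W → IsConnectedSubgroup L W →
    (∀ s ∈ S, ∀ x ∈ W, s x ∈ W) → W = ⊥ ∨ W = ⊤

/-- The endomorphism `s` has graph `Φ(z, V, V)`. -/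
def HasCode {k : ℕ} (Φ : Set (Fin k ⊕ (Fin n ⊕ Fin n) → M)) (z : Fin k → M)
    (s : AddMonoid.End V) : Prop :=
  ∀ x y : V, Sum.elim z (Sum.elim (x : Fin n → M) (y : Fin n → M)) ∈ Φ ↔ s x = y

/-- An invariant set of definable endomorphisms: a union of fewer than `κ` type-definable
families, the `i`-th family consisting of the endomorphisms with graphs `Φ i (z, V, V)` where `z`
runs over a type-definable set `Z i` of parameters. -/
def IsInvariantSet (κ : Cardinal.{w}) (S : Set (AddMonoid.End V)) : Prop :=
  ∃ (ι : Type w) (k : ι → ℕ) (Φ : ∀ i, Set (Fin (k i) ⊕ (Fin n ⊕ Fin n) → M))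
    (Z : ∀ i, Set (Fin (k i) → M)),
    #ι < κ ∧ (∀ i, IsDef L (Φ i)) ∧ (∀ i, IsTypeDef L κ (Z i)) ∧
    (∀ i, ∀ z ∈ Z i, ∃ s : AddMonoid.End V, HasCode (Φ i) z s) ∧
    S = {s | ∃ i, ∃ z ∈ Z i, HasCode (Φ i) z s}

/-- A definable set of endomorphisms: it is in bijection with a definable set `P` in such a way
that the evaluation map `P × V → V` is definable. (Addition and composition are then definable
on `P`.) -/
def IsDefSetOfEnd (S : Set (AddMonoid.End V)) : Prop :=
  ∃ (k : ℕ) (P : Set (Fin k → M)) (e : P ≃ S), IsDef L P ∧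
    IsDefMap₂ L (fun (p : P) (x : V) => (e p : AddMonoid.End V) x)

end Groups

end ZilberLemma

namespace ZilberLemma

open FirstOrder FirstOrder.Language Cardinal Set

/-! Two facts about definable subgroups drive the proof. Dimension drops strictly on passing to a
subgroup of infinite index (`vdim_lt_of_relIndex`), so a definable subgroup of full dimension in a
connected group is everything. A definable endomorphism that preserves the dimension of a subgroup
has finite kernel on it (`finite_ker_of_dim_le`). As in Schur's lemma, a non-zero element of `T` is
then surjective with finite kernel, and `S` is a prime ring (`prime`).

What prevents `T` from being a division ring is the possible existence of finite invariant
subgroups. By saturation, an infinite type-definable family of endomorphisms contains two distinct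
members agreeing on a given small set, provided finite parts of that set have finite orbits
(`exists_agree`). Applied to whichever of `S` and `T` is unbounded, this yields a non-zero element
of `S` killing every finite `T`-invariant subgroup. Such elements form a two-sided ideal, and an
argument with idempotents of maximal image (`one_mem_of_ideal`) shows that the ideal contains the
identity. So there are no such subgroups (`eq_bot_of_finite_inv`); then `S` is simple and `T` is a
division ring.

The core is `dfn_eval`: an unbounded invariant division ring `D` acts definably. Take a subfamily
`Y` whose orbit `Y a` has the largest dimension `d ≥ 1`. The sums `s a + s' b` with `b` in `D a`
stay in dimension `d`, whereas an injective sum map would need dimension `2d`. A coincidence of sums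
writes `b` as `(s₁ - s₂)⁻¹ (s₃ - s₄) a`. Thus one family describes all of `D`, the orbit `D a` is
recognised by a dimension condition, and compactness makes the action definable.

If only `S` is known to be unbounded, `dfn_eval` is applied to a corner `e S e` which is a division
ring. Rank-one maps of `e V`, extended through `1 ∈ S e S`, then show that `T` is unbounded too
(`unbounded_centralizer`). Finally `T` is identified with an orbit `T a`. Adding orbits increases
the dimension, so `V` has a finite basis; linear maps are definable from their values on it, and the
double centraliser condition puts them in `S`. -/

/-- A type whose elements are coded by the tuples of a definable subset of a finite power of
`M`. -/
class DSort (L : FirstOrder.Language.{u, v}) (M : Type w) [L.Structure M] (Γ : Type*) where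
  idx : Type
  fin : Finite idx
  emb : Γ → idx → M
  inj : Function.Injective emb
  rng : IsDef L (range emb)

attribute [instance] DSort.fin

/-! ### Calculus of definable predicates and functions on coded sorts. -/

section Toolkit

variable (L : FirstOrder.Language.{u, v}) (M : Type w) [L.Structure M]

instance DSort.pow (α : Type) [Finite α] : DSort L M (α → M) where
  idx := α
  fin := inferInstance
  emb := id
  inj := Function.injective_id
  rng := by rw [range_id]; exact definable_univ

instance DSort.prod (Γ Δ : Type*) [hΓ : DSort L M Γ] [hΔ : DSort L M Δ] : DSort L M (Γ × Δ) where
  idx := hΓ.idx ⊕ hΔ.idx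
  fin := inferInstance
  emb p := Sum.elim (hΓ.emb p.1) (hΔ.emb p.2)
  inj p q h := by
    have h1 : hΓ.emb p.1 = hΓ.emb q.1 := funext fun i => congrFun h (Sum.inl i)
    have h2 : hΔ.emb p.2 = hΔ.emb q.2 := funext fun i => congrFun h (Sum.inr i)
    exact Prod.ext (hΓ.inj h1) (hΔ.inj h2)
  rng := by
    have := (hΓ.rng.preimage_comp (Sum.inl : _ → hΓ.idx ⊕ hΔ.idx)).inter
      (hΔ.rng.preimage_comp (Sum.inr : _ → hΓ.idx ⊕ hΔ.idx))
    refine (congrArg (IsDef L) (Set.ext fun w => ⟨?_, ?_⟩)).mp this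
    · rintro ⟨⟨x, hx⟩, ⟨y, hy⟩⟩
      refine ⟨(x, y), ?_⟩
      simp only [hx, hy, Sum.elim_comp_inl_inr]
    · rintro ⟨p, rfl⟩
      exact ⟨⟨p.1, rfl⟩, ⟨p.2, rfl⟩⟩

instance DSort.coe {n : ℕ} (V : Set (Fin n → M)) [hV : Fact (IsDef L V)] : DSort L M V where
  idx := Fin n
  fin := inferInstance
  emb := Subtype.val
  inj := Subtype.val_injective
  rng := by rw [Subtype.range_coe]; exact hV.out

variable {Γ Δ Θ Ξ : Type*} [hΓ : DSort L M Γ] [hΔ : DSort L M Δ] [hΘ : DSort L M Θ]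
  [hΞ : DSort L M Ξ]

/-- Definable predicates. -/
def Dfn (P : Γ → Prop) : Prop :=
  IsDef L (hΓ.emb '' {x | P x})

/-- Definable functions. -/
@[fun_prop]
def DFun (f : Γ → Δ) : Prop :=
  Dfn L M (fun p : Γ × Δ => p.2 = f p.1)

variable {L M} {P Q : Γ → Prop}

lemma Dfn.congr (h : Dfn L M P) (hPQ : ∀ x, P x ↔ Q x) : Dfn L M Q := by
  rwa [show Q = P from funext fun x => propext (hPQ x).symm]

lemma Dfn.and (hP : Dfn L M P) (hQ : Dfn L M Q) : Dfn L M (fun x => P x ∧ Q x) := by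
  have := Definable.inter hP hQ
  rwa [← image_inter hΓ.inj] at this

lemma Dfn.or (hP : Dfn L M P) (hQ : Dfn L M Q) : Dfn L M (fun x => P x ∨ Q x) := by
  have := Definable.union hP hQ
  rwa [← image_union] at this

lemma Dfn.not (hP : Dfn L M P) : Dfn L M (fun x => ¬ P x) := by
  have := hΓ.rng.sdiff hP
  refine (congrArg (IsDef L) ?_).mp this
  rw [← image_univ, ← image_sdiff hΓ.inj]
  congr 1
  ext x
  simp

lemma Dfn.imp (hP : Dfn L M P) (hQ : Dfn L M Q) : Dfn L M (fun x => P x → Q x) :=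
  (hP.not.or hQ).congr fun _ => imp_iff_not_or.symm

lemma Dfn.const (p : Prop) : Dfn L M (fun _ : Γ => p) := by
  by_cases hp : p
  · exact (congrArg (IsDef L) (by simp [hp])).mp hΓ.rng
  · exact (congrArg (IsDef L) (by simp [hp])).mp (definable_empty (L := L) (A := univ))

lemma Dfn.forall_finite {ι : Sort*} [Finite ι] {P : ι → Γ → Prop} (hP : ∀ i, Dfn L M (P i)) :
    Dfn L M (fun x => ∀ i, P i x) := by
  have h : IsDef L (⋂ i : PLift ι, hΓ.emb '' {x | P i.down x}) :=
    definable_iInter_of_finite fun i => hP i.down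
  refine (congrArg (IsDef L) (Set.ext fun w => ⟨?_, ?_⟩)).mp (h.inter hΓ.rng)
  · rintro ⟨h, x, rfl⟩
    refine ⟨x, fun i => ?_, rfl⟩
    obtain ⟨y, hy, hxy⟩ := mem_iInter.1 h ⟨i⟩
    rwa [← hΓ.inj hxy]
  · rintro ⟨x, hx, rfl⟩
    exact ⟨mem_iInter.2 fun i => ⟨x, hx i.down, rfl⟩, x, rfl⟩

/-- Substitution of variables. -/
lemma Dfn.subst {P : Δ → Prop} (hP : Dfn L M P) (θ : Γ → Δ) (σ : hΔ.idx → hΓ.idx)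
    (h : ∀ x, hΔ.emb (θ x) = hΓ.emb x ∘ σ) : Dfn L M (fun x => P (θ x)) := by
  refine (congrArg (IsDef L) (Set.ext fun w => ⟨?_, ?_⟩)).mp
    ((Definable.preimage_comp σ hP).inter hΓ.rng)
  · rintro ⟨⟨y, hy, hxy⟩, x, rfl⟩
    exact ⟨x, by rwa [mem_ofPred_eq, hΔ.inj ((h x).trans hxy.symm)], rfl⟩
  · rintro ⟨x, hx, rfl⟩
    exact ⟨⟨θ x, hx, h x⟩, x, rfl⟩

lemma Dfn.ex {P : Γ → Δ → Prop} (hP : Dfn L M (fun p : Γ × Δ => P p.1 p.2)) :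
    Dfn L M (fun x => ∃ y, P x y) := by
  refine (congrArg (IsDef L) (Set.ext fun w => ⟨?_, ?_⟩)).mp
    (Definable.image_comp hP (Sum.inl : hΓ.idx → hΓ.idx ⊕ hΔ.idx))
  · rintro ⟨_, ⟨p, hp, rfl⟩, rfl⟩
    exact ⟨p.1, ⟨p.2, hp⟩, rfl⟩
  · rintro ⟨x, ⟨y, hy⟩, rfl⟩
    exact ⟨_, ⟨(x, y), hy, rfl⟩, rfl⟩

lemma Dfn.all {P : Γ → Δ → Prop} (hP : Dfn L M (fun p : Γ × Δ => P p.1 p.2)) :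
    Dfn L M (fun x => ∀ y, P x y) :=
  (Dfn.ex (P := fun x y => ¬ P x y) hP.not).not.congr fun x => by simp

lemma dfn_tuple_eq {α β : Type} [Finite α] [Finite β] (σ τ : β → α) :
    IsDef L {w : α → M | w ∘ σ = w ∘ τ} := by
  have : ∀ b : β, IsDef L {w : α → M | w (σ b) = w (τ b)} := fun b =>
    ⟨(Term.var (σ b)).equal (Term.var (τ b)), by ext; simp⟩
  refine (congrArg (IsDef L) ?_).mp (definable_iInter_of_finite this)
  ext w
  simp [funext_iff]

lemma dfn_diag : Dfn L M (fun p : Γ × Γ => p.1 = p.2) := by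
  refine (congrArg (IsDef L) (Set.ext fun w => ⟨?_, ?_⟩)).mp
    ((dfn_tuple_eq (Sum.inl : hΓ.idx → hΓ.idx ⊕ hΓ.idx) Sum.inr).inter
      (DSort.prod L M Γ Γ).rng)
  · rintro ⟨h, p, rfl⟩
    exact ⟨p, hΓ.inj (by simpa [DSort.emb] using h), rfl⟩
  · rintro ⟨p, hp, rfl⟩
    exact ⟨by simp [DSort.emb, (show p.1 = p.2 from hp)], p, rfl⟩

/-- The graph of a map that only rearranges coordinates is a pullback of the diagonal. Projections,
reindexings and inclusions are all of this kind. -/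
lemma DFun.of_subst (θ : Γ → Δ) (σ : hΔ.idx → hΓ.idx)
    (h : ∀ x, hΔ.emb (θ x) = hΓ.emb x ∘ σ) : DFun L M θ :=
  (dfn_diag (L := L) (M := M) (Γ := Δ)).subst (fun p : Γ × Δ => (p.2, θ p.1))
    (Sum.elim Sum.inr (Sum.inl ∘ σ)) fun p => by
      funext i
      cases i with
      | inl i => rfl
      | inr i => exact congrFun (h p.1) i

@[fun_prop] lemma DFun.id : DFun L M (fun x : Γ => x) := .of_subst _ _root_.id fun _ => rfl

@[fun_prop] lemma DFun.fst : DFun L M (fun p : Γ × Δ => p.1) := .of_subst _ Sum.inl fun _ => rfl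

@[fun_prop] lemma DFun.snd : DFun L M (fun p : Γ × Δ => p.2) := .of_subst _ Sum.inr fun _ => rfl

lemma Dfn.comp {P : Δ → Prop} (hP : Dfn L M P) {f : Γ → Δ} (hf : DFun L M f) :
    Dfn L M (fun x => P (f x)) := by
  have h : Dfn L M (fun p : Γ × Δ => P p.2) := hP.subst _ Sum.inr fun _ => rfl
  exact (Dfn.ex (P := fun x y => y = f x ∧ P y) (Dfn.and hf h)).congr fun x => by simp

lemma Dfn.rel₂ {R : Γ → Δ → Prop} (hR : Dfn L M (fun p : Γ × Δ => R p.1 p.2)) {f : Θ → Γ}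
    {g : Θ → Δ} (hf : DFun L M f) (hg : DFun L M g) : Dfn L M (fun x => R (f x) (g x)) := by
  have h1 : Dfn L M (fun q : (Θ × Γ) × Δ => R q.1.2 q.2) :=
    hR.subst (fun q : (Θ × Γ) × Δ => (q.1.2, q.2)) (Sum.elim (Sum.inl ∘ Sum.inr) Sum.inr)
      fun q => by funext i; cases i <;> rfl
  have h2 : Dfn L M (fun q : (Θ × Γ) × Δ => q.2 = g q.1.1) :=
    Dfn.subst (P := fun q : Θ × Δ => q.2 = g q.1) hg (fun q : (Θ × Γ) × Δ => (q.1.1, q.2))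
      (Sum.elim (Sum.inl ∘ Sum.inl) Sum.inr) fun q => by funext i; cases i <;> rfl
  have h3 : Dfn L M (fun q : Θ × Γ => ∃ y, y = g q.1 ∧ R q.2 y) := Dfn.ex (h2.and h1)
  exact (Dfn.ex (P := fun x z => z = f x ∧ ∃ y, y = g x ∧ R z y) (Dfn.and hf h3)).congr
    fun x => by simp

@[fun_prop] lemma DFun.comp {f : Δ → Θ} {g : Γ → Δ} (hf : DFun L M f) (hg : DFun L M g) :
    DFun L M (fun x => f (g x)) := by
  have h : DFun L M (fun p : Γ × Θ => g p.1) :=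
    Dfn.subst (P := fun q : Γ × Δ => q.2 = g q.1) hg (fun q : (Γ × Θ) × Δ => (q.1.1, q.2))
      (Sum.elim (Sum.inl ∘ Sum.inl) Sum.inr) fun q => by funext i; cases i <;> rfl
  exact Dfn.rel₂ (R := fun (x : Δ) (y : Θ) => y = f x) hf h DFun.snd

lemma Dfn.eq {f g : Γ → Δ} (hf : DFun L M f) (hg : DFun L M g) :
    Dfn L M (fun x => f x = g x) :=
  Dfn.rel₂ (R := fun x y : Δ => x = y) dfn_diag hf hg

@[fun_prop] lemma DFun.pair {f : Γ → Δ} {g : Γ → Θ} (hf : DFun L M f) (hg : DFun L M g) :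
    DFun L M (fun x => (f x, g x)) :=
  (((Dfn.eq (DFun.fst.comp DFun.snd) (hf.comp DFun.fst)).and
    (Dfn.eq (DFun.snd.comp DFun.snd) (hg.comp DFun.fst)) :
      Dfn L M (fun p : Γ × (Δ × Θ) => p.2.1 = f p.1 ∧ p.2.2 = g p.1))).congr
    fun p => (Prod.ext_iff (x := p.2) (y := (f p.1, g p.1))).symm

lemma Dfn.rel₃ {R : Γ → Δ → Θ → Prop} (hR : Dfn L M (fun p : Γ × Δ × Θ => R p.1 p.2.1 p.2.2))
    {f : Ξ → Γ} {g : Ξ → Δ} {h : Ξ → Θ} (hf : DFun L M f) (hg : DFun L M g) (hh : DFun L M h) :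
    Dfn L M (fun x => R (f x) (g x) (h x)) :=
  Dfn.comp hR (hf.pair (hg.pair hh))

/-- Fixed points become admissible parameters here: each coordinate of `c` is named by a constant.
-/
lemma dfn_eq_const (c : Γ) : Dfn L M (fun x : Γ => x = c) := by
  have h : ∀ i, IsDef L {w : hΓ.idx → M | w i = hΓ.emb c i} := fun i =>
    ⟨(Term.var i).equal (L.con (⟨hΓ.emb c i, mem_univ _⟩ : (univ : Set M))).term, by
      ext; simp⟩
  refine (congrArg (IsDef L) (Set.ext fun w => ⟨?_, ?_⟩)).mp (definable_iInter_of_finite h)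
  · intro h
    exact ⟨c, rfl, (funext fun i => mem_iInter.1 h i).symm⟩
  · rintro ⟨x, rfl, rfl⟩
    exact mem_iInter.2 fun i => rfl

@[fun_prop] lemma DFun.const (c : Δ) : DFun L M (fun _ : Γ => c) :=
  (dfn_eq_const c).comp DFun.snd

lemma dfn_mem_of_isDef {α : Type} [Finite α] {X : Set (α → M)} (hX : IsDef L X) :
    Dfn L M (fun w => w ∈ X) := by
  have : IsDef L (_root_.id '' X) := by rwa [image_id]
  exact this

lemma DFun.sumElim {α β : Type} [Finite α] [Finite β] :
    DFun L M (fun p : (α → M) × (β → M) => (Sum.elim p.1 p.2 : α ⊕ β → M)) :=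
  .of_subst _ _root_.id fun _ => rfl

lemma DFun.reindex {α β : Type} [Finite α] [Finite β] (σ : β → α) :
    DFun L M (fun w : α → M => w ∘ σ) :=
  .of_subst _ σ fun _ => rfl

@[fun_prop] lemma DFun.val {n : ℕ} {V : Set (Fin n → M)} [Fact (IsDef L V)] :
    DFun L M (fun x : V => (x : Fin n → M)) :=
  .of_subst _ _root_.id fun _ => rfl

lemma Dfn.isDef {P : Γ → Prop} (hP : Dfn L M P) : IsDef L (hΓ.emb '' {x | P x}) := hP

end Toolkit

/-! ### Compactness and type-definable predicates. -/

section Saturation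

/-- `M` is saturated in a regular uncountable cardinal `κ`. -/
structure IsMonster (L : FirstOrder.Language.{u, v}) (M : Type w) [L.Structure M]
    (κ : Cardinal.{w}) : Prop where
  regular : κ.IsRegular
  uncountable : ℵ₀ < κ
  saturated : IsSaturated L M κ

variable {L : FirstOrder.Language.{u, v}} {M : Type w} [L.Structure M] {κ : Cardinal.{w}}
variable {Γ Δ Θ : Type*} [hΓ : DSort L M Γ] [hΔ : DSort L M Δ] [hΘ : DSort L M Θ]

lemma IsMonster.mk_lt_of_finite (hM : IsMonster L M κ) (ι : Type w) [Finite ι] : #ι < κ :=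
  (mk_lt_aleph0 (α := ι)).trans hM.uncountable

lemma IsMonster.mk_finset_lt (hM : IsMonster L M κ) {ι : Type w} (hι : #ι < κ) :
    #(Finset ι) < κ := by
  cases finite_or_infinite ι
  · exact hM.mk_lt_of_finite _
  · rwa [mk_finset_of_infinite]

lemma IsMonster.mk_iUnion_lt (hM : IsMonster L M κ) {ι α : Type w} (hι : #ι < κ) {f : ι → Set α}
    (hf : ∀ i, #(f i) < κ) : #(⋃ i, f i : Set α) < κ :=
  (mk_iUnion_le_sum_mk).trans_lt (sum_lt_of_isRegular hM.regular hι hf)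

lemma exists_finset_definable {α : Type} {X : Set (α → M)} (hX : IsDef L X) :
    ∃ A : Finset M, (A : Set M).Definable L X := by
  obtain ⟨A, -, hA⟩ := definable_iff_finitely_definable.1 hX
  exact ⟨A, hA⟩

/-- Saturation for fewer than `κ` definable predicates. -/
theorem IsMonster.compactness (hM : IsMonster L M κ) {ι : Type w} (hι : #ι < κ)
    {D : ι → Γ → Prop} (hD : ∀ i, Dfn L M (D i))
    (hfin : ∀ J : Finset ι, ∃ x, ∀ i ∈ J, D i x) : ∃ x, ∀ i, D i x := by
  classical
  obtain ⟨x₀, -⟩ := hfin ∅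
  cases isEmpty_or_nonempty ι with
  | inl h => exact ⟨x₀, fun i => h.elim i⟩
  | inr h =>
  obtain ⟨n, ⟨e⟩⟩ := Finite.exists_equiv_fin hΓ.idx
  choose A hA using fun i => exists_finset_definable (hD i)
  -- Saturation concerns types over a single small set, so all predicates are moved to the union of
  -- their finite parameter sets.
  have hAU : ∀ i, (⋃ i, (A i : Set M)).Definable L (hΓ.emb '' {x | D i x}) := fun i =>
    (hA i).mono (subset_iUnion (fun i => (A i : Set M)) i)
  choose φ hφ using hAU
  have hreal : ∀ i (a : Fin n → M), ((φ i).relabel e).Realize a ↔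
      a ∘ e ∈ hΓ.emb '' {x | D i x} := fun i a => by
    rw [hφ i, Formula.realize_relabel]; rfl
  have hcard : #(⋃ i, (A i : Set M) : Set M) < κ :=
    hM.mk_iUnion_lt hι fun i => hM.mk_lt_of_finite _
  obtain ⟨a, ha⟩ := hM.saturated _ hcard n (range fun i => (φ i).relabel e) (by
    intro q hq
    rw [← image_univ] at hq
    obtain ⟨J, -, rfl⟩ := Finset.subset_set_image_iff.1 hq
    obtain ⟨x, hx⟩ := hfin J
    refine ⟨hΓ.emb x ∘ e.symm, fun ψ hψ => ?_⟩
    obtain ⟨i, hi, rfl⟩ := Finset.mem_image.1 hψ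
    rw [hreal]
    exact ⟨x, hx i hi, by ext; simp⟩)
  have ha' : ∀ i, a ∘ e ∈ hΓ.emb '' {x | D i x} := fun i => (hreal i a).1 (ha _ ⟨i, rfl⟩)
  -- The realisation is only a tuple; any one predicate places it in the range of the coding. This
  -- is why the empty index type is treated separately.
  obtain ⟨x, -, hx⟩ := ha' h.some
  refine ⟨x, fun i => ?_⟩
  obtain ⟨y, hy, hyx⟩ := ha' i
  rwa [← hΓ.inj (hyx.trans hx.symm)]

variable (L M) in
/-- Type-definable predicates. -/
def TDfn (κ : Cardinal.{w}) (P : Γ → Prop) : Prop :=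
  ∃ (ι : Type w) (D : ι → Γ → Prop), #ι < κ ∧ (∀ i, Dfn L M (D i)) ∧ ∀ x, P x ↔ ∀ i, D i x

lemma Dfn.tdfn (hM : IsMonster L M κ) {P : Γ → Prop} (hP : Dfn L M P) : TDfn L M κ P :=
  ⟨PUnit, fun _ => P, hM.mk_lt_of_finite _, fun _ => hP, fun _ => by simp⟩

lemma TDfn.comp {P : Δ → Prop} (hP : TDfn L M κ P) {f : Γ → Δ} (hf : DFun L M f) :
    TDfn L M κ (fun x => P (f x)) := by
  obtain ⟨ι, D, hι, hD, h⟩ := hP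
  exact ⟨ι, fun i x => D i (f x), hι, fun i => (hD i).comp hf, fun x => h (f x)⟩

lemma TDfn.and (hM : IsMonster L M κ) {P Q : Γ → Prop} (hP : TDfn L M κ P)
    (hQ : TDfn L M κ Q) : TDfn L M κ (fun x => P x ∧ Q x) := by
  obtain ⟨ι, D, hι, hD, h⟩ := hP
  obtain ⟨ι', D', hι', hD', h'⟩ := hQ
  refine ⟨ι ⊕ ι', Sum.elim D D', ?_, ?_, fun x => ?_⟩
  · rw [mk_sum, lift_id, lift_id]
    exact add_lt_of_lt hM.uncountable.le hι hι'
  · rintro (i | i)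
    · exact hD i
    · exact hD' i
  · exact (and_congr (h x) (h' x)).trans
      (Sum.forall (p := fun s => Sum.elim D D' s x)).symm

/-- Projections of type-definable sets are type-definable. -/
lemma TDfn.ex (hM : IsMonster L M κ) {P : Γ → Δ → Prop}
    (hP : TDfn L M κ (fun p : Γ × Δ => P p.1 p.2)) : TDfn L M κ (fun x => ∃ y, P x y) := by
  obtain ⟨ι, D, hι, hD, h⟩ := hP
  -- By compactness, the projection of the intersection is the intersection of the projections of
  -- its finite subintersections.
  refine ⟨Finset ι, fun J x => ∃ y, ∀ i : J, D i (x, y), hM.mk_finset_lt hι,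
    fun J => .ex (.forall_finite fun i => hD i), fun x => ⟨?_, fun hx => ?_⟩⟩
  · rintro ⟨y, hy⟩ J
    exact ⟨y, fun i => (h (x, y)).1 hy i⟩
  · obtain ⟨y, hy⟩ := hM.compactness (D := fun i y => D i (x, y)) hι
      (fun i => (hD i).comp (by fun_prop)) fun J => by
        obtain ⟨y, hy⟩ := hx J
        exact ⟨y, fun i hi => hy ⟨i, hi⟩⟩
    exact ⟨y, (h (x, y)).2 hy⟩

/-- If fewer than `κ` definable predicates `Ψ j` cover a power of a type-definable set `G`
(or the points whose projections lie in `G`), then finitely many of them cover the power of a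
definable set containing `G`. -/
theorem TDfn.exists_dfn_of_cover (hM : IsMonster L M κ) {G : Γ → Prop} (hG : TDfn L M κ G)
    {r : ℕ} {π : Fin r → Θ → Γ} (hπ : ∀ i, DFun L M (π i)) {ι' : Type w} (hι' : #ι' < κ)
    {Ψ : ι' → Θ → Prop} (hΨ : ∀ j, Dfn L M (Ψ j))
    (h : ∀ θ, (∀ i, G (π i θ)) → ∃ j, Ψ j θ) :
    ∃ G₀ : Γ → Prop, Dfn L M G₀ ∧ (∀ x, G x → G₀ x) ∧
      ∃ J : Finset ι', ∀ θ, (∀ i, G₀ (π i θ)) → ∃ j ∈ J, Ψ j θ := by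
  classical
  obtain ⟨ι, D, hι, hD, hGD⟩ := hG
  by_contra! hcon
  -- If no finite intersection of the `D i` and no finite subcover work, then "all projections lie
  -- in `G` and no `Ψ j` holds" is finitely satisfiable, against the cover.
  have key : ∃ θ, ∀ s : ι ⊕ ι', Sum.elim (fun i θ => ∀ k, D i (π k θ)) (fun j θ => ¬ Ψ j θ) s θ := by
    refine hM.compactness ?_ ?_ fun J => ?_
    · rw [mk_sum, lift_id, lift_id]
      exact add_lt_of_lt hM.uncountable.le hι hι'
    · rintro (i | j)
      · exact .forall_finite fun k => (hD i).comp (hπ k)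
      · exact (hΨ j).not
    · obtain ⟨θ, hθ, hθ'⟩ := hcon (fun x => ∀ i : J.toLeft, D i x)
        (.forall_finite fun i => hD i) (fun x hx i => (hGD x).1 hx i) J.toRight
      refine ⟨θ, ?_⟩
      rintro (i | j) hs
      · exact fun k => hθ k ⟨i, Finset.mem_toLeft.2 hs⟩
      · exact hθ' j (Finset.mem_toRight.2 hs)
  obtain ⟨θ, hθ⟩ := key
  obtain ⟨j, hj⟩ := h θ fun k => (hGD _).2 fun i => hθ (Sum.inl i) k
  exact hθ (Sum.inr j) hj

/-- A definable property of finite tuples of elements of a type-definable set holds for the tuples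
of some definable set containing it. -/
theorem TDfn.exists_dfn (hM : IsMonster L M κ) {G : Γ → Prop} (hG : TDfn L M κ G)
    {r : ℕ} {π : Fin r → Θ → Γ} (hπ : ∀ i, DFun L M (π i)) {Ψ : Θ → Prop} (hΨ : Dfn L M Ψ)
    (h : ∀ θ, (∀ i, G (π i θ)) → Ψ θ) :
    ∃ G₀ : Γ → Prop, Dfn L M G₀ ∧ (∀ x, G x → G₀ x) ∧ ∀ θ, (∀ i, G₀ (π i θ)) → Ψ θ := by
  obtain ⟨G₀, h1, h2, J, hJ⟩ := hG.exists_dfn_of_cover hM hπ (ι' := PUnit)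
    (hM.mk_lt_of_finite _) (Ψ := fun _ => Ψ) (fun _ => hΨ) fun θ hθ => ⟨⟨⟩, h θ hθ⟩
  exact ⟨G₀, h1, h2, fun θ hθ => (hJ θ hθ).choose_spec.2⟩

lemma IsTypeDef.tdfn {k : ℕ} {Z : Set (Fin k → M)} (hZ : IsTypeDef L κ Z) :
    TDfn L M κ (fun z => z ∈ Z) := by
  obtain ⟨ι, D, hι, hD, rfl⟩ := hZ
  exact ⟨ι, fun i z => z ∈ D i, hι, fun i => dfn_mem_of_isDef (hD i), fun x => mem_iInter⟩

end Saturation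

/-! ### Definability of the group operations. -/

section DefinableGroup

variable (L : FirstOrder.Language.{u, v}) {M : Type w} [L.Structure M] {n : ℕ}

/-- A definable abelian group. -/
class DefGroup (V : Set (Fin n → M)) [AddCommGroup V] : Prop where
  isDef : IsDef L V
  isDef_add : IsDefMap₂ L (fun x y : V => x + y)

instance DefGroup.fact (V : Set (Fin n → M)) [AddCommGroup V] [h : DefGroup L V] :
    Fact (IsDef L V) := ⟨h.isDef⟩

variable {L} {V : Set (Fin n → M)} [AddCommGroup V] [hV : DefGroup L V]
variable {Γ : Type*} [hΓ : DSort L M Γ]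

lemma isDefMap₂_iff {a b c : ℕ} {X : Set (Fin a → M)} {Y : Set (Fin b → M)} {Z : Set (Fin c → M)}
    [Fact (IsDef L X)] [Fact (IsDef L Y)] [Fact (IsDef L Z)] {f : X → Y → Z} :
    IsDefMap₂ L f ↔ DFun L M (fun p : X × Y => f p.1 p.2) := by
  have h : IsDefMap₂ L f ↔ Dfn L M (fun p : X × Y × Z => p.2.2 = f p.1 p.2.1) := by
    refine Iff.of_eq (congrArg (IsDef L) (Set.ext fun w => ⟨?_, ?_⟩))
    · rintro ⟨x, y, rfl⟩
      exact ⟨(x, y, f x y), rfl, rfl⟩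
    · rintro ⟨⟨x, y, z⟩, h, rfl⟩
      obtain rfl : z = f x y := h
      exact ⟨x, y, rfl⟩
  refine h.trans ⟨fun h => ?_, fun h => ?_⟩
  · exact h.comp (f := fun p : (X × Y) × Z => (p.1.1, p.1.2, p.2)) (by fun_prop)
  · exact Dfn.comp h (f := fun p : X × Y × Z => ((p.1, p.2.1), p.2.2)) (by fun_prop)

lemma dfn_add : DFun L M (fun p : V × V => p.1 + p.2) :=
  isDefMap₂_iff.1 hV.isDef_add

@[fun_prop] lemma DFun.add {f g : Γ → V} (hf : DFun L M f) (hg : DFun L M g) :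
    DFun L M (fun x => f x + g x) :=
  dfn_add.comp (hf.pair hg)

@[fun_prop] lemma DFun.neg {f : Γ → V} (hf : DFun L M f) : DFun L M (fun x => - f x) := by
  have h : Dfn L M (fun p : Γ × V => f p.1 + p.2 = 0) := .eq (by fun_prop) (by fun_prop)
  exact h.congr fun p => by rw [add_comm, add_eq_zero_iff_eq_neg]

@[fun_prop] lemma DFun.sub {f g : Γ → V} (hf : DFun L M f) (hg : DFun L M g) :
    DFun L M (fun x => f x - g x) := by
  simp only [sub_eq_add_neg]
  fun_prop

lemma mem_defEnd_iff {f : AddMonoid.End V} : f ∈ defEnd L V ↔ DFun L M (fun x => f x) := by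
  refine Iff.of_eq (congrArg (IsDef L) (Set.ext fun w => ⟨?_, ?_⟩))
  · rintro ⟨x, rfl⟩
    exact ⟨(x, f x), rfl, rfl⟩
  · rintro ⟨⟨x, y⟩, h, rfl⟩
    obtain rfl : y = f x := h
    exact ⟨x, rfl⟩

end DefinableGroup

/-! ### Dimension of definable subsets of `V`. -/

section Dimension

variable {L : FirstOrder.Language.{u, v}} {M : Type w} [L.Structure M]

variable (L M) in
/-- The sort of `n`-tuples of elements of `M`. -/
def realSort (n : ℕ) : ImagSort L M where
  arity := n
  eqv := ⊥
  definable := ⟨Formula.iInf fun i : Fin n =>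
      (Term.var (Sum.inl i)).equal (Term.var (Sum.inr i)), by
    ext w
    simp only [mem_ofPred_eq, Formula.realize_iInf, Formula.realize_equal, Term.realize_var]
    exact funext_iff⟩

lemma realSort_cls_injective (n : ℕ) : Function.Injective (realSort L M n).cls :=
  fun _ _ h => Quotient.exact h

lemma ImagSort.dfn_cls_eq (σ : ImagSort L M) :
    Dfn L M (fun p : (Fin σ.arity → M) × (Fin σ.arity → M) => σ.cls p.1 = σ.cls p.2) := by
  refine (congrArg (IsDef L) (Set.ext fun w => ⟨fun h => ?_, ?_⟩)).mp
    (σ.definable.mono (empty_subset univ))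
  · exact ⟨(w ∘ Sum.inl, w ∘ Sum.inr), Quotient.sound h, Sum.elim_comp_inl_inr w⟩
  · rintro ⟨p, hp, rfl⟩
    exact Quotient.exact (s := σ.eqv) hp

lemma isDef_of_dfn {α : Type} [Finite α] {X : Set (α → M)} (h : Dfn L M (fun w => w ∈ X)) :
    IsDef L X := by
  have h' : IsDef L (id '' X) := h
  rwa [image_id] at h'

variable (dim : ∀ σ : ImagSort L M, Set σ.Elt → WithBot ℕ)

/-- The dimension of a set of tuples. -/
def tdim {n : ℕ} (X : Set (Fin n → M)) : WithBot ℕ :=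
  dim (realSort L M n) ((realSort L M n).cls '' X)

lemma isInterpretable_realSort {n : ℕ} {X : Set (Fin n → M)} (hX : IsDef L X) :
    IsInterpretable ((realSort L M n).cls '' X) := by
  refine (congrArg (IsDef L) ?_).mp hX
  ext a
  exact ((realSort_cls_injective n).mem_set_image).symm

variable {dim} (hdim : IsDimension dim)
include hdim

lemma IsDimension.tdim_fibration {n : ℕ} {X : Set (Fin n → M)} (hX : IsDef L X)
    {τ : ImagSort L M} {Y : Set τ.Elt} (hY : IsInterpretable Y) {F : (Fin n → M) → τ.Elt}
    (hF : ∀ x ∈ X, F x ∈ Y)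
    (hgr : IsDef L {w : Fin n ⊕ Fin τ.arity → M | w ∘ Sum.inl ∈ X ∧
      F (w ∘ Sum.inl) = τ.cls (w ∘ Sum.inr)})
    (d : ℕ) (hd : ∀ y ∈ Y, (d : WithBot ℕ) ≤ tdim dim {x | x ∈ X ∧ F x = y}) :
    dim τ Y + d ≤ tdim dim X := by
  let r : (realSort L M n).Elt → (Fin n → M) := Quotient.lift id fun _ _ h => h
  have hr : ∀ a, (realSort L M n).cls (r a) = a := fun a => by
    induction a using Quotient.inductionOn
    rfl
  have hr' : ∀ a, r ((realSort L M n).cls a) = a := fun a => rfl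
  have hrX : ∀ x : (realSort L M n).cls '' X, r x ∈ X := by
    rintro ⟨_, x, hx, rfl⟩
    exact hx
  refine hdim.fibration (realSort L M n) τ _ Y (isInterpretable_realSort hX) hY
    (fun x => ⟨F (r x), hF _ (hrX x)⟩) ?_ d ?_
  · refine (congrArg (IsDef L) (Set.ext fun w => ⟨?_, ?_⟩)).mp hgr
    · rintro ⟨h1, h2⟩
      exact ⟨⟨_, w ∘ Sum.inl, h1, rfl⟩, rfl, h2⟩
    · rintro ⟨⟨_, x, hx, rfl⟩, h1, h2⟩
      obtain rfl : x = w ∘ Sum.inl := realSort_cls_injective n h1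
      exact ⟨hx, h2⟩
  · rintro ⟨y, hy⟩
    refine (hd y hy).trans (le_of_eq (congrArg (dim _) (Set.ext fun a => ⟨?_, ?_⟩)))
    · rintro ⟨x, ⟨hx, rfl⟩, rfl⟩
      exact ⟨⟨_, x, hx, rfl⟩, rfl, rfl⟩
    · rintro ⟨⟨_, x, hx, rfl⟩, h, rfl⟩
      exact ⟨x, ⟨hx, congrArg Subtype.val h⟩, rfl⟩

/-- A point has dimension `0`, and the union axiom bounds the dimension of `X` below by that of any
of its points. -/
lemma IsDimension.nonneg {σ : ImagSort L M} {X : Set σ.Elt} (hX : IsInterpretable X)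
    (hne : X.Nonempty) : 0 ≤ dim σ X := by
  obtain ⟨x, hx⟩ := hne
  obtain ⟨a, rfl⟩ : ∃ a, σ.cls a = x := Quotient.exists_rep x
  have hint : IsInterpretable ({σ.cls a} : Set σ.Elt) := by
    exact isDef_of_dfn ((σ.dfn_cls_eq).comp (f := fun w => (w, a)) (by fun_prop))
  have h0 := (hdim.algebraicity σ {σ.cls a} hint).2 ⟨finite_singleton _, singleton_nonempty _⟩
  have := hdim.union σ {σ.cls a} X hint hX
  rw [union_eq_self_of_subset_left (singleton_subset_iff.2 hx), h0] at this
  rw [this]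
  exact le_max_left _ _

omit hdim in
lemma dfn_val_image {n : ℕ} {V : Set (Fin n → M)} [Fact (IsDef L V)] {X : Set V}
    (hX : Dfn L M (fun x => x ∈ X)) : IsDef L (Subtype.val '' X) := hX

/-- The dimension of a subset of `V`. -/
def vdim (dim : ∀ σ : ImagSort L M, Set σ.Elt → WithBot ℕ) {n : ℕ} {V : Set (Fin n → M)}
    (X : Set V) : ℕ :=
  -- The empty set receives `0`, which keeps the values in `ℕ`; comparison with `tdim` therefore
  -- needs non-emptiness.
  (tdim dim (Subtype.val '' X)).unbotD 0

section

variable {n : ℕ} {V : Set (Fin n → M)} [hV : Fact (IsDef L V)]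

lemma IsDimension.coe_vdim {X : Set V} (hX : Dfn L M (fun x => x ∈ X)) (hne : X.Nonempty) :
    (vdim dim X : WithBot ℕ) = tdim dim (Subtype.val '' X) := by
  have h := hdim.nonneg (isInterpretable_realSort (dfn_val_image hX)) ((hne.image _).image _)
  unfold vdim tdim at *
  generalize dim _ _ = m at *
  cases m with
  | bot => simp at h
  | coe m => rfl

omit hV in
lemma IsDimension.vdim_empty : vdim dim (∅ : Set V) = 0 := by
  have : tdim dim (∅ : Set (Fin n → M)) = ⊥ := by
    exact (congrArg (dim _) (image_empty _)).trans (hdim.empty _)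
  rw [vdim, image_empty, this]
  rfl

lemma IsDimension.vdim_union {X Y : Set V} (hX : Dfn L M (fun x => x ∈ X))
    (hY : Dfn L M (fun x => x ∈ Y)) : vdim dim (X ∪ Y) = max (vdim dim X) (vdim dim Y) := by
  rcases X.eq_empty_or_nonempty with rfl | hX'
  · simp [hdim.vdim_empty]
  rcases Y.eq_empty_or_nonempty with rfl | hY'
  · simp [hdim.vdim_empty]
  have h : tdim dim (Subtype.val '' X ∪ Subtype.val '' Y) =
      max (tdim dim (Subtype.val '' X)) (tdim dim (Subtype.val '' Y)) := by
    have := hdim.union _ _ _ (isInterpretable_realSort (dfn_val_image hX))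
      (isInterpretable_realSort (dfn_val_image hY))
    unfold tdim
    rw [← this]
    exact congrArg _ (image_union _ _ _)
  rw [← image_union] at h
  rw [← hdim.coe_vdim (X := X ∪ Y) (hX.or hY) hX'.inl, ← hdim.coe_vdim hX hX', ← hdim.coe_vdim hY hY'] at h
  exact WithBot.coe_injective (h.trans (WithBot.coe_max _ _).symm)

lemma IsDimension.vdim_mono {X Y : Set V} (hX : Dfn L M (fun x => x ∈ X))
    (hY : Dfn L M (fun x => x ∈ Y)) (hXY : X ⊆ Y) : vdim dim X ≤ vdim dim Y := by
  rw [← union_eq_self_of_subset_left hXY, hdim.vdim_union hX hY]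
  exact le_max_left _ _

lemma IsDimension.vdim_biUnion_le {ι : Type*} {X : ι → Set V}
    (hX : ∀ i, Dfn L M (fun x => x ∈ X i)) {d : ℕ} (hd : ∀ i, vdim dim (X i) ≤ d)
    (J : Finset ι) :
    Dfn L M (fun x => x ∈ ⋃ j ∈ J, X j) ∧ vdim dim (⋃ j ∈ J, X j) ≤ d := by
  classical
  induction J using Finset.induction_on with
  | empty =>
    simp only [Finset.notMem_empty, iUnion_of_empty, iUnion_empty, mem_empty_iff_false,
      hdim.vdim_empty]
    exact ⟨.const _, zero_le⟩
  | insert i J _ ih =>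
    rw [Finset.set_biUnion_insert]
    exact ⟨(hX i).or ih.1, by rw [hdim.vdim_union (hX i) ih.1]; exact max_le (hd i) ih.2⟩

lemma IsDimension.vdim_finite {X : Set V} (hX : Dfn L M (fun x => x ∈ X))
    (h : vdim dim X = 0) : X.Finite := by
  rcases X.eq_empty_or_nonempty with rfl | hX'
  · exact finite_empty
  have h' := hdim.coe_vdim hX hX'
  rw [h] at h'
  have := ((hdim.algebraicity _ _ (isInterpretable_realSort (dfn_val_image hX))).1 h'.symm).1
  exact Finite.of_finite_image (this.of_finite_image (realSort_cls_injective n).injOn)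
    Subtype.val_injective.injOn

/-- Super-additivity of the dimension of a fibration of a subset of `V` over an interpretable
set. -/
lemma IsDimension.fibration_le {X : Set V} (hX : Dfn L M (fun x => x ∈ X))
    {τ : ImagSort L M} {Y : Set τ.Elt} (hY : IsInterpretable Y) {F : V → τ.Elt}
    (hF : ∀ x ∈ X, F x ∈ Y) (hsurj : ∀ y ∈ Y, ∃ x ∈ X, F x = y) (hne : X.Nonempty)
    (hgr : Dfn L M (fun p : V × (Fin τ.arity → M) => p.1 ∈ X ∧ F p.1 = τ.cls p.2))
    (hfib : ∀ y ∈ Y, Dfn L M (fun x => x ∈ X ∧ F x = y))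
    (d : ℕ) (hd : ∀ y ∈ Y, d ≤ vdim dim {x | x ∈ X ∧ F x = y}) :
    dim τ Y + d ≤ vdim dim X := by
  classical
  obtain ⟨x₀, -⟩ := id hne
  let F' : (Fin n → M) → τ.Elt := fun x => if h : x ∈ V then F ⟨x, h⟩ else F x₀
  have hF' : ∀ x : V, F' x = F x := fun x => dif_pos x.2
  rw [hdim.coe_vdim hX hne]
  refine hdim.tdim_fibration (dfn_val_image hX) hY (F := F') ?_ ?_ d ?_
  · rintro _ ⟨x, hx, rfl⟩
    rw [hF']
    exact hF x hx
  · refine (congrArg (IsDef L) (Set.ext fun w => ⟨?_, ?_⟩)).mp hgr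
    · rintro ⟨p, ⟨h1, h2⟩, rfl⟩
      exact ⟨⟨p.1, h1, rfl⟩, (hF' p.1).trans h2⟩
    · rintro ⟨⟨x, hx, hxw⟩, h⟩
      refine ⟨(x, w ∘ Sum.inr), ⟨hx, ?_⟩, ?_⟩
      · rw [← h, ← hxw, hF']
      · exact (congrArg₂ Sum.elim hxw rfl).trans (Sum.elim_comp_inl_inr w)
  · intro y hy
    have h := hdim.coe_vdim (X := {x | x ∈ X ∧ F x = y}) (hfib y hy) (hsurj y hy)
    have h' : ((d : ℕ) : WithBot ℕ) ≤ (vdim dim {x | x ∈ X ∧ F x = y} : WithBot ℕ) :=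
      Nat.cast_le.2 (hd y hy)
    rw [h] at h'
    refine h'.trans (le_of_eq (congrArg (tdim dim) (Set.ext fun a => ⟨?_, ?_⟩)))
    · rintro ⟨x, ⟨hx, rfl⟩, rfl⟩
      exact ⟨⟨x, hx, rfl⟩, hF' x⟩
    · rintro ⟨⟨x, hx, rfl⟩, rfl⟩
      exact ⟨x, ⟨hx, (hF' x).symm⟩, rfl⟩

/-- Super-additivity for a definable map between subsets of `V`. -/
lemma IsDimension.vdim_add_le {X Y : Set V} (hX : Dfn L M (fun x => x ∈ X))
    (hY : Dfn L M (fun x => x ∈ Y)) {f : V → V} (hf : ∀ x ∈ X, f x ∈ Y)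
    (hsurj : ∀ y ∈ Y, ∃ x ∈ X, f x = y) (hne : X.Nonempty)
    (hgr : Dfn L M (fun p : V × V => p.1 ∈ X ∧ f p.1 = p.2))
    (d : ℕ) (hd : ∀ y ∈ Y, d ≤ vdim dim {x | x ∈ X ∧ f x = y}) :
    vdim dim Y + d ≤ vdim dim X := by
  have hinj := (realSort_cls_injective (L := L) (M := M) n).comp
    (Subtype.val_injective (p := fun x => x ∈ V))
  have h := hdim.fibration_le (τ := realSort L M n)
    (F := fun x => (realSort L M n).cls (f x : Fin n → M)) hX
    (isInterpretable_realSort (dfn_val_image hY))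
    (fun x hx => ⟨_, ⟨f x, hf x hx, rfl⟩, rfl⟩) (by
      rintro _ ⟨_, ⟨y, hy, rfl⟩, rfl⟩
      obtain ⟨x, hx, rfl⟩ := hsurj y hy
      exact ⟨x, hx, rfl⟩) hne (by
      have h1 : Dfn L M (fun p : V × (Fin n → M) => ∃ y : V, (p.1 ∈ X ∧ f p.1 = y) ∧ p.2 = y) :=
        .ex (.and (hgr.comp (f := fun q : (V × (Fin n → M)) × V => (q.1.1, q.2)) (by fun_prop))
          (.eq (by fun_prop) (by fun_prop)))
      refine h1.congr fun p => ⟨?_, ?_⟩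
      · rintro ⟨y, ⟨h1, h2⟩, h3⟩
        exact ⟨h1, congrArg _ ((congrArg Subtype.val h2).trans h3.symm)⟩
      · rintro ⟨h1, h2⟩
        exact ⟨f p.1, ⟨h1, rfl⟩, (realSort_cls_injective n h2).symm⟩) (by
      rintro _ ⟨_, ⟨y, hy, rfl⟩, rfl⟩
      exact (hgr.comp (f := fun x => (x, y)) (by fun_prop)).congr fun x =>
        and_congr_right fun _ => hinj.eq_iff.symm) d (by
      rintro _ ⟨_, ⟨y, hy, rfl⟩, rfl⟩
      refine (hd y hy).trans (le_of_eq (congrArg _ (Set.ext fun x => ?_)))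
      exact and_congr_right fun _ => hinj.eq_iff.symm)
  change tdim dim (Subtype.val '' Y) + _ ≤ _ at h
  obtain ⟨x, hx⟩ := hne
  rw [← hdim.coe_vdim hY ⟨_, hf x hx⟩] at h
  exact_mod_cast h

/-- A definable image has smaller dimension. -/
lemma IsDimension.vdim_image_le {X Y : Set V} (hX : Dfn L M (fun x => x ∈ X))
    (hY : Dfn L M (fun x => x ∈ Y)) {f : V → V} (hf : ∀ x ∈ X, f x ∈ Y)
    (hsurj : ∀ y ∈ Y, ∃ x ∈ X, f x = y)
    (hgr : Dfn L M (fun p : V × V => p.1 ∈ X ∧ f p.1 = p.2)) :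
    vdim dim Y ≤ vdim dim X := by
  rcases X.eq_empty_or_nonempty with rfl | hne
  · have : Y = ∅ := eq_empty_of_forall_notMem fun y hy => by simpa using hsurj y hy
    rw [this]
  · exact hdim.vdim_add_le hX hY hf hsurj hne hgr 0 fun _ _ => zero_le

end

omit hdim in
/-- Elimination of imaginaries in the sorts: a definable equivalence relation on `V` is the kernel
of an interpretable map. -/
lemma exists_imagSort {n : ℕ} {V : Set (Fin n → M)} [Fact (IsDef L V)] {R : V → V → Prop}
    (hR : Equivalence R) (hRd : Dfn L M (fun p : V × V => R p.1 p.2)) :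
    ∃ (τ : ImagSort L M) (F : V → τ.Elt),
      Dfn L M (fun p : V × (Fin τ.arity → M) => F p.1 = τ.cls p.2) ∧
      ∀ x y, F x = F y ↔ R x y := by
  classical
  obtain ⟨A, hA⟩ := exists_finset_definable hRd.isDef
  obtain ⟨φ, hφ⟩ := definable_iff_exists_formula_sum.1 hA
  let e := A.equivFin
  let k := A.card
  let c : Fin k → M := fun i => e.symm i
  let Q : (Fin k → M) → (Fin n → M) → (Fin n → M) → Prop := fun c x y =>
    φ.Realize (Sum.elim (c ∘ e) (Sum.elim x y))
  have hQ' : ∀ (x : V) (y : Fin n → M), Q c x y ↔ ∃ y' : V, (y' : Fin n → M) = y ∧ R x y' := by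
    intro x y
    have h1 : (Sum.elim (x : Fin n → M) y : Fin n ⊕ Fin n → M) ∈
        {v | φ.Realize (Sum.elim (fun a : A => (a : M)) v)} ↔ Q c x y := by
      have : c ∘ e = fun a : A => (a : M) := funext fun a => by simp [c]
      simp only [Q, this]
      rfl
    rw [← h1]
    refine (Eq.to_iff (congrArg (fun s => (Sum.elim (x : Fin n → M) y) ∈ s)
      hφ.symm)).trans ⟨?_, ?_⟩
    · rintro ⟨⟨x', y'⟩, h, hxy⟩
      obtain rfl : x' = x := Subtype.ext (funext fun i => congrFun hxy (.inl i))
      exact ⟨y', funext fun i => congrFun hxy (.inr i), h⟩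
    · rintro ⟨y', rfl, h⟩
      exact ⟨(x, y'), h, rfl⟩
  let vec : (Fin (n + k) → M) → Fin n → M := fun u => u ∘ Fin.castAdd k
  let par : (Fin (n + k) → M) → Fin k → M := fun u => u ∘ Fin.natAdd n
  -- The parameters become extra coordinates, so that no parameter is left in the definition. For
  -- other parameter values `φ` need not define an equivalence relation; comparing the sets that it
  -- cuts out always gives one.
  let st : Setoid (Fin (n + k) → M) :=
    { r := fun u u' => par u = par u' ∧ ∀ y, Q (par u) (vec u) y ↔ Q (par u') (vec u') y
      iseqv := ⟨fun u => ⟨rfl, fun _ => Iff.rfl⟩, fun h => ⟨h.1.symm, fun y => (h.2 y).symm⟩,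
        fun h h' => ⟨h.1.trans h'.1, fun y => (h.2 y).trans (h'.2 y)⟩⟩ }
  have hst : (∅ : Set M).Definable L
      {w : Fin (n + k) ⊕ Fin (n + k) → M | st (w ∘ Sum.inl) (w ∘ Sum.inr)} := by
    have hφd : (∅ : Set M).Definable L {v | φ.Realize v} := empty_definable_iff.2 ⟨φ, rfl⟩
    have hpre : ∀ i : Fin (n + k) → Fin (n + k) ⊕ Fin (n + k), (∅ : Set M).Definable L
        {w : (Fin (n + k) ⊕ Fin (n + k)) ⊕ Fin n → M |
          Q (par ((w ∘ Sum.inl) ∘ i)) (vec ((w ∘ Sum.inl) ∘ i)) (w ∘ Sum.inr)} := fun i => by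
      refine (congrArg (Definable (L := L) ∅) (Set.ext fun w => Eq.to_iff
        (congrArg φ.Realize ?_))).mp (hφd.preimage_comp (Sum.elim
          (Sum.inl ∘ i ∘ Fin.natAdd n ∘ e) (Sum.elim (Sum.inl ∘ i ∘ Fin.castAdd k) Sum.inr)))
      funext j
      rcases j with j | j | j <;> rfl
    have h1 := (((hpre Sum.inl).compl.union (hpre Sum.inr)).inter
      ((hpre Sum.inr).compl.union (hpre Sum.inl))).forall_of_finite
    have h2 : (∅ : Set M).Definable L
        {w : Fin (n + k) ⊕ Fin (n + k) → M | par (w ∘ Sum.inl) = par (w ∘ Sum.inr)} :=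
      empty_definable_iff.2 ⟨Formula.iInf fun i : Fin k =>
        (Term.var (Sum.inl (Fin.natAdd n i))).equal (Term.var (Sum.inr (Fin.natAdd n i))), by
          ext w
          simp only [mem_ofPred_eq, Formula.realize_iInf, Formula.realize_equal,
            Term.realize_var]
          exact funext_iff⟩
    refine (congrArg (Definable (L := L) ∅) (Set.ext fun w => ?_)).mp (h2.inter h1)
    refine and_congr_right fun _ => forall_congr' fun y => ?_
    simp only [mem_inter_iff, mem_union, mem_compl_iff, mem_ofPred_eq, Sum.elim_comp_inl,
      Sum.elim_comp_inr]
    tauto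
  let τ : ImagSort L M := ⟨n + k, st, hst⟩
  let app : V → Fin (n + k) → M := fun x => Sum.elim (x : Fin n → M) c ∘ finSumFinEquiv.symm
  have hvec : ∀ x, vec (app x) = x := fun x => by ext i; simp [vec, app]
  have hpar : ∀ x, par (app x) = c := fun x => by ext i; simp [par, app]
  have happ : DFun L M app := (DFun.reindex finSumFinEquiv.symm).comp
    ((DFun.sumElim (α := Fin n) (β := Fin k)).comp (g := fun x : V => ((x : Fin n → M), c))
      (by fun_prop))
  refine ⟨τ, fun x => τ.cls (app x), ?_, fun x y => ?_⟩
  · exact τ.dfn_cls_eq.rel₂ (R := fun u u' => τ.cls u = τ.cls u') (happ.comp .fst) .snd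
  · have : τ.cls (app x) = τ.cls (app y) ↔ st (app x) (app y) := Quotient.eq
    rw [this]
    change (par _ = par _ ∧ ∀ z, Q (par _) (vec _) z ↔ Q (par _) (vec _) z) ↔ _
    simp only [hvec, hpar, true_and]
    simp only [hQ']
    refine ⟨fun h => ?_, fun h z => exists_congr fun z' => and_congr_right fun _ =>
      ⟨fun h' => hR.trans (hR.symm h) h', fun h' => hR.trans h h'⟩⟩
    obtain ⟨x', hx', h'⟩ := (h x).1 ⟨x, rfl, hR.refl x⟩
    rw [Subtype.ext hx'] at h'
    exact hR.symm h'

variable {n : ℕ} {V : Set (Fin n → M)} [AddCommGroup V] [hV : DefGroup L V]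

/-- The dimension drops in definable subgroups of infinite index. -/
lemma IsDimension.vdim_lt_of_relIndex {H W : AddSubgroup V} (hH : Dfn L M (fun x => x ∈ H))
    (hW : Dfn L M (fun x => x ∈ W)) (hHW : H ≤ W) (hi : H.relIndex W = 0) :
    vdim dim (H : Set V) < vdim dim (W : Set V) := by
  classical
  obtain ⟨τ, F, hFd, hF⟩ := exists_imagSort (L := L) (R := fun x y : V => y - x ∈ H)
    ⟨fun x => by simp, fun {x y} h => by simpa using H.neg_mem h,
      fun {x y z} h h' => by simpa using H.add_mem h' h⟩ (hH.comp (f := fun p : V × V => p.2 - p.1)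
        (by fun_prop))
  let Y : Set τ.Elt := F '' (W : Set V)
  have hYi : IsInterpretable Y := isDef_of_dfn (by
    have : Dfn L M (fun u : Fin τ.arity → M => ∃ x : V, x ∈ W ∧ F x = τ.cls u) :=
      .ex ((hW.comp .snd).and (hFd.comp (f := fun p : (Fin τ.arity → M) × V => (p.2, p.1))
        (by fun_prop)))
    exact this)
  have hYinf : Y.Infinite := by
    have : Infinite (W ⧸ H.addSubgroupOf W) := AddSubgroup.index_eq_zero_iff_infinite.1 hi
    refine infinite_of_injective_forall_mem (f := fun q : W ⧸ H.addSubgroupOf W => F q.out) ?_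
      fun q => ⟨_, q.out.2, rfl⟩
    intro q q' h
    have h' := (hF _ _).1 h
    rw [← q.out_eq', ← q'.out_eq']
    refine QuotientAddGroup.eq.2 ?_
    rw [AddSubgroup.mem_addSubgroupOf]
    rwa [sub_eq_neg_add] at h'
  have hgr : Dfn L M (fun p : V × (Fin τ.arity → M) => p.1 ∈ (W : Set V) ∧ F p.1 = τ.cls p.2) :=
    (hW.comp .fst).and hFd
  have hfib : ∀ x : V, Dfn L M (fun y => y ∈ (W : Set V) ∧ F y = F x) := fun x =>
    hW.and ((hH.comp (f := fun y => x - y) (by fun_prop)).congr fun y => (hF y x).symm)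
  -- The fibres of `W → W/H` are cosets, and `y ↦ x - y` carries the fibre through `x` onto `H`. The
  -- quotient is infinite, so it contributes at least `1`.
  have h := hdim.fibration_le hW hYi (F := F) (fun x hx => ⟨x, hx, rfl⟩)
    (fun y hy => hy) ⟨0, W.zero_mem⟩ hgr (by rintro _ ⟨x, -, rfl⟩; exact hfib x)
    (vdim dim (H : Set V)) (by
      rintro _ ⟨x, hx, rfl⟩
      refine hdim.vdim_image_le (X := {y | y ∈ (W : Set V) ∧ F y = F x}) (Y := (H : Set V))
        (hfib x) hH (f := fun y => x - y)
        (fun y hy => (hF y x).1 hy.2) (fun y hy => ⟨x - y, ⟨W.sub_mem hx (hHW hy),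
          (hF _ _).2 (by simpa using hy)⟩, by simp⟩) ?_
      exact ((hfib x).comp (f := fun p : V × V => p.1) .fst).and (.eq (by fun_prop) (by fun_prop)))
  have hY0 : (1 : WithBot ℕ) ≤ dim τ Y := by
    have h0 := hdim.nonneg hYi hYinf.nonempty
    have h1 : dim τ Y ≠ 0 := fun h0 => hYinf ((hdim.algebraicity τ Y hYi).1 h0).1
    generalize dim τ Y = m at *
    cases m with
    | bot => simp at h0
    | coe m =>
      have : m ≠ 0 := fun h => h1 (by rw [h]; rfl)
      exact WithBot.coe_le_coe.2 (Nat.one_le_iff_ne_zero.2 this)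
  have h2 : (1 : WithBot ℕ) + vdim dim (H : Set V) ≤ vdim dim (W : Set V) :=
    (add_le_add_left hY0 _).trans h
  have h3 : 1 + vdim dim (H : Set V) ≤ vdim dim (W : Set V) := by exact_mod_cast h2
  omega

end Dimension

/-! ### Connected subgroups, primeness of `S`, and idempotents. -/

section Algebra

lemma exists_max_of_bounded {α : Type*} (P : α → Prop) (f : α → ℕ) (N : ℕ) (hne : ∃ a, P a)
    (hN : ∀ a, P a → f a ≤ N) : ∃ a, P a ∧ ∀ b, P b → f b ≤ f a := by
  obtain ⟨a₀, h₀⟩ := hne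
  have hbdd : BddAbove (f '' {a | P a}) := ⟨N, by rintro _ ⟨a, ha, rfl⟩; exact hN a ha⟩
  obtain ⟨a, ha, hfa⟩ := Nat.sSup_mem (s := f '' {a | P a}) ⟨_, a₀, h₀, rfl⟩ hbdd
  exact ⟨a, ha, fun b hb => hfa ▸ le_csSup hbdd ⟨b, hb, rfl⟩⟩

lemma exists_min_nat {α : Type*} (P : α → Prop) (f : α → ℕ) (hne : ∃ a, P a) :
    ∃ a, P a ∧ ∀ b, P b → f a ≤ f b := by
  obtain ⟨a₀, h₀⟩ := hne
  obtain ⟨a, ha, hfa⟩ := Nat.sInf_mem (s := f '' {a | P a}) ⟨_, a₀, h₀, rfl⟩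
  exact ⟨a, ha, fun b hb => hfa ▸ Nat.sInf_le ⟨b, hb, rfl⟩⟩

lemma end_ext {V : Type*} [AddCommGroup V] {f g : AddMonoid.End V} (h : ∀ x, f x = g x) : f = g :=
  AddMonoidHom.ext h

/-- The algebraic content of a dimension on the definable subgroups of an abelian group: a lattice
of subgroups, a ring of endomorphisms, and a super-additive dimension. -/
structure GroupDim (V : Type*) [AddCommGroup V] where
  Def : AddSubgroup V → Prop
  Hom : Subring (AddMonoid.End V)
  dim : AddSubgroup V → ℕ
  def_bot : Def ⊥
  def_top : Def ⊤
  def_sup : ∀ {H W}, Def H → Def W → Def (H ⊔ W)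
  def_inf : ∀ {H W}, Def H → Def W → Def (H ⊓ W)
  def_map : ∀ {W f}, Def W → f ∈ Hom → Def (W.map (f : V →+ V))
  def_comap : ∀ {W f}, Def W → f ∈ Hom → Def (W.comap (f : V →+ V))
  dim_mono : ∀ {H W}, Def H → Def W → H ≤ W → dim H ≤ dim W
  dim_lt : ∀ {H W}, Def H → Def W → H ≤ W → H.relIndex W = 0 → dim H < dim W
  dim_map : ∀ {W f}, Def W → f ∈ Hom →
    dim (W.map (f : V →+ V)) + dim (W ⊓ AddMonoidHom.ker (f : V →+ V)) ≤ dim W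
  finite_of_dim : ∀ {W}, Def W → dim W = 0 → (W : Set V).Finite
  exists_div : ∀ {W u h}, Def W → u ∈ Hom → h ∈ Hom → (∀ x, ∃! y, y ∈ W ∧ u y = h x) →
    ∃ k ∈ Hom, ∀ x, k x ∈ W ∧ u (k x) = h x

namespace GroupDim

variable {V : Type*} [AddCommGroup V] (G : GroupDim V)

/-- Connectedness relative to the definable subgroups. -/
def Conn (W : AddSubgroup V) : Prop :=
  ∀ H : AddSubgroup V, H ≤ W → G.Def H → H.relIndex W ≠ 0 → H = W

variable {G}

lemma Conn.le_of_relIndex {W H : AddSubgroup V} (hW : G.Conn W) (hWd : G.Def W) (hH : G.Def H)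
    (h : H.relIndex W ≠ 0) : W ≤ H := by
  have := hW (H ⊓ W) inf_le_right (G.def_inf hH hWd) (by rwa [AddSubgroup.inf_relIndex_right])
  exact inf_eq_right.1 this

lemma Conn.map {W : AddSubgroup V} (hW : G.Conn W) (hWd : G.Def W) {f : AddMonoid.End V}
    (hf : f ∈ G.Hom) : G.Conn (W.map (f : V →+ V)) := by
  intro H hHW hH hi
  have e := AddSubgroup.relIndex_comap H (f : V →+ V) W
  exact le_antisymm hHW (AddSubgroup.map_le_iff_le_comap.2
    (hW.le_of_relIndex hWd (G.def_comap hH hf) fun h => hi (e.symm.trans h)))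

lemma Conn.sup {W W' : AddSubgroup V} (hW : G.Conn W) (hWd : G.Def W) (hW' : G.Conn W')
    (hWd' : G.Def W') : G.Conn (W ⊔ W') := by
  intro H hH hHd hi
  refine le_antisymm hH (sup_le (hW.le_of_relIndex hWd hHd fun h => hi ?_)
    (hW'.le_of_relIndex hWd' hHd fun h => hi ?_))
  · exact AddSubgroup.relIndex_eq_zero_of_le_right le_sup_left h
  · exact AddSubgroup.relIndex_eq_zero_of_le_right le_sup_right h

/-- Infinite index would make the dimension drop. This is how extremal choices of dimension become
equalities of subgroups. -/
lemma Conn.eq_of_dim_le {W H : AddSubgroup V} (hW : G.Conn W) (hWd : G.Def W) (hH : G.Def H)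
    (h : H ≤ W) (hd : G.dim W ≤ G.dim H) : H = W :=
  hW H h hH fun hi => (G.dim_lt hH hWd h hi).not_ge hd

/-- Super-additivity leaves only dimension `0` for the kernel when the image already takes all of
`dim W`. -/
lemma finite_ker_of_dim_le {W : AddSubgroup V} (hW : G.Def W) {f : AddMonoid.End V}
    (hf : f ∈ G.Hom) (h : G.dim W ≤ G.dim (W.map (f : V →+ V))) :
    ((W ⊓ AddMonoidHom.ker (f : V →+ V) : AddSubgroup V) : Set V).Finite := by
  refine G.finite_of_dim (G.def_inf hW ?_) ?_
  · exact G.def_comap G.def_bot hf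
  · have := G.dim_map hW hf
    omega

variable (G) in
/-- A pair of mutually centralising rings of definable endomorphisms, the first irreducible. -/
structure IsPair (S T : Subring (AddMonoid.End V)) : Prop where
  conn : G.Conn ⊤
  S_le : S ≤ G.Hom
  T_le : T ≤ G.Hom
  comm : ∀ s ∈ S, ∀ t ∈ T, s * t = t * s
  mem_T : ∀ f ∈ G.Hom, (∀ s ∈ S, s * f = f * s) → f ∈ T
  mem_S : ∀ f ∈ G.Hom, (∀ t ∈ T, t * f = f * t) → f ∈ S
  irr : ∀ W, G.Def W → G.Conn W → (∀ s ∈ S, ∀ x ∈ W, s x ∈ W) → W = ⊥ ∨ W = ⊤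
  S_inf : Infinite S
  T_inf : Infinite T

variable {S T : Subring (AddMonoid.End V)}

/-- The image of an endomorphism. -/
def im (f : AddMonoid.End V) : AddSubgroup V := (⊤ : AddSubgroup V).map (f : V →+ V)

lemma mem_im {f : AddMonoid.End V} {y : V} : y ∈ im f ↔ ∃ x, f x = y :=
  ⟨fun ⟨x, _, h⟩ => ⟨x, h⟩, fun ⟨x, h⟩ => ⟨x, trivial, h⟩⟩

lemma im_eq_bot {f : AddMonoid.End V} : im f = ⊥ ↔ f = 0 := by
  refine ⟨fun h => end_ext fun x => ?_, fun h => ?_⟩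
  · have : f x ∈ im f := mem_im.2 ⟨x, rfl⟩
    rw [h] at this
    exact this
  · subst h
    exact (AddSubgroup.eq_bot_iff_forall _).2 fun y hy => by
      obtain ⟨x, rfl⟩ := mem_im.1 hy
      rfl

lemma def_im {f : AddMonoid.End V} (hf : f ∈ G.Hom) : G.Def (im f) := G.def_map G.def_top hf

lemma map_im (f g : AddMonoid.End V) : (im g).map (f : V →+ V) = im (f * g) :=
  AddSubgroup.map_map _ _ _

/-- Only finitely many maps `N → N` exist, so two distinct elements of `R` agree on `N`; their
difference kills it. -/
lemma exists_ne_zero_kill {R : Subring (AddMonoid.End V)} [Infinite R] {N : AddSubgroup V}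
    (hN : (N : Set V).Finite) (hR : ∀ r ∈ R, ∀ x ∈ N, r x ∈ N) :
    ∃ r ∈ R, r ≠ 0 ∧ ∀ x ∈ N, r x = 0 := by
  have : Finite N := hN
  obtain ⟨r, r', hne, h⟩ := Finite.exists_ne_map_eq_of_infinite
    fun (r : R) (x : N) => (⟨(r : AddMonoid.End V) x, hR r r.2 x x.2⟩ : N)
  refine ⟨r - r', R.sub_mem r.2 r'.2, sub_ne_zero.2 fun h => hne (Subtype.ext h), fun x hx => ?_⟩
  have := congrArg Subtype.val (congrFun h ⟨x, hx⟩)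
  exact sub_eq_zero.2 this

namespace IsPair

variable (hP : G.IsPair S T)
include hP

lemma comm_apply {s t : AddMonoid.End V} (hs : s ∈ S) (ht : t ∈ T) (x : V) :
    s (t x) = t (s x) :=
  DFunLike.congr_fun (hP.comm s hs t ht) x

lemma conn_im {f : AddMonoid.End V} (hf : f ∈ G.Hom) : G.Conn (im f) :=
  hP.conn.map G.def_top hf

/-- Schur's lemma: the image is definable, connected and `S`-invariant. No such conclusion holds yet
for the kernel, which need not be connected. -/
lemma surjective {t : AddMonoid.End V} (ht : t ∈ T) (h0 : t ≠ 0) : Function.Surjective t := by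
  have h := (hP.irr (im t) (def_im (hP.T_le ht)) (hP.conn_im (hP.T_le ht)) fun s hs x hx => by
    obtain ⟨y, rfl⟩ := mem_im.1 hx
    exact mem_im.2 ⟨s y, (hP.comm_apply hs ht y).symm⟩).resolve_left fun h => h0 (im_eq_bot.1 h)
  exact fun y => mem_im.1 (h ▸ AddSubgroup.mem_top y)

lemma finite_ker {t : AddMonoid.End V} (ht : t ∈ T) (h0 : t ≠ 0) : {x | t x = 0}.Finite := by
  have h := finite_ker_of_dim_le G.def_top (hP.T_le ht) (le_of_eq (congrArg G.dim
    ((AddSubgroup.eq_top_iff' _).2 fun y => by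
      obtain ⟨x, rfl⟩ := hP.surjective ht h0 y
      exact ⟨x, trivial, rfl⟩)).symm)
  rwa [top_inf_eq] at h

/-- The images of the `s * b` generate an `S`-invariant subgroup, which is all of `V` once known to
be definable and connected; `a` vanishes on it. -/
lemma prime {a b : AddMonoid.End V} (hb : b ∈ S) (hb0 : b ≠ 0)
    (h : ∀ s ∈ S, a * s * b = 0) : a = 0 := by
  let U : AddSubgroup V := ⨆ s : S, im ((s : AddMonoid.End V) * b)
  obtain ⟨W, ⟨hWd, hWc, hWU⟩, hmax⟩ := exists_max_of_bounded
    (fun W => G.Def W ∧ G.Conn W ∧ W ≤ U) G.dim (G.dim ⊤)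
    ⟨im b, def_im (hP.S_le hb), hP.conn_im (hP.S_le hb), by
      have := le_iSup (fun s : S => im ((s : AddMonoid.End V) * b)) 1
      simpa using this⟩ fun W hW => G.dim_mono hW.1 G.def_top le_top
  have hle : ∀ s ∈ S, im (s * b) ≤ W := by
    intro s hs
    have hsb := hP.S_le (S.mul_mem hs hb)
    -- A definable connected `W` of largest dimension inside `U` absorbs each image, so the infinite
    -- sum `U` is `W` itself.
    have hc := hWc.sup hWd (hP.conn_im hsb) (def_im hsb)
    have hd := G.def_sup hWd (def_im hsb)
    have := hc.eq_of_dim_le hd hWd le_sup_left (hmax _ ⟨hd, hc, sup_le hWU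
      (le_iSup (fun s : S => im ((s : AddMonoid.End V) * b)) ⟨s, hs⟩)⟩)
    exact this ▸ le_sup_right
  have hWU' : W = U := le_antisymm hWU (iSup_le fun s => hle s s.2)
  have hU : ∀ K : AddSubgroup V, (∀ s ∈ S, ∀ x, s (b x) ∈ K) → U ≤ K := fun K hK =>
    iSup_le fun s y hy => by
      obtain ⟨x, rfl⟩ := mem_im.1 hy
      exact hK s s.2 x
  have hmem : ∀ s ∈ S, ∀ x, s (b x) ∈ U := fun s hs x =>
    le_iSup (fun s : S => im ((s : AddMonoid.End V) * b)) ⟨s, hs⟩ (mem_im.2 ⟨x, rfl⟩)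
  have htop : U = ⊤ := by
    refine (hP.irr U (hWU' ▸ hWd) (hWU' ▸ hWc) fun s hs x hx => ?_).resolve_left fun h => hb0 ?_
    · exact hU (U.comap (s : V →+ V)) (fun s' hs' x => hmem (s * s') (S.mul_mem hs hs') x) hx
    · refine end_ext fun x => ?_
      have := hmem 1 S.one_mem x
      rw [h] at this
      exact this
  refine end_ext fun x => ?_
  have : U ≤ AddMonoidHom.ker (a : V →+ V) := hU _ fun s hs x => DFunLike.congr_fun (h s hs) x
  exact this (htop ▸ AddSubgroup.mem_top x)

/-- An element of `S` inducing an automorphism of its image yields a projection onto its image. -/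
lemma exists_projection {q : AddMonoid.End V} (hqS : q ∈ S) (himqq : im (q * q) = im q)
    (hinj : ∀ x, q (q x) = 0 → q x = 0) :
    ∃ f ∈ S, ∃ g ∈ S, g * q = f ∧ f * f = f ∧ q * f = q ∧ (∀ x, f x ∈ im q) ∧
      ∀ x ∈ im q, f x = x := by
  have hqHom := hP.S_le hqS
  have huniq' : ∀ x y, x ∈ im q → y ∈ im q → q x = q y → x = y := by
    intro x y hx hy hxy
    obtain ⟨x', rfl⟩ := mem_im.1 hx
    obtain ⟨y', rfl⟩ := mem_im.1 hy
    have := hinj (x' - y') (by rw [map_sub, map_sub, hxy, sub_self])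
    rwa [map_sub, sub_eq_zero] at this
  have huniq : ∀ h ∈ G.Hom, im h ≤ im q → ∃ k ∈ G.Hom, ∀ x, k x ∈ im q ∧ q (k x) = h x := by
    intro h hh him
    refine G.exists_div (def_im hqHom) hqHom hh fun x => ?_
    obtain ⟨y, hy⟩ := mem_im.1 (himqq ▸ him (mem_im.2 ⟨x, rfl⟩) : h x ∈ im (q * q))
    exact ⟨q y, ⟨mem_im.2 ⟨y, rfl⟩, hy⟩, fun z hz =>
      huniq' _ _ hz.1 (mem_im.2 ⟨y, rfl⟩) (hz.2.trans hy.symm)⟩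
  have hTim : ∀ t ∈ T, ∀ x ∈ im q, t x ∈ im q := by
    intro t ht x hx
    obtain ⟨y, rfl⟩ := mem_im.1 hx
    exact mem_im.2 ⟨t y, hP.comm_apply hqS ht y⟩
  -- A quotient by `q` with values in the `T`-invariant group `im q` is unique, hence commutes with
  -- `T`, hence lies in `S`.
  have hkS : ∀ h ∈ S, ∀ k ∈ G.Hom, (∀ x, k x ∈ im q ∧ q (k x) = h x) → k ∈ S := by
    intro h hh k hk hkq
    refine hP.mem_S k hk fun t ht => end_ext fun x => ?_
    refine huniq' _ _ (hTim t ht _ (hkq x).1) (hkq _).1 ?_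
    exact ((hP.comm_apply hqS ht (k x)).trans (congrArg t (hkq x).2)).trans
      ((hP.comm_apply hh ht x).symm.trans (hkq (t x)).2.symm)
  -- With `q'` the inverse of `q` on `im q`, the choices are `f = q' q` and `g = q' f`.
  obtain ⟨f, hfHom, hf⟩ := huniq q hqHom le_rfl
  have hfS := hkS q hqS f hfHom hf
  obtain ⟨g, hgHom, hg⟩ := huniq f hfHom fun y hy => by
    obtain ⟨x, rfl⟩ := mem_im.1 hy
    exact (hf x).1
  have hfix : ∀ x ∈ im q, f x = x := fun x hx => huniq' _ _ (hf x).1 hx (hf x).2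
  refine ⟨f, hfS, g, hkS f hfS g hgHom hg, end_ext fun x => ?_, end_ext fun x => hfix _ (hf x).1,
    end_ext fun x => (hf x).2, fun x => (hf x).1, hfix⟩
  refine huniq' _ _ (hg _).1 (hf x).1 ?_
  exact ((hg (q x)).2.trans (hfix _ (mem_im.2 ⟨x, rfl⟩))).trans (hf x).2.symm

/-- An ideal all of whose elements are injective on their image as soon as they preserve it
contains the identity. -/
lemma one_mem_of_ideal (I : AddMonoid.End V → Prop) (hIS : ∀ i, I i → i ∈ S)
    (hI0 : I 0) (hadd : ∀ i j, I i → I j → I (i + j)) (hl : ∀ s ∈ S, ∀ i, I i → I (s * i))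
    (hr : ∀ s ∈ S, ∀ i, I i → I (i * s)) (hne : ∃ i, I i ∧ i ≠ 0)
    (hinj : ∀ i, I i → (im (i * i) = im i) → ∀ x, i (i x) = 0 → i x = 0) : I 1 := by
  -- An idempotent of `I` with largest image must be `1`: otherwise a non-zero idempotent of `I`
  -- orthogonal to it can be added.
  obtain ⟨e, ⟨heI, hee⟩, hmax⟩ := exists_max_of_bounded
    (fun e => I e ∧ e * e = e) (fun e => G.dim (im e)) (G.dim ⊤) ⟨0, hI0, by simp⟩
    fun e he => G.dim_mono (def_im (hP.S_le (hIS e he.1))) G.def_top le_top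
  have heS := hIS e heI
  by_cases he1 : e = 1
  · exact he1 ▸ heI
  exfalso
  set c : AddMonoid.End V := 1 - e with hc
  have hcS : c ∈ S := S.sub_mem S.one_mem heS
  have hc0 : c ≠ 0 := sub_ne_zero.2 (Ne.symm he1)
  have hcc : c * c = c := by simp [hc, mul_sub, sub_mul, hee]
  have hec : e * c = 0 := by simp [hc, mul_sub, hee]
  have hce : c * e = 0 := by simp [hc, sub_mul, hee]
  -- Two applications of primeness show that the corner `c S c` meets `I` non-trivially; `s` has
  -- smallest image there.
  obtain ⟨s, ⟨hsI, hs0, hcs, hsc⟩, hmin⟩ := exists_min_nat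
    (fun s => I s ∧ s ≠ 0 ∧ c * s = s ∧ s * c = s) (fun s => G.dim (im s)) (by
      obtain ⟨i, hi, hi0⟩ := hne
      by_contra! hcon
      have hcic : ∀ s ∈ S, c * s * i * c = 0 := fun s hs => by
        by_contra hne
        refine hcon (c * s * i * c) (hr _ hcS _ (hl _ (S.mul_mem hcS hs) _ hi)) hne ?_ ?_
        · simp only [← mul_assoc, hcc]
        · rw [mul_assoc, hcc]
      have hicne : ∃ s ∈ S, i * s * c ≠ 0 := by
        by_contra! h
        exact hi0 (hP.prime hcS hc0 h)
      obtain ⟨s', hs', h'⟩ := hicne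
      refine hc0 (hP.prime (b := i * s' * c) (S.mul_mem (S.mul_mem (hIS i hi) hs') hcS) h' ?_)
      intro s hs
      by_contra hne
      refine hcon (c * s * (i * s' * c)) (hl _ (S.mul_mem hcS hs) _
        (hr _ hcS _ (hr _ hs' _ hi))) hne ?_ ?_
      · simp only [← mul_assoc, hcc]
      · simp only [mul_assoc, hcc])
  have hsS := hIS s hsI
  obtain ⟨i, hiS, hi⟩ : ∃ i ∈ S, s * i * s ≠ 0 := by
    by_contra! h
    exact hs0 (hP.prime hsS hs0 h)
  have hminle : ∀ g, I g → g ≠ 0 → c * g = g → g * c = g → im g ≤ im s → im g = im s :=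
    fun g hg h0 h1 h2 h3 => (hP.conn_im (hP.S_le hsS)).eq_of_dim_le (def_im (hP.S_le hsS))
      (def_im (hP.S_le (hIS g hg))) h3 (hmin g ⟨hg, h0, h1, h2⟩)
  -- By minimality `q` and `q * s` have the image of `s`, so `q` maps its own image onto itself and
  -- yields a projection in the corner.
  set q : AddMonoid.End V := s * i * c with hq
  have hqI : I q := hr _ hcS _ (hr _ hiS _ hsI)
  have hqs : q * s = s * i * s := by rw [hq, mul_assoc, hcs]
  have hcq : c * q = q := by rw [hq, ← mul_assoc, ← mul_assoc, hcs]
  have hqc : q * c = q := by rw [hq, mul_assoc, hcc]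
  have hqs0 : q * s ≠ 0 := hqs ▸ hi
  have hq0 : q ≠ 0 := fun h => hqs0 (by rw [h, zero_mul])
  have himq : im q = im s := hminle q hqI hq0 hcq hqc fun y hy => by
    obtain ⟨x, rfl⟩ := mem_im.1 hy
    exact mem_im.2 ⟨i (c x), rfl⟩
  have himqs : im (q * s) = im s := hminle (q * s) (hr _ hsS _ hqI) hqs0
    (by rw [← mul_assoc, hcq]) (by rw [mul_assoc, hsc]) fun y hy => by
      obtain ⟨x, rfl⟩ := mem_im.1 hy
      exact mem_im.2 ⟨i (c (s x)), rfl⟩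
  have himqq : im (q * q) = im q := by
    rw [← map_im, himq, map_im, himqs]
  obtain ⟨f, hfS, g, hgS, hgq, hff, hqf, hfq, hfix⟩ :=
    hP.exists_projection (hIS q hqI) himqq (hinj q hqI himqq)
  have hfI : I f := hgq ▸ hl g hgS q hqI
  have hfc : f * c = f := by rw [← hgq, mul_assoc, hqc]
  have hcf : c * f = f := end_ext fun x => by
    obtain ⟨y, hy⟩ := mem_im.1 (hfq x)
    change c (f x) = f x
    rw [← hy]
    exact DFunLike.congr_fun hcq y
  have hef : e * f = 0 := by rw [← hcf, ← mul_assoc, hec, zero_mul]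
  have hfe : f * e = 0 := by rw [← hfc, mul_assoc, hce, mul_zero]
  have hf0 : f ≠ 0 := fun h => hq0 (by rw [← hqf, h, mul_zero])
  have hidem : (e + f) * (e + f) = e + f := by
    rw [mul_add, add_mul, add_mul, hee, hff, hef, hfe, add_zero, zero_add]
  have hle : im e ≤ im (e + f) := fun y hy => by
    obtain ⟨x, rfl⟩ := mem_im.1 hy
    have : (e + f) * e = e := by rw [add_mul, hee, hfe, add_zero]
    exact mem_im.2 ⟨e x, DFunLike.congr_fun this x⟩
  have hefI := hadd e f heI hfI
  -- By maximality `e + f` has the same image as `e`, so `im f ≤ im e`. Since `f * e = 0`, the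
  -- projection `f` vanishes on its own image.
  have heq := (hP.conn_im (hP.S_le (hIS _ hefI))).eq_of_dim_le (def_im (hP.S_le (hIS _ hefI)))
    (def_im (hP.S_le heS)) hle (hmax (e + f) ⟨hefI, hidem⟩)
  have hfim : im f ≤ im (e + f) := fun y hy => by
    obtain ⟨x, rfl⟩ := mem_im.1 hy
    have : (e + f) * f = f := by rw [add_mul, hff, hef, zero_add]
    exact mem_im.2 ⟨f x, DFunLike.congr_fun this x⟩
  refine hf0 (end_ext fun x => ?_)
  obtain ⟨y, hy⟩ := mem_im.1 (heq ▸ hfim (mem_im.2 ⟨x, rfl⟩) : f x ∈ im e)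
  have h1 : f (f x) = f x := DFunLike.congr_fun hff x
  have h2 : f (e y) = 0 := DFunLike.congr_fun hfe y
  rw [← h1, ← hy, h2]
  rfl

end IsPair

end GroupDim

end Algebra

/-! ### Finite `T`-invariant subgroups, simplicity of `S`, and corners. -/

namespace GroupDim

variable {V : Type*} [AddCommGroup V] {G : GroupDim V} {S T : Subring (AddMonoid.End V)}

/-- Invariance of a subgroup under a ring of endomorphisms. -/
def Inv (T : Subring (AddMonoid.End V)) (N : AddSubgroup V) : Prop :=
  ∀ t ∈ T, ∀ x ∈ N, t x ∈ N

lemma Inv.sup {N N' : AddSubgroup V} (h : Inv T N) (h' : Inv T N') : Inv T (N ⊔ N') := by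
  intro t ht x hx
  obtain ⟨y, hy, z, hz, rfl⟩ := AddSubgroup.mem_sup.1 hx
  rw [map_add]
  exact AddSubgroup.mem_sup.2 ⟨_, h t ht y hy, _, h' t ht z hz, rfl⟩

lemma finite_sup {N N' : AddSubgroup V} (h : (N : Set V).Finite)
    (h' : (N' : Set V).Finite) : ((N ⊔ N' : AddSubgroup V) : Set V).Finite := by
  refine (h.image2 (· + ·) h').subset fun x hx => ?_
  obtain ⟨y, hy, z, hz, rfl⟩ := AddSubgroup.mem_sup.1 hx
  exact ⟨y, hy, z, hz, rfl⟩

/-- Finitely many elements of finite invariant subgroups lie in a common one. -/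
lemma exists_finite_inv (F : Finset V)
    (h : ∀ x ∈ F, ∃ N : AddSubgroup V, (N : Set V).Finite ∧ Inv T N ∧ x ∈ N) :
    ∃ N : AddSubgroup V, (N : Set V).Finite ∧ Inv T N ∧ ∀ x ∈ F, x ∈ N := by
  classical
  induction F using Finset.induction_on with
  | empty => exact ⟨⊥, by simp, fun t _ x hx => by
      rw [AddSubgroup.mem_bot] at *; rw [hx, map_zero], by simp⟩
  | insert a F _ ih =>
    obtain ⟨N, h1, h2, h3⟩ := ih fun x hx => h x (Finset.mem_insert_of_mem hx)
    obtain ⟨N', h1', h2', h3'⟩ := h a (Finset.mem_insert_self a F)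
    refine ⟨N' ⊔ N, finite_sup h1' h1, h2'.sup h2, fun x hx => ?_⟩
    rcases Finset.mem_insert.1 hx with rfl | hx
    · exact AddSubgroup.mem_sup_left h3'
    · exact AddSubgroup.mem_sup_right (h3 x hx)

namespace IsPair

variable (hP : G.IsPair S T)
include hP

lemma inv_im_inf_ker {i j : AddMonoid.End V} (hi : i ∈ S) (hj : j ∈ S) :
    Inv T (im i ⊓ AddMonoidHom.ker (j : V →+ V)) := by
  rintro t ht x ⟨hx, hx'⟩
  obtain ⟨y, rfl⟩ := mem_im.1 hx
  refine ⟨mem_im.2 ⟨t y, hP.comm_apply hi ht y⟩, ?_⟩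
  have h0 : j (i y) = 0 := hx'
  exact (hP.comm_apply hj ht (i y)).trans ((congrArg t h0).trans (map_zero t))

lemma finite_im_inf_ker {i j : AddMonoid.End V} (hi : i ∈ S) (hj : j ∈ S)
    (h : im (j * i) = im i) :
    ((im i ⊓ AddMonoidHom.ker (j : V →+ V) : AddSubgroup V) : Set V).Finite := by
  refine finite_ker_of_dim_le (def_im (hP.S_le hi)) (hP.S_le hj) (le_of_eq ?_)
  rw [map_im, h]

/-- If some non-zero element of `S` kills all finite `T`-invariant subgroups, there are none. -/
lemma eq_bot_of_kill (hne : ∃ s ∈ S, s ≠ 0 ∧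
      ∀ N : AddSubgroup V, (N : Set V).Finite → Inv T N → ∀ x ∈ N, s x = 0)
    (N : AddSubgroup V) (hN : (N : Set V).Finite) (hNT : Inv T N) : N = ⊥ := by
  have h1 := hP.one_mem_of_ideal (fun i => i ∈ S ∧
      ∀ N : AddSubgroup V, (N : Set V).Finite → Inv T N → ∀ x ∈ N, i x = 0)
    (fun i hi => hi.1) ⟨S.zero_mem, fun _ _ _ _ _ => rfl⟩
    (fun i j hi hj => ⟨S.add_mem hi.1 hj.1, fun N hN hNT x hx => by
      have h1 := hi.2 N hN hNT x hx
      have h2 := hj.2 N hN hNT x hx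
      exact (congrArg₂ (· + ·) h1 h2).trans (add_zero 0)⟩)
    (fun s hs i hi => ⟨S.mul_mem hs hi.1, fun N hN hNT x hx =>
      (congrArg s (hi.2 N hN hNT x hx)).trans (map_zero s)⟩)
    (fun s hs i hi => ⟨S.mul_mem hi.1 hs, fun N hN hNT x hx =>
      hi.2 (N.map (s : V →+ V)) (hN.image s) (by
        rintro t ht _ ⟨y, hy, rfl⟩
        exact ⟨t y, hNT t ht y hy, hP.comm_apply hs ht y⟩) (s x) ⟨x, hx, rfl⟩⟩)
    (by obtain ⟨s, h1, h2, h3⟩ := hne; exact ⟨s, ⟨h1, h3⟩, h2⟩)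
    -- If `i (i x) = 0`, write `i x = i (i z)`. Then `i z` lies in the finite `T`-invariant group
    -- `im i ∩ ker i²`, which `i` kills.
    (fun i hi him x hx => by
      obtain ⟨z, hz⟩ := mem_im.1 (him ▸ mem_im.2 ⟨x, rfl⟩ : i x ∈ im (i * i))
      have him3 : im (i * i * i) = im i := by
        rw [mul_assoc, ← map_im, him, map_im, him]
      have h := hi.2 _ (hP.finite_im_inf_ker hi.1 (S.mul_mem hi.1 hi.1) him3)
        (hP.inv_im_inf_ker hi.1 (S.mul_mem hi.1 hi.1)) (i z)
        ⟨mem_im.2 ⟨z, rfl⟩, (congrArg i hz).trans hx⟩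
      exact hz.symm.trans h)
  exact (AddSubgroup.eq_bot_iff_forall _).2 fun x hx => h1.2 N hN hNT x hx

section NoFinite

variable (hNF : ∀ N : AddSubgroup V, (N : Set V).Finite → Inv T N → N = ⊥)
include hNF

lemma injective_on_im {i : AddMonoid.End V} (hi : i ∈ S) (him : im (i * i) = im i) (x : V)
    (hx : i (i x) = 0) : i x = 0 := by
  have h := hNF _ (hP.finite_im_inf_ker hi hi him) (hP.inv_im_inf_ker hi hi)
  exact (AddSubgroup.eq_bot_iff_forall _).1 h (i x) ⟨mem_im.2 ⟨x, rfl⟩, hx⟩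

/-- `S` is a simple ring. -/
lemma one_mem (I : AddMonoid.End V → Prop) (hIS : ∀ i, I i → i ∈ S)
    (hI0 : I 0) (hadd : ∀ i j, I i → I j → I (i + j)) (hl : ∀ s ∈ S, ∀ i, I i → I (s * i))
    (hr : ∀ s ∈ S, ∀ i, I i → I (i * s)) (hne : ∃ i, I i ∧ i ≠ 0) : I 1 :=
  hP.one_mem_of_ideal I hIS hI0 hadd hl hr hne fun i hi him =>
    hP.injective_on_im hNF (hIS i hi) him

/-- The kernel of `t` is finite and `S`-invariant, so its annihilator in the infinite ring `S` is a
non-zero two-sided ideal and contains `1`. -/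
lemma injective {t : AddMonoid.End V} (ht : t ∈ T) (h0 : t ≠ 0) (x : V) (hx : t x = 0) :
    x = 0 := by
  have := hP.S_inf
  have hinv : ∀ s ∈ S, ∀ y, t y = 0 → t (s y) = 0 := fun s hs y hy => by
    rw [← hP.comm_apply hs ht, hy, map_zero]
  obtain ⟨s, hs, hs0, hsk⟩ := exists_ne_zero_kill (R := S) (N := AddMonoidHom.ker (t : V →+ V))
    (hP.finite_ker ht h0) hinv
  have h1 := hP.one_mem hNF (fun i => i ∈ S ∧ ∀ y, t y = 0 → i y = 0)
    (fun i hi => hi.1) ⟨S.zero_mem, fun _ _ => rfl⟩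
    (fun i j hi hj => ⟨S.add_mem hi.1 hj.1, fun y hy =>
      (congrArg₂ (· + ·) (hi.2 y hy) (hj.2 y hy)).trans (add_zero 0)⟩)
    (fun s hs i hi => ⟨S.mul_mem hs hi.1, fun y hy =>
      (congrArg s (hi.2 y hy)).trans (map_zero s)⟩)
    (fun s hs i hi => ⟨S.mul_mem hi.1 hs, fun y hy => hi.2 (s y) (hinv s hs y hy)⟩)
    ⟨s, ⟨hs, fun y hy => hsk y hy⟩, hs0⟩
  exact h1.2 x hx

lemma exists_inv {t : AddMonoid.End V} (ht : t ∈ T) (h0 : t ≠ 0) :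
    ∃ t' ∈ T, t' * t = 1 ∧ t * t' = 1 := by
  have hinj : ∀ x y, t x = t y → x = y := fun x y h =>
    sub_eq_zero.1 (hP.injective hNF ht h0 (x - y) (by rw [map_sub, h, sub_self]))
  obtain ⟨k, hk, hkt⟩ := G.exists_div G.def_top (hP.T_le ht) G.Hom.one_mem fun x => by
    obtain ⟨y, hy⟩ := hP.surjective ht h0 x
    exact ⟨y, ⟨trivial, hy⟩, fun z hz => hinj _ _ (hz.2.trans hy.symm)⟩
  have htk : t * k = 1 := end_ext fun x => (hkt x).2
  refine ⟨k, hP.mem_T k hk fun s hs => end_ext fun x => hinj _ _ ?_, end_ext fun x =>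
    hinj _ _ (hkt (t x)).2, htk⟩
  exact (hP.comm_apply hs ht (k x)).symm.trans ((congrArg s (hkt x).2).trans (hkt (s x)).2.symm)

/-- A primitive idempotent of `S` cuts out a division ring. -/
lemma exists_primitive : ∃ e ∈ S, e ≠ 0 ∧ e * e = e ∧
    ∀ d ∈ S, e * d = d → d * e = d → d ≠ 0 → ∃ d' ∈ S, e * d' = d' ∧ d' * e = d' ∧ d' * d = e := by
  have := hP.S_inf
  -- An element of smallest image plays the role of a generator of a minimal right ideal.
  obtain ⟨s, ⟨hsS, hs0⟩, hmin⟩ := exists_min_nat (fun s => s ∈ S ∧ s ≠ 0)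
    (fun s => G.dim (im s)) (by
      obtain ⟨s, hs⟩ := exists_ne (0 : S)
      exact ⟨s, s.2, fun h => hs (Subtype.ext h)⟩)
  have hminle : ∀ g ∈ S, g ≠ 0 → ∀ h ∈ S, G.dim (im h) ≤ G.dim (im s) → im g ≤ im h →
      im g = im h := fun g hg h0 h hh h1 h2 =>
    (hP.conn_im (hP.S_le hh)).eq_of_dim_le (def_im (hP.S_le hh))
      (def_im (hP.S_le hg)) h2 (h1.trans (hmin g ⟨hg, h0⟩))
  have him : ∀ a b : AddMonoid.End V, im (a * b) ≤ im a := fun a b y hy => by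
    obtain ⟨x, rfl⟩ := mem_im.1 hy
    exact mem_im.2 ⟨b x, rfl⟩
  obtain ⟨i, hiS, hi⟩ : ∃ i ∈ S, s * i * s ≠ 0 := by
    by_contra! h
    exact hs0 (hP.prime hsS hs0 h)
  have hqS := S.mul_mem hsS hiS
  have hq0 : s * i ≠ 0 := fun h => hi (by rw [h, zero_mul])
  have h1 : im (s * i) = im s := hminle _ hqS hq0 s hsS le_rfl (him s i)
  have h2 : im (s * i * s) = im s := hminle _ (S.mul_mem hqS hsS) hi s hsS le_rfl
    (by rw [mul_assoc]; exact him s _)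
  have h3 : im (s * i * (s * i)) = im (s * i) := by rw [← map_im, h1, map_im, h2]
  obtain ⟨e, heS, g, -, -, hee, hqe, heq, hefix⟩ :=
    hP.exists_projection hqS h3 (hP.injective_on_im hNF hqS h3)
  have heim : im e ≤ im s := fun y hy => by
    obtain ⟨x, rfl⟩ := mem_im.1 hy
    exact h1 ▸ heq x
  refine ⟨e, heS, fun h => hq0 (by rw [← hqe, h, mul_zero]), hee, ?_⟩
  intro d hdS hed hde hd0
  -- By minimality every non-zero `d` in `e S e` maps `e V` onto itself; the projection obtained
  -- from `d` is therefore `e`.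
  have hd1 : im d = im e := hminle d hdS hd0 e heS
    (G.dim_mono (def_im (hP.S_le heS)) (def_im (hP.S_le hsS)) heim) (by rw [← hed]; exact him e d)
  have hd2 : im (d * d) = im d := by rw [← map_im, hd1, map_im, hde, hd1]
  obtain ⟨f, hfS, g, hgS, hgd, hff, hdf, hfd, hffix⟩ :=
    hP.exists_projection hdS hd2 (hP.injective_on_im hNF hdS hd2)
  have hfe : f = e := by
    have h4 : f * e = e := end_ext fun x => hffix _ (hd1 ▸ mem_im.2 ⟨x, rfl⟩)
    rw [← h4, ← hgd, mul_assoc, hde]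
  refine ⟨e * g * e, S.mul_mem (S.mul_mem heS hgS) heS, ?_, ?_, ?_⟩
  · simp only [← mul_assoc, hee]
  · simp only [mul_assoc, hee]
  · rw [mul_assoc, hed, mul_assoc, hgd, hfe, hee]

/-- The identity is a sum of elements of `S e S`. -/
lemma exists_sum_eq_one {e : AddMonoid.End V} (he : e ∈ S) (he0 : e ≠ 0) :
    ∃ (m : ℕ) (a b : Fin m → AddMonoid.End V), (∀ i, a i ∈ S) ∧ (∀ i, b i ∈ S) ∧
      ∑ i, a i * e * b i = 1 := by
  refine hP.one_mem hNF (fun x => ∃ (m : ℕ) (a b : Fin m → AddMonoid.End V), (∀ i, a i ∈ S) ∧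
    (∀ i, b i ∈ S) ∧ ∑ i, a i * e * b i = x) ?_ ?_ ?_ ?_ ?_ ?_
  · rintro x ⟨m, a, b, ha, hb, rfl⟩
    exact S.sum_mem fun i _ => S.mul_mem (S.mul_mem (ha i) he) (hb i)
  · exact ⟨0, 0, 0, fun i => i.elim0, fun i => i.elim0, rfl⟩
  · rintro x y ⟨m, a, b, ha, hb, rfl⟩ ⟨m', a', b', ha', hb', rfl⟩
    refine ⟨m + m', Fin.append a a', Fin.append b b', fun i => ?_, fun i => ?_, ?_⟩
    · refine Fin.addCases (fun i => ?_) (fun i => ?_) i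
      · rw [Fin.append_left]; exact ha i
      · rw [Fin.append_right]; exact ha' i
    · refine Fin.addCases (fun i => ?_) (fun i => ?_) i
      · rw [Fin.append_left]; exact hb i
      · rw [Fin.append_right]; exact hb' i
    · simp [Fin.sum_univ_add]
  · rintro s hs x ⟨m, a, b, ha, hb, rfl⟩
    exact ⟨m, fun i => s * a i, b, fun i => S.mul_mem hs (ha i), hb, by
      simp only [Finset.mul_sum, mul_assoc]⟩
  · rintro s hs x ⟨m, a, b, ha, hb, rfl⟩
    exact ⟨m, a, fun i => b i * s, ha, fun i => S.mul_mem (hb i) hs, by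
      simp only [Finset.sum_mul, mul_assoc]⟩
  · exact ⟨e, ⟨1, 1, 1, fun _ => S.one_mem, fun _ => S.one_mem, by simp⟩, he0⟩

end NoFinite

/-- An endomorphism of `eV` commuting with `eSe` extends to an element of `T`. -/
lemma extend_mem {e : AddMonoid.End V} {m : ℕ}
    {a b : Fin m → AddMonoid.End V} (ha : ∀ i, a i ∈ S) (hb : ∀ i, b i ∈ S)
    (h1 : ∑ i, a i * e * b i = 1) {p : AddMonoid.End V} (hp : p ∈ G.Hom) (hep : e * p = p)
    (hpe : p * e = p) (hcomm : ∀ s ∈ S, e * s * e * p = p * (e * s * e)) :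
    ∑ i, a i * p * b i ∈ T := by
  refine hP.mem_T _ (Subring.sum_mem _ fun i _ => G.Hom.mul_mem (G.Hom.mul_mem (hP.S_le (ha i)) hp)
    (hP.S_le (hb i))) fun s hs => ?_
  -- After `1 = ∑ a i * e * b i` is inserted, `s` occurs only through the corner elements `e * (b i
  -- * s * a j) * e`, which commute with `p`.
  have key : ∀ i j, a i * e * b i * (s * (a j * p * b j)) =
      a i * p * b i * (s * (a j * e * b j)) := by
    intro i j
    have h := hcomm (b i * s * a j) (S.mul_mem (S.mul_mem (hb i) hs) (ha j))
    calc a i * e * b i * (s * (a j * p * b j))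
        = a i * (e * (b i * s * a j) * e * p) * b j := by
          rw [mul_assoc (e * _) e p, hep]; simp only [mul_assoc]
      _ = a i * (p * (e * (b i * s * a j) * e)) * b j := by rw [h]
      _ = a i * (p * e) * b i * (s * (a j * e * b j)) := by simp only [mul_assoc]
      _ = _ := by rw [hpe]
  calc s * ∑ j, a j * p * b j = (∑ i, a i * e * b i) * (s * ∑ j, a j * p * b j) := by
        rw [h1, one_mul]
    _ = ∑ i, ∑ j, a i * e * b i * (s * (a j * p * b j)) := by
        simp only [Finset.mul_sum, Finset.sum_mul]
        rw [Finset.sum_comm]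
    _ = ∑ i, ∑ j, a i * p * b i * (s * (a j * e * b j)) := by simp only [key]
    _ = (∑ i, a i * p * b i) * (s * ∑ j, a j * e * b j) := by
        simp only [Finset.mul_sum, Finset.sum_mul]
        rw [Finset.sum_comm]
    _ = (∑ i, a i * p * b i) * s := by rw [h1, mul_one]

end IsPair

end GroupDim

/-! ### Type-definable families, and the absence of finite invariant subgroups. -/

section Families

variable (L : FirstOrder.Language.{u, v}) {M : Type w} [L.Structure M] (κ : Cardinal.{w})
variable {n : ℕ} (V : Set (Fin n → M)) [AddCommGroup V] [hV : DefGroup L V]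

/-- A type-definable family of definable endomorphisms of `V`. -/
structure EndFamily where
  arity : ℕ
  code : (Fin arity → M) → Prop
  graph : (Fin arity → M) → V → V → Prop
  tdfn_code : TDfn L M κ code
  dfn_graph : Dfn L M (fun p : (Fin arity → M) × V × V => graph p.1 p.2.1 p.2.2)
  exists_end : ∀ z, code z → ∃ s : AddMonoid.End V, ∀ x y, graph z x y ↔ s x = y

variable {L κ V}

/-- The endomorphisms in a family. -/
def EndFamily.carrier (X : EndFamily L κ V) : Set (AddMonoid.End V) :=
  {s | ∃ z, X.code z ∧ ∀ x y, X.graph z x y ↔ s x = y}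

lemma exists_families {D : Set (AddMonoid.End V)} (hD : IsInvariantSet L κ D) :
    ∃ (ι : Type w) (X : ι → EndFamily L κ V), #ι < κ ∧ D = ⋃ i, (X i).carrier := by
  obtain ⟨ι, k, Φ, Z, hι, hΦ, hZ, hex, rfl⟩ := hD
  refine ⟨ι, fun i =>
    { arity := k i
      code := fun z => z ∈ Z i
      graph := fun z x y => Sum.elim z (Sum.elim (x : Fin n → M) (y : Fin n → M)) ∈ Φ i
      tdfn_code := (hZ i).tdfn
      dfn_graph := ?_
      exists_end := hex i }, hι, ?_⟩
  · exact (dfn_mem_of_isDef (hΦ i)).comp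
      ((DFun.sumElim (α := Fin (k i)) (β := Fin n ⊕ Fin n)).comp
        (g := fun p : (Fin (k i) → M) × V × V =>
          (p.1, Sum.elim (p.2.1 : Fin n → M) (p.2.2 : Fin n → M)))
        (DFun.pair (by fun_prop) ((DFun.sumElim (α := Fin n) (β := Fin n)).comp
          (g := fun p : (Fin (k i) → M) × V × V => ((p.2.1 : Fin n → M), (p.2.2 : Fin n → M)))
          (by fun_prop))))
  · ext s
    simp only [mem_iUnion]
    rfl

/-- An unbounded union of few families contains an infinite family. -/
lemma exists_infinite (hM : IsMonster L M κ) {α : Type w} {D : Set α} (hc : κ ≤ #D) {ι : Type w}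
    {X : ι → Set α} (hι : #ι < κ) (hD : D ⊆ ⋃ i, X i) : ∃ i, (X i).Infinite := by
  by_contra! h
  refine (hc.trans (mk_le_mk_of_subset hD)).not_gt (hM.mk_iUnion_lt hι fun i => ?_)
  have := (h i).to_subtype
  exact hM.mk_lt_of_finite _

/-- An infinite family contains two elements that agree on a small set with finite orbits. -/
lemma EndFamily.exists_agree (hM : IsMonster L M κ) (X : EndFamily L κ V)
    (hX : X.carrier.Infinite) {Q : Set V} (hQ : #Q < κ)
    (hfin : ∀ F : Finset V, (F : Set V) ⊆ Q →
      ∃ N : Set V, N.Finite ∧ ∀ s ∈ X.carrier, ∀ x ∈ F, s x ∈ N) :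
    ∃ s ∈ X.carrier, ∃ s' ∈ X.carrier, s ≠ s' ∧ ∀ x ∈ Q, s x = s' x := by
  classical
  have hP : TDfn L M κ (fun p : (Fin X.arity → M) × (Fin X.arity → M) =>
      X.code p.1 ∧ X.code p.2 ∧ ∃ x y, X.graph p.1 x y ∧ ¬ X.graph p.2 x y) := by
    refine (X.tdfn_code.comp .fst).and hM ((X.tdfn_code.comp .snd).and hM (Dfn.tdfn hM ?_))
    exact .ex (.ex (.and
      (Dfn.rel₃ X.dfn_graph (f := fun p : (((Fin X.arity → M) × (Fin X.arity → M)) × V) × V =>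
        p.1.1.1) (by fun_prop) (g := fun p => p.1.2) (by fun_prop) (h := fun p => p.2)
        (by fun_prop))
      (Dfn.rel₃ X.dfn_graph (f := fun p : (((Fin X.arity → M) × (Fin X.arity → M)) × V) × V =>
        p.1.1.2) (by fun_prop) (g := fun p => p.1.2) (by fun_prop) (h := fun p => p.2)
        (by fun_prop)).not))
  obtain ⟨ι, D, hι, hD, hPD⟩ := hP
  obtain ⟨p, hp⟩ := hM.compactness (ι := ι ⊕ Q)
    (D := Sum.elim D fun (x : Q) p => ∃ y : V, X.graph p.1 x y ∧ X.graph p.2 x y) (by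
      rw [mk_sum, lift_id, lift_id]
      exact add_lt_of_lt hM.uncountable.le hι hQ) (by
      rintro (i | x)
      · exact hD i
      · exact .ex (.and
          (Dfn.rel₃ X.dfn_graph (f := fun p : ((Fin X.arity → M) × (Fin X.arity → M)) × V =>
            p.1.1) (by fun_prop) (g := fun _ => (x : V)) (by fun_prop) (h := fun p => p.2)
            (by fun_prop))
          (Dfn.rel₃ X.dfn_graph (f := fun p : ((Fin X.arity → M) × (Fin X.arity → M)) × V =>
            p.1.2) (by fun_prop) (g := fun _ => (x : V)) (by fun_prop) (h := fun p => p.2)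
            (by fun_prop)))) (by
      intro J
      let F : Finset V := J.toRight.image Subtype.val
      obtain ⟨N, hN, hNF⟩ := hfin F (by
        intro x hx
        obtain ⟨y, -, rfl⟩ := Finset.mem_image.1 hx
        exact y.2)
      have := hX.to_subtype
      have := hN.to_subtype
      -- Finite satisfiability is a pigeonhole: infinitely many endomorphisms induce only finitely
      -- many maps `F → N`.
      obtain ⟨s, s', hne, h⟩ := Finite.exists_ne_map_eq_of_infinite
        fun (s : X.carrier) (x : F) => (⟨(s : AddMonoid.End V) x, hNF s s.2 x x.2⟩ : N)
      obtain ⟨z, hz, hzs⟩ := s.2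
      obtain ⟨z', hz', hzs'⟩ := s'.2
      have hne' : ∃ x, (s : AddMonoid.End V) x ≠ (s' : AddMonoid.End V) x := by
        by_contra! hcon
        exact hne (Subtype.ext (end_ext hcon))
      obtain ⟨x, hx⟩ := hne'
      have hDz := (hPD (z, z')).1 ⟨hz, hz', x, (s : AddMonoid.End V) x, (hzs _ _).2 rfl,
        fun h => hx ((hzs' _ _).1 h).symm⟩
      refine ⟨(z, z'), ?_⟩
      rintro (i | x) hi
      · exact hDz i
      · have hxF : (x : V) ∈ F := Finset.mem_image.2 ⟨x, Finset.mem_toRight.2 hi, rfl⟩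
        have := congrArg Subtype.val (congrFun h ⟨x, hxF⟩)
        exact ⟨(s : AddMonoid.End V) x, (hzs _ _).2 rfl, (hzs' _ _).2 this.symm⟩)
  obtain ⟨h1, h2, x, y, h3, h4⟩ := (hPD p).2 fun i => hp (Sum.inl i)
  obtain ⟨s, hs⟩ := X.exists_end p.1 h1
  obtain ⟨s', hs'⟩ := X.exists_end p.2 h2
  refine ⟨s, ⟨p.1, h1, hs⟩, s', ⟨p.2, h2, hs'⟩, fun h => h4 ?_, fun x hx => ?_⟩
  · rw [hs', ← h, ← hs]
    exact h3
  · obtain ⟨y, hy, hy'⟩ := hp (Sum.inr ⟨x, hx⟩)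
    exact ((hs _ _).1 hy).trans ((hs' _ _).1 hy').symm

open GroupDim in
/-- In a pair of mutually centralising rings of which one is unbounded, there are no finite
`T`-invariant subgroups. -/
lemma eq_bot_of_finite_inv (hM : IsMonster L M κ) {G : GroupDim V}
    {S T : Subring (AddMonoid.End V)} (hP : G.IsPair S T)
    (hS : IsInvariantSet L κ (S : Set (AddMonoid.End V)))
    (hT : IsInvariantSet L κ (T : Set (AddMonoid.End V))) (hunb : κ ≤ #S ∨ κ ≤ #T)
    (N : AddSubgroup V) (hN : (N : Set V).Finite) (hNT : Inv T N) : N = ⊥ := by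
  classical
  have := hP.S_inf
  have := hP.T_inf
  refine hP.eq_bot_of_kill ?_ N hN hNT
  have hker : ∀ t ∈ T, Inv S (AddMonoidHom.ker (t : V →+ V)) := fun t ht s hs y hy =>
    (hP.comm_apply hs ht y).symm.trans ((congrArg s hy).trans (map_zero s))
  by_cases hTκ : κ ≤ #T
  · obtain ⟨ι, X, hι, hX⟩ := exists_families hT
    obtain ⟨i, hi⟩ := exists_infinite hM (D := (T : Set (AddMonoid.End V))) hTκ hι hX.subset
    have hXT : (X i).carrier ⊆ T := hX ▸ subset_iUnion (fun i => (X i).carrier) i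
    let U : Set V := {x | ∃ N : AddSubgroup V, (N : Set V).Finite ∧ Inv T N ∧ x ∈ N}
    -- Were the union of the finite `T`-invariant subgroups infinite, two distinct elements of `T`
    -- would agree on a countably infinite part of it. Their difference would then have infinite
    -- kernel.
    have hU : U.Finite := by
      by_contra hU
      have hUinf : U.Infinite := hU
      let em := hUinf.natEmbedding
      let Q : Set V := range fun k => (em k : V)
      have hQinf : Q.Infinite := infinite_range_of_injective
        (Subtype.val_injective.comp em.injective)
      obtain ⟨t, ht, t', ht', hne, hag⟩ := (X i).exists_agree hM hi (Q := Q)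
        ((countable_range _).le_aleph0.trans_lt hM.uncountable) fun F hF => by
          obtain ⟨N, h1, h2, h3⟩ := exists_finite_inv (T := T) F fun x hx => by
            obtain ⟨k, rfl⟩ := hF hx
            exact (em k).2
          exact ⟨N, h1, fun s hs x hx => h2 s (hXT hs) x (h3 x hx)⟩
      refine hQinf ((hP.finite_ker (T.sub_mem (hXT ht) (hXT ht')) (sub_ne_zero.2 hne)).subset
        fun x hx => ?_)
      exact sub_eq_zero.2 (hag x hx)
    -- One finite `N` now contains them all. Some `t ≠ 0` kills `N`, and some `s ≠ 0` in `S` kills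
    -- the finite group `ker t`.
    obtain ⟨N, h1, h2, h3⟩ := exists_finite_inv (T := T) hU.toFinset fun x hx =>
      hU.mem_toFinset.1 hx
    obtain ⟨t, ht, ht0, htk⟩ := exists_ne_zero_kill h1 h2
    obtain ⟨s, hs, hs0, hsk⟩ := exists_ne_zero_kill (R := S)
      (N := AddMonoidHom.ker (t : V →+ V)) (hP.finite_ker ht ht0) (hker t ht)
    exact ⟨s, hs, hs0, fun N' hN' hNT' x hx => hsk x (htk x (h3 x (hU.mem_toFinset.2
      ⟨N', hN', hNT', hx⟩)))⟩
  · obtain ⟨ι, X, hι, hX⟩ := exists_families hS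
    obtain ⟨i, hi⟩ := exists_infinite hM (D := (S : Set (AddMonoid.End V)))
      (hunb.resolve_right hTκ) hι hX.subset
    have hXS : (X i).carrier ⊆ S := hX ▸ subset_iUnion (fun i => (X i).carrier) i
    -- Here `T` is bounded, so `Q` is small. Its finite parts lie in finite `S`-invariant subgroups,
    -- and every finite `T`-invariant subgroup lies in the kernel of some `t ≠ 0`, hence in `Q`.
    let Q : Set V := ⋃ t : {t : T // t ≠ 0}, {x | (t : AddMonoid.End V) x = 0}
    have ht0 : ∀ t : {t : T // t ≠ 0}, ((t : T) : AddMonoid.End V) ≠ 0 := fun t h =>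
      t.2 (Subtype.ext h)
    have hQ : #Q < κ := hM.mk_iUnion_lt
      ((mk_subtype_le _).trans_lt (not_le.1 hTκ)) fun t => by
        have := (hP.finite_ker t.1.2 (ht0 t)).to_subtype
        exact hM.mk_lt_of_finite _
    obtain ⟨s, hs, s', hs', hne, hag⟩ := (X i).exists_agree hM hi hQ fun F hF => by
      obtain ⟨N, h1, h2, h3⟩ := exists_finite_inv (T := S) F fun x hx => by
        obtain ⟨t, ht⟩ := mem_iUnion.1 (hF hx)
        exact ⟨AddMonoidHom.ker ((t : AddMonoid.End V) : V →+ V), hP.finite_ker t.1.2 (ht0 t),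
          hker t t.1.2, ht⟩
      exact ⟨N, h1, fun s hs x hx => h2 s (hXS hs) x (h3 x hx)⟩
    refine ⟨s - s', S.sub_mem (hXS hs) (hXS hs'), sub_ne_zero.2 hne, fun N hN hNT x hx => ?_⟩
    obtain ⟨t, ht, htn0, htk⟩ := exists_ne_zero_kill hN hNT
    exact sub_eq_zero.2 (hag x (mem_iUnion.2 ⟨⟨⟨t, ht⟩, fun h => htn0 (congrArg Subtype.val h)⟩,
      htk x hx⟩))

end Families

/-! ### Dimension along a definable relation. -/

section

variable {L : FirstOrder.Language.{u, v}} {M : Type w} [L.Structure M]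
variable {dim : ∀ σ : ImagSort L M, Set σ.Elt → WithBot ℕ} (hdim : IsDimension dim)
variable {n : ℕ} {V : Set (Fin n → M)} [hV : Fact (IsDef L V)]
include hdim

/-- Super-additivity for a definable surjection given by its graph. -/
lemma IsDimension.vdim_add_le_rel {X Y : Set V} (hX : Dfn L M (fun x => x ∈ X))
    (hY : Dfn L M (fun x => x ∈ Y)) {R : V → V → Prop} (hR : Dfn L M (fun p : V × V => R p.1 p.2))
    (hRX : ∀ x y, R x y → x ∈ X) (hRY : ∀ x y, R x y → y ∈ Y) (hex : ∀ x ∈ X, ∃ y, R x y)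
    (huniq : ∀ x y y', R x y → R x y' → y = y') (hsurj : ∀ y ∈ Y, ∃ x, R x y)
    (hne : X.Nonempty) (d : ℕ) (hd : ∀ y ∈ Y, d ≤ vdim dim {x | R x y}) :
    vdim dim Y + d ≤ vdim dim X := by
  classical
  obtain ⟨x₀, hx₀⟩ := id hne
  let f : V → V := fun x => if h : ∃ y, R x y then h.choose else x₀
  have hf : ∀ x y, R x y ↔ x ∈ X ∧ f x = y := by
    refine fun x y => ⟨fun h => ⟨hRX x y h, ?_⟩, ?_⟩
    · have h' : ∃ y, R x y := ⟨y, h⟩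
      simp only [f, dif_pos h']
      exact huniq x _ _ h'.choose_spec h
    · rintro ⟨hx, rfl⟩
      simp only [f, dif_pos (hex x hx)]
      exact (hex x hx).choose_spec
  refine hdim.vdim_add_le hX hY (f := f) (fun x hx => hRY x _ ((hf x _).2 ⟨hx, rfl⟩))
    (fun y hy => ?_) hne (hR.congr fun p => hf p.1 p.2) d fun y hy => ?_
  · obtain ⟨x, hx⟩ := hsurj y hy
    exact ⟨x, (hf x y).1 hx⟩
  · refine (hd y hy).trans (le_of_eq (congrArg _ (Set.ext fun x => hf x y)))

end

/-! ### Definability of unbounded division rings of endomorphisms. -/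

section Division

variable {L : FirstOrder.Language.{u, v}} {M : Type w} [L.Structure M] {κ : Cardinal.{w}}
variable {n : ℕ} {V : Set (Fin n → M)} [AddCommGroup V]

/-- A division ring of endomorphisms, whose unit `e` need not be the identity. -/
structure IsEndDivision (D : Set (AddMonoid.End V)) (e : AddMonoid.End V) : Prop where
  add_mem : ∀ d ∈ D, ∀ d' ∈ D, d + d' ∈ D
  sub_mem : ∀ d ∈ D, ∀ d' ∈ D, d - d' ∈ D
  mul_mem : ∀ d ∈ D, ∀ d' ∈ D, d * d' ∈ D
  unit_mem : e ∈ D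
  unit_mul : ∀ d ∈ D, e * d = d
  mul_unit : ∀ d ∈ D, d * e = d
  exists_inv : ∀ d ∈ D, d ≠ 0 → ∃ d' ∈ D, d' * d = e

/-- An inverse of `d` would recover `a = e a` from `d a`. Evaluation at one non-zero vector of `e V`
is thus injective on `D`. -/
lemma IsEndDivision.eq_zero {D : Set (AddMonoid.End V)} {e : AddMonoid.End V}
    (hD : IsEndDivision D e) {d : AddMonoid.End V} (hd : d ∈ D) {a : V} (hea : e a = a)
    (ha : a ≠ 0) (h : d a = 0) : d = 0 := by
  by_contra h0
  obtain ⟨d', -, hdd⟩ := hD.exists_inv d hd h0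
  refine ha ?_
  rw [← hea, ← hdd]
  exact (congrArg d' h).trans (map_zero d')

lemma IsEndDivision.eq_of_apply {D : Set (AddMonoid.End V)} {e : AddMonoid.End V}
    (hD : IsEndDivision D e) {d d' : AddMonoid.End V} (hd : d ∈ D) (hd' : d' ∈ D) {a : V}
    (hea : e a = a) (ha : a ≠ 0) (h : d a = d' a) : d = d' :=
  sub_eq_zero.1 (hD.eq_zero (hD.sub_mem d hd d' hd') hea ha (sub_eq_zero.2 h))

/-- Solving a linear equation over a division ring of endomorphisms. -/
lemma IsEndDivision.exists_quotient {D : Set (AddMonoid.End V)} {e : AddMonoid.End V}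
    (hD : IsEndDivision D e) {s₁ s₂ s₃ s₄ : AddMonoid.End V} (h₁ : s₁ ∈ D) (h₂ : s₂ ∈ D)
    (h₃ : s₃ ∈ D) (h₄ : s₄ ∈ D) (hne : s₁ ≠ s₂) :
    ∃ t ∈ D, ∀ x y, e x = x → s₁ x - s₂ x = s₃ y - s₄ y → x = t y := by
  obtain ⟨d, hd, hds⟩ := hD.exists_inv _ (hD.sub_mem _ h₁ _ h₂) (sub_ne_zero.2 hne)
  refine ⟨d * (s₃ - s₄), hD.mul_mem _ hd _ (hD.sub_mem _ h₃ _ h₄), fun x y hx hxy => ?_⟩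
  rw [← hx, ← hds]
  exact congrArg d hxy

variable [hV : DefGroup L V]

lemma EndFamily.mem_iff (X : EndFamily L κ V) (P : AddMonoid.End V → Prop) :
    (∃ s ∈ X.carrier, P s) ↔ ∃ z, X.code z ∧ ∃ s : AddMonoid.End V,
      (∀ x y, X.graph z x y ↔ s x = y) ∧ P s :=
  ⟨fun ⟨s, ⟨z, hz, hs⟩, hp⟩ => ⟨z, hz, s, hs, hp⟩, fun ⟨z, hz, s, hs, hp⟩ => ⟨s, ⟨z, hz, hs⟩, hp⟩⟩

/-- The values of the elements of a family at `a` and at a variable point. -/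
def EndFamily.val (X : EndFamily L κ V) (a : V) (p : V × V × V) : Prop :=
  ∃ s ∈ X.carrier, p.1 = s a ∧ p.2.1 = s p.2.2

lemma EndFamily.tdfn_val (hM : IsMonster L M κ) (X : EndFamily L κ V) (a : V) :
    TDfn L M κ (X.val a) := by
  have h : TDfn L M κ (fun p : V × V × V => ∃ z, X.code z ∧ X.graph z a p.1 ∧
      X.graph z p.2.2 p.2.1) := by
    refine .ex hM ((X.tdfn_code.comp .snd).and hM (Dfn.tdfn hM ?_))
    exact (Dfn.rel₃ X.dfn_graph (f := fun q : (V × V × V) × (Fin X.arity → M) => q.2)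
        (by fun_prop) (g := fun _ => a) (by fun_prop) (h := fun q => q.1.1) (by fun_prop)).and
      (Dfn.rel₃ X.dfn_graph (f := fun q : (V × V × V) × (Fin X.arity → M) => q.2)
        (by fun_prop) (g := fun q => q.1.2.2) (by fun_prop) (h := fun q => q.1.2.1) (by fun_prop))
  obtain ⟨ι, D, h1, h2, h3⟩ := h
  refine ⟨ι, D, h1, h2, fun p => Iff.trans ?_ (h3 p)⟩
  refine (X.mem_iff _).trans (exists_congr fun z => and_congr_right fun hz => ⟨?_, ?_⟩)
  · rintro ⟨s, hs, h4, h5⟩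
    exact ⟨(hs _ _).2 h4.symm, (hs _ _).2 h5.symm⟩
  · rintro ⟨h4, h5⟩
    obtain ⟨s, hs⟩ := X.exists_end z hz
    exact ⟨s, hs, ((hs _ _).1 h4).symm, ((hs _ _).1 h5).symm⟩

variable {dim : ∀ σ : ImagSort L M, Set σ.Elt → WithBot ℕ} (hdim : IsDimension dim)
  (hM : IsMonster L M κ)
include hdim hM

/-- If `X a + X b` has too small a dimension then the sum map is not injective. -/
lemma EndFamily.exists_relation (X : EndFamily L κ V) {a b : V} {d : ℕ} (hd : 1 ≤ d)
    (hmin : ∀ B : Set V, Dfn L M (fun x => x ∈ B) → (∀ s ∈ X.carrier, s a ∈ B) → d ≤ vdim dim B)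
    {A : Set V} (hA : Dfn L M (fun x => x ∈ A)) (hAd : vdim dim A ≤ d)
    (hsum : ∀ s ∈ X.carrier, ∀ s' ∈ X.carrier, s a + s' b ∈ A) :
    ∃ s₁ ∈ X.carrier, ∃ s₂ ∈ X.carrier, ∃ s₃ ∈ X.carrier, ∃ s₄ ∈ X.carrier,
      s₁ ≠ s₂ ∧ s₁ b - s₂ b = s₃ a - s₄ a := by
  by_contra! hcon
  -- `F` is a definable approximation of the pairs `(s a, s b)` on which the sums still lie in `A`
  -- and still determine their terms, as measured by first coordinates.
  obtain ⟨F, hF, hXF, hFΨ⟩ := ((X.tdfn_val hM a).comp (f := fun p : V × V => (p.1, p.2, b))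
    (by fun_prop)).exists_dfn hM (Θ := ((V × V) × (V × V)) × ((V × V) × (V × V))) (r := 4)
    (π := ![fun θ => θ.1.1, fun θ => θ.1.2, fun θ => θ.2.1, fun θ => θ.2.2])
    (fun i => by fin_cases i <;> dsimp <;> fun_prop)
    (Ψ := fun θ => θ.1.1.1 + θ.1.2.2 ∈ A ∧ (θ.1.1.1 + θ.1.2.2 = θ.2.1.1 + θ.2.2.2 →
      θ.1.1.1 = θ.2.1.1 ∧ θ.1.2.1 = θ.2.2.1))
    ((hA.comp (by fun_prop)).and ((Dfn.eq (by fun_prop) (by fun_prop)).imp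
      ((Dfn.eq (by fun_prop) (by fun_prop)).and (Dfn.eq (by fun_prop) (by fun_prop)))))
    (by
      rintro ⟨⟨⟨p₁, q₁⟩, ⟨p₁', q₁'⟩⟩, ⟨⟨p₂, q₂⟩, ⟨p₂', q₂'⟩⟩⟩ h
      obtain ⟨s₁, hs₁, hp₁, hq₁⟩ := h 0
      obtain ⟨s₁', hs₁', hp₁', hq₁'⟩ := h 1
      obtain ⟨s₂, hs₂, hp₂, hq₂⟩ := h 2
      obtain ⟨s₂', hs₂', hp₂', hq₂'⟩ := h 3
      simp only [Matrix.cons_val] at *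
      subst hp₁ hq₁ hp₁' hq₁' hp₂ hq₂ hp₂' hq₂'
      refine ⟨hsum _ hs₁ _ hs₁', fun heq => ?_⟩
      have : s₁' = s₂' := by
        by_contra hne
        refine hcon s₁' hs₁' s₂' hs₂' s₂ hs₂ s₁ hs₁ hne ?_
        rw [sub_eq_sub_iff_add_eq_add, add_comm, heq]
      subst this
      exact ⟨add_right_cancel heq, rfl⟩)
  have hΨ : ∀ p₁ q₁ p₁' q₁', F (p₁, q₁) → F (p₁', q₁') → p₁ + q₁' ∈ A ∧ ∀ p₂ q₂ p₂' q₂',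
      F (p₂, q₂) → F (p₂', q₂') → p₁ + q₁' = p₂ + q₂' → p₁ = p₂ ∧ p₁' = p₂' := by
    have key : ∀ p₁ q₁ p₁' q₁' p₂ q₂ p₂' q₂', F (p₁, q₁) → F (p₁', q₁') → F (p₂, q₂) →
        F (p₂', q₂') → p₁ + q₁' ∈ A ∧ (p₁ + q₁' = p₂ + q₂' → p₁ = p₂ ∧ p₁' = p₂') := by
      intro p₁ q₁ p₁' q₁' p₂ q₂ p₂' q₂' h1 h2 h3 h4
      refine hFΨ (((p₁, q₁), (p₁', q₁')), ((p₂, q₂), (p₂', q₂'))) fun i => ?_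
      fin_cases i
      exacts [h1, h2, h3, h4]
    exact fun p₁ q₁ p₁' q₁' h1 h2 => ⟨(key _ _ _ _ _ _ _ _ h1 h2 h1 h2).1,
      fun p₂ q₂ p₂' q₂' h3 h4 => (key _ _ _ _ _ _ _ _ h1 h2 h3 h4).2⟩
  let B : Set V := {p | ∃ q, F (p, q)}
  have hB : Dfn L M (fun x => x ∈ B) := .ex hF
  have hBd : d ≤ vdim dim B := hmin B hB fun s hs => ⟨s b, hXF _ ⟨s, hs, rfl, rfl⟩⟩
  -- The second summand `q'` is tracked by its partner `p'`: the lower bound on dimension concerns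
  -- values at `a`, not at `b`.
  let R : V → V → V → Prop := fun c p p' => ∃ q q', F (p, q) ∧ F (p', q') ∧ p + q' = c
  have hR : Dfn L M (fun x : V × V × V => R x.1 x.2.1 x.2.2) :=
    .ex (.ex ((hF.comp (f := fun x : ((V × V × V) × V) × V => (x.1.1.2.1, x.1.2))
      (by fun_prop)).and ((hF.comp (f := fun x : ((V × V × V) × V) × V => (x.1.1.2.2, x.2))
        (by fun_prop)).and (.eq (by fun_prop) (by fun_prop)))))
  let C : Set V := {c | ∃ p p', R c p p'}
  have hC : Dfn L M (fun c => c ∈ C) :=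
    .ex (.ex (hR.comp (f := fun x : (V × V) × V => (x.1.1, x.1.2, x.2)) (by fun_prop)))
  have hCA : vdim dim C ≤ vdim dim A := hdim.vdim_mono hC hA (by
    rintro c ⟨p, p', q, q', h1, h2, rfl⟩
    exact (hΨ _ _ _ _ h1 h2).1)
  have hRuniq : ∀ c p p' r r', R c p p' → R c r r' → p = r ∧ p' = r' := by
    rintro c p p' r r' ⟨q, q', h1, h2, rfl⟩ ⟨q₁, q₁', h3, h4, h5⟩
    exact (hΨ _ _ _ _ h1 h2).2 _ _ _ _ h3 h4 h5.symm
  have hBne : B.Nonempty := by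
    by_contra hne
    rw [not_nonempty_iff_eq_empty.1 hne, hdim.vdim_empty] at hBd
    omega
  have hRex : ∀ p ∈ B, ∀ p' ∈ B, ∃ c, R c p p' := fun p ⟨q, hq⟩ p' ⟨q', hq'⟩ =>
    ⟨_, q, q', hq, hq', rfl⟩
  have hRB : ∀ c p p', R c p p' → p ∈ B ∧ p' ∈ B := fun c p p' ⟨q, q', h1, h2, _⟩ =>
    ⟨⟨q, h1⟩, ⟨q', h2⟩⟩
  have hCne : C.Nonempty := by
    obtain ⟨p, hp⟩ := hBne
    obtain ⟨c, hc⟩ := hRex p hp p hp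
    exact ⟨c, p, p, hc⟩
  have hfib : ∀ p ∈ B, vdim dim B ≤ vdim dim {c | ∃ p', R c p p'} := by
    intro p hp
    refine hdim.vdim_add_le_rel (X := {c | ∃ p', R c p p'}) (Y := B)
      (.ex (hR.comp (f := fun x : V × V => (x.1, p, x.2)) (by fun_prop))) hB
      (R := fun c p' => R c p p') (hR.comp (f := fun x : V × V => (x.1, p, x.2)) (by fun_prop))
      (fun c p' h => ⟨p', h⟩) (fun c p' h => (hRB c p p' h).2) (fun c h => h)
      (fun c p' r' h h' => (hRuniq c p p' p r' h h').2) (fun p' hp' => hRex p hp p' hp') ?_ 0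
      fun _ _ => zero_le
    obtain ⟨c, hc⟩ := hRex p hp p hp
    exact ⟨c, p, hc⟩
  -- The sums project onto `B` with fibres that again map onto `B`, so `2d ≤ dim C ≤ d`.
  have h2 := hdim.vdim_add_le_rel hC hB (R := fun c p => ∃ p', R c p p')
    (.ex (hR.comp (f := fun x : (V × V) × V => (x.1.1, x.1.2, x.2)) (by fun_prop)))
    (fun c p h => ⟨p, h⟩) (fun c p ⟨p', h⟩ => (hRB c p p' h).1) (fun c h => h)
    (fun c p r ⟨p', h⟩ ⟨r', h'⟩ => (hRuniq c p p' r r' h h').1)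
    (fun p hp => (hRex p hp p hp).imp fun c hc => ⟨p, hc⟩) hCne _ hfib
  omega

/-- An unbounded invariant division ring of endomorphisms is definable. -/
theorem IsEndDivision.dfn_eval {D : Set (AddMonoid.End V)} {e : AddMonoid.End V}
    (hD : IsEndDivision D e) (he : e ∈ defEnd L V) {ι : Type w} {X : ι → EndFamily L κ V}
    (hι : #ι < κ) (hDX : D = ⋃ i, (X i).carrier) (hunb : κ ≤ #D)
    {a : V} (hea : e a = a) (ha : a ≠ 0) :
    Dfn L M (fun p : V × V × V => ∃ t ∈ D, p.1 = t a ∧ p.2.2 = t p.2.1) := by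
  classical
  have heF : DFun L M (fun x => e x) := mem_defEnd_iff.1 he
  have hXD : ∀ i, (X i).carrier ⊆ D := fun i => hDX ▸ subset_iUnion (fun i => (X i).carrier) i
  have hmem : ∀ t ∈ D, ∃ i, t ∈ (X i).carrier := fun t ht => by
    rw [hDX] at ht
    exact mem_iUnion.1 ht
  -- The dimension of a merely type-definable orbit `X i a` is that of a smallest definable set
  -- around it.
  have hchoice : ∀ i, ∃ A : Set V, (Dfn L M (fun x => x ∈ A) ∧ ∀ s ∈ (X i).carrier, s a ∈ A) ∧
      ∀ B : Set V, (Dfn L M (fun x => x ∈ B) ∧ ∀ s ∈ (X i).carrier, s a ∈ B) →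
        vdim dim A ≤ vdim dim B := fun i =>
    exists_min_nat _ _ ⟨univ, .const True, fun _ _ => trivial⟩
  choose A hA hAmin using hchoice
  obtain ⟨i₀, -, hi₀⟩ := exists_max_of_bounded (fun _ : ι => True) (fun i => vdim dim (A i))
    (vdim dim (univ : Set V)) ((hmem e hD.unit_mem).imp fun _ _ => trivial)
    fun i _ => hdim.vdim_mono (hA i).1 (.const True) (subset_univ _)
  replace hi₀ := fun i => hi₀ i trivial
  set d := vdim dim (A i₀)
  have hcov : ∀ t ∈ D, ∃ i, t a ∈ A i := fun t ht => (hmem t ht).imp fun i hi => (hA i).2 t hi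
  -- If `d = 0`, all the `A i` are finite and their union is too small to receive the injection `t ↦
  -- t a` of `D`.
  have hd1 : 1 ≤ d := by
    by_contra hd
    have hfin : ∀ i, (A i).Finite := fun i =>
      hdim.vdim_finite (hA i).1 (by have := hi₀ i; omega)
    have hlt : #(⋃ i, A i : Set V) < κ := hM.mk_iUnion_lt hι fun i => by
      have := (hfin i).to_subtype
      exact hM.mk_lt_of_finite _
    refine (hunb.trans ?_).not_gt hlt
    refine mk_le_of_injective (f := fun t : D => (⟨(t : AddMonoid.End V) a,
      mem_iUnion.2 (hcov t t.2)⟩ : (⋃ i, A i : Set V))) fun t t' h => ?_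
    exact Subtype.ext (hD.eq_of_apply t.2 t'.2 hea ha (congrArg Subtype.val h))
  set Y := X i₀
  have hYD : Y.carrier ⊆ D := hXD i₀
  have hrel : ∀ b, ∀ A' : Set V, Dfn L M (fun x => x ∈ A') → vdim dim A' ≤ d →
      (∀ s ∈ Y.carrier, ∀ s' ∈ Y.carrier, s a + s' b ∈ A') →
      ∃ s₁ ∈ Y.carrier, ∃ s₂ ∈ Y.carrier, ∃ s₃ ∈ Y.carrier, ∃ s₄ ∈ Y.carrier,
        s₁ ≠ s₂ ∧ s₁ b - s₂ b = s₃ a - s₄ a := fun b A' h1 h2 h3 =>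
    Y.exists_relation hdim hM hd1 (fun B hB hB' => hAmin i₀ B ⟨hB, hB'⟩) h1 h2 h3
  have hsumD : ∀ s ∈ Y.carrier, ∀ s' ∈ Y.carrier, ∀ t ∈ D, ∃ i, s a + s' (t a) ∈ A i :=
    fun s hs s' hs' t ht =>
      hcov (s + s' * t) (hD.add_mem _ (hYD hs) _ (hD.mul_mem _ (hYD hs') _ ht))
  -- The sums `s a + s' (t a)` are values at `a` of elements of `D`. By compactness finitely many `A
  -- i` hold them all, which leaves no room for injectivity; so `t` is a quotient of differences
  -- from the single family `Y`.
  have hquot : ∀ t ∈ D, ∃ s₁ ∈ Y.carrier, ∃ s₂ ∈ Y.carrier, ∃ s₃ ∈ Y.carrier,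
      ∃ s₄ ∈ Y.carrier, s₁ ≠ s₂ ∧ s₁ (t a) - s₂ (t a) = s₃ a - s₄ a := by
    intro t ht
    obtain ⟨F, -, hYF, J, hJ⟩ := ((Y.tdfn_val hM a).comp (f := fun p : V × V => (p.1, p.2, t a))
      (by fun_prop)).exists_dfn_of_cover hM (Θ := (V × V) × (V × V)) (r := 2)
      (π := ![fun θ => θ.1, fun θ => θ.2]) (fun i => by fin_cases i <;> dsimp <;> fun_prop)
      hι (Ψ := fun i θ => θ.1.1 + θ.2.2 ∈ A i) (fun i => (hA i).1.comp (by fun_prop)) (by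
        rintro ⟨⟨p, q⟩, ⟨p', q'⟩⟩ h
        obtain ⟨s, hs, hp, -⟩ := h 0
        obtain ⟨s', hs', -, hq'⟩ := h 1
        simp only [Matrix.cons_val] at *
        subst hp hq'
        exact hsumD s hs s' hs' t ht)
    have hJA := hdim.vdim_biUnion_le (fun i => (hA i).1) hi₀ J
    refine hrel (t a) _ hJA.1 hJA.2 fun s hs s' hs' => ?_
    obtain ⟨j, hj, h⟩ := hJ ((s a, s (t a)), (s' a, s' (t a))) fun i => by
      fin_cases i
      exacts [hYF _ ⟨s, hs, rfl, rfl⟩, hYF _ ⟨s', hs', rfl, rfl⟩]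
    exact mem_iUnion₂.2 ⟨j, hj, h⟩
  have heb : ∀ t ∈ D, ∀ x, e (t x) = t x := fun t ht x => DFunLike.congr_fun (hD.unit_mul t ht) x
  -- Uniformly in `b`: once a relation witnesses `b ∈ D a`, the sums over `b` are covered by the `A
  -- i`. Compactness fixes `F` and a finite `J` for all such `b`; conversely, sums confined to that
  -- finite union produce a relation.
  obtain ⟨B, hB, hBD⟩ : ∃ B : V → Prop, Dfn L M B ∧ ∀ b, B b ↔ ∃ t ∈ D, b = t a := by
    obtain ⟨F, hF, hYF, J, hJ⟩ := (Y.tdfn_val hM a).exists_dfn_of_cover hM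
      (Θ := (((V × V) × (V × V)) × ((V × V) × (V × V))) × ((V × V) × (V × V)) × V) (r := 6)
      (π := ![fun θ => (θ.1.1.1.1, θ.1.1.1.2, θ.2.2), fun θ => (θ.1.1.2.1, θ.1.1.2.2, θ.2.2),
        fun θ => (θ.1.2.1.1, θ.1.2.1.2, θ.2.2), fun θ => (θ.1.2.2.1, θ.1.2.2.2, θ.2.2),
        fun θ => (θ.2.1.1.1, θ.2.1.1.2, θ.2.2), fun θ => (θ.2.1.2.1, θ.2.1.2.2, θ.2.2)])
      (fun i => by fin_cases i <;> dsimp <;> fun_prop) hι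
      (Ψ := fun i θ => e θ.2.2 = θ.2.2 ∧ ¬ θ.1.1.1.1 = θ.1.1.2.1 ∧
        θ.1.1.1.2 - θ.1.1.2.2 = θ.1.2.1.1 - θ.1.2.2.1 → θ.2.1.1.1 + θ.2.1.2.2 ∈ A i)
      (fun i => ((Dfn.eq (heF.comp (by fun_prop)) (by fun_prop)).and
        ((Dfn.eq (by fun_prop) (by fun_prop)).not.and
          (Dfn.eq (by fun_prop) (by fun_prop)))).imp ((hA i).1.comp (by fun_prop))) (by
        rintro ⟨⟨⟨⟨p₁, q₁⟩, ⟨p₂, q₂⟩⟩, ⟨⟨p₃, q₃⟩, ⟨p₄, q₄⟩⟩⟩, ⟨⟨p₅, q₅⟩, ⟨p₆, q₆⟩⟩, b⟩ h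
        obtain ⟨s₁, hs₁, hp₁, hq₁⟩ := h 0
        obtain ⟨s₂, hs₂, hp₂, hq₂⟩ := h 1
        obtain ⟨s₃, hs₃, hp₃, hq₃⟩ := h 2
        obtain ⟨s₄, hs₄, hp₄, hq₄⟩ := h 3
        obtain ⟨s₅, hs₅, hp₅, hq₅⟩ := h 4
        obtain ⟨s₆, hs₆, hp₆, hq₆⟩ := h 5
        simp only [Matrix.cons_val] at *
        subst hp₁ hq₁ hp₂ hq₂ hp₃ hq₃ hp₄ hq₄ hp₅ hq₅ hp₆ hq₆
        by_cases hc : e b = b ∧ ¬ s₁ a = s₂ a ∧ s₁ b - s₂ b = s₃ a - s₄ a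
        · obtain ⟨t, ht, htb⟩ := hD.exists_quotient (hYD hs₁) (hYD hs₂) (hYD hs₃) (hYD hs₄)
            fun h => hc.2.1 (by rw [h])
          rw [htb b a hc.1 hc.2.2]
          exact (hsumD s₅ hs₅ s₆ hs₆ t ht).imp fun i hi _ => hi
        · exact ⟨i₀, fun h => absurd h hc⟩)
    have hJA := hdim.vdim_biUnion_le (fun i => (hA i).1) hi₀ J
    refine ⟨fun b => e b = b ∧ ∀ x y : V × V, F (x.1, x.2, b) → F (y.1, y.2, b) →
      x.1 + y.2 ∈ ⋃ j ∈ J, A j, ?_, fun b => ⟨?_, ?_⟩⟩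
    · refine (Dfn.eq heF (by fun_prop)).and (.all (.all ((hF.comp
        (f := fun z : (V × V × V) × V × V => (z.1.2.1, z.1.2.2, z.1.1)) (by fun_prop)).imp
        ((hF.comp (f := fun z : (V × V × V) × V × V => (z.2.1, z.2.2, z.1.1)) (by fun_prop)).imp
          (hJA.1.comp (f := fun z : (V × V × V) × V × V => z.1.2.1 + z.2.2) (by fun_prop))))))
    · rintro ⟨hb, h⟩
      obtain ⟨s₁, hs₁, s₂, hs₂, s₃, hs₃, s₄, hs₄, hne, heq⟩ := hrel b _ hJA.1 hJA.2
        fun s hs s' hs' => h (s a, s b) (s' a, s' b) (hYF _ ⟨s, hs, rfl, rfl⟩)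
          (hYF _ ⟨s', hs', rfl, rfl⟩)
      obtain ⟨t, ht, htb⟩ := hD.exists_quotient (hYD hs₁) (hYD hs₂) (hYD hs₃) (hYD hs₄) hne
      exact ⟨t, ht, htb b a hb heq⟩
    · rintro ⟨t, ht, rfl⟩
      refine ⟨heb t ht a, fun x y hx hy => ?_⟩
      obtain ⟨s₁, hs₁, s₂, hs₂, s₃, hs₃, s₄, hs₄, hne, heq⟩ := hquot t ht
      obtain ⟨j, hj, h⟩ := hJ ((((s₁ a, s₁ (t a)), (s₂ a, s₂ (t a))),
        ((s₃ a, s₃ (t a)), (s₄ a, s₄ (t a)))), (x, y), t a) fun i => by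
          fin_cases i
          exacts [hYF _ ⟨s₁, hs₁, rfl, rfl⟩, hYF _ ⟨s₂, hs₂, rfl, rfl⟩,
            hYF _ ⟨s₃, hs₃, rfl, rfl⟩, hYF _ ⟨s₄, hs₄, rfl, rfl⟩, hx, hy]
      exact mem_iUnion₂.2 ⟨j, hj, h ⟨heb t ht a, fun h => hne (hD.eq_of_apply (hYD hs₁)
        (hYD hs₂) hea ha h), heq⟩⟩
  let C := Fin Y.arity → M
  let K : (C × C) × (C × C) → V → V → Prop := fun z u u' => ∃ y y' : V × V,
    (Y.graph z.1.1 u y.1 ∧ Y.graph z.1.2 u y.2) ∧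
      (Y.graph z.2.1 u' y'.1 ∧ Y.graph z.2.2 u' y'.2) ∧ y.1 - y.2 = y'.1 - y'.2
  have hK : Dfn L M (fun p : ((C × C) × (C × C)) × V × V => K p.1 p.2.1 p.2.2) := by
    refine .ex (.ex ((Dfn.and ?_ ?_).and ((Dfn.and ?_ ?_).and
      (.eq (by fun_prop) (by fun_prop)))))
    · exact Dfn.rel₃ Y.dfn_graph
        (f := fun q : ((((C × C) × (C × C)) × V × V) × V × V) × V × V => q.1.1.1.1.1)
        (by fun_prop) (g := fun q => q.1.1.2.1) (by fun_prop) (h := fun q => q.1.2.1) (by fun_prop)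
    · exact Dfn.rel₃ Y.dfn_graph
        (f := fun q : ((((C × C) × (C × C)) × V × V) × V × V) × V × V => q.1.1.1.1.2)
        (by fun_prop) (g := fun q => q.1.1.2.1) (by fun_prop) (h := fun q => q.1.2.2) (by fun_prop)
    · exact Dfn.rel₃ Y.dfn_graph
        (f := fun q : ((((C × C) × (C × C)) × V × V) × V × V) × V × V => q.1.1.1.2.1)
        (by fun_prop) (g := fun q => q.1.1.2.2) (by fun_prop) (h := fun q => q.2.1) (by fun_prop)
    · exact Dfn.rel₃ Y.dfn_graph
        (f := fun q : ((((C × C) × (C × C)) × V × V) × V × V) × V × V => q.1.1.1.2.2)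
        (by fun_prop) (g := fun q => q.1.1.2.2) (by fun_prop) (h := fun q => q.2.2) (by fun_prop)
  have hKs : ∀ z : (C × C) × (C × C), ∀ s₁ s₂ s₃ s₄ : AddMonoid.End V,
      (∀ x y, Y.graph z.1.1 x y ↔ s₁ x = y) → (∀ x y, Y.graph z.1.2 x y ↔ s₂ x = y) →
      (∀ x y, Y.graph z.2.1 x y ↔ s₃ x = y) → (∀ x y, Y.graph z.2.2 x y ↔ s₄ x = y) →
      ∀ u u', K z u u' ↔ s₁ u - s₂ u = s₃ u' - s₄ u' := by
    intro z s₁ s₂ s₃ s₄ h1 h2 h3 h4 u u'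
    constructor
    · rintro ⟨y, y', ⟨h5, h6⟩, ⟨h7, h8⟩, h9⟩
      rw [(h1 _ _).1 h5, (h2 _ _).1 h6, (h3 _ _).1 h7, (h4 _ _).1 h8, h9]
    · intro h
      exact ⟨(s₁ u, s₂ u), (s₃ u', s₄ u'), ⟨(h1 _ _).2 rfl, (h2 _ _).2 rfl⟩,
        ⟨(h3 _ _).2 rfl, (h4 _ _).2 rfl⟩, h⟩
  let E : V × V × V → Prop := fun p => ∃ z : (C × C) × (C × C),
    ((Y.code z.1.1 ∧ Y.code z.1.2) ∧ (Y.code z.2.1 ∧ Y.code z.2.2)) ∧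
      (¬ ∃ y, Y.graph z.1.1 a y ∧ Y.graph z.1.2 a y) ∧ (e p.1 = p.1 ∧ e p.2.2 = p.2.2) ∧
      K z p.1 a ∧ K z p.2.2 p.2.1
  -- The evaluation relation is type-definable because all of `D` is obtained from codes in `Y`,
  -- with inverses avoided by clearing denominators.
  have hE : TDfn L M κ E := by
    refine .ex hM ((((Y.tdfn_code.comp (by fun_prop)).and hM (Y.tdfn_code.comp (by fun_prop))).and
      hM ((Y.tdfn_code.comp (by fun_prop)).and hM (Y.tdfn_code.comp (by fun_prop)))).and hM
      (Dfn.tdfn hM (.and (.not (.ex (.and ?_ ?_))) (.and (.and ?_ ?_) (.and ?_ ?_)))))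
    · exact Dfn.rel₃ Y.dfn_graph (f := fun q : ((V × V × V) × (C × C) × (C × C)) × V => q.1.2.1.1)
        (by fun_prop) (g := fun _ => a) (by fun_prop) (h := fun q => q.2) (by fun_prop)
    · exact Dfn.rel₃ Y.dfn_graph (f := fun q : ((V × V × V) × (C × C) × (C × C)) × V => q.1.2.1.2)
        (by fun_prop) (g := fun _ => a) (by fun_prop) (h := fun q => q.2) (by fun_prop)
    · exact .eq (heF.comp (by fun_prop)) (by fun_prop)
    · exact .eq (heF.comp (by fun_prop)) (by fun_prop)
    · exact Dfn.rel₃ hK (f := fun q : (V × V × V) × (C × C) × (C × C) => q.2)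
        (by fun_prop) (g := fun q => q.1.1) (by fun_prop) (h := fun _ => a) (by fun_prop)
    · exact Dfn.rel₃ hK (f := fun q : (V × V × V) × (C × C) × (C × C) => q.2)
        (by fun_prop) (g := fun q => q.1.2.2) (by fun_prop) (h := fun q => q.1.2.1) (by fun_prop)
  have hED : ∀ p v w, E (p, v, w) ↔ ∃ t ∈ D, p = t a ∧ w = t v := by
    intro p v w
    constructor
    · rintro ⟨z, ⟨⟨c₁, c₂⟩, c₃, c₄⟩, hne, ⟨hp, hw⟩, hK1, hK2⟩
      obtain ⟨s₁, hs₁⟩ := Y.exists_end _ c₁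
      obtain ⟨s₂, hs₂⟩ := Y.exists_end _ c₂
      obtain ⟨s₃, hs₃⟩ := Y.exists_end _ c₃
      obtain ⟨s₄, hs₄⟩ := Y.exists_end _ c₄
      have hKz := hKs z s₁ s₂ s₃ s₄ hs₁ hs₂ hs₃ hs₄
      obtain ⟨t, ht, htb⟩ := hD.exists_quotient (hYD ⟨_, c₁, hs₁⟩) (hYD ⟨_, c₂, hs₂⟩)
        (hYD ⟨_, c₃, hs₃⟩) (hYD ⟨_, c₄, hs₄⟩) fun h => hne ⟨s₁ a, (hs₁ _ _).2 rfl,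
          (hs₂ _ _).2 (by rw [h])⟩
      exact ⟨t, ht, htb _ _ hp ((hKz _ _).1 hK1), htb _ _ hw ((hKz _ _).1 hK2)⟩
    · rintro ⟨t, ht, rfl, rfl⟩
      obtain ⟨s₁, hs₁, s₂, hs₂, s₃, hs₃, s₄, hs₄, hne, heq⟩ := hquot t ht
      obtain ⟨t', ht', htb⟩ := hD.exists_quotient (hYD hs₁) (hYD hs₂) (hYD hs₃) (hYD hs₄) hne
      obtain ⟨z₁, c₁, h₁⟩ := id hs₁
      obtain ⟨z₂, c₂, h₂⟩ := id hs₂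
      obtain ⟨z₃, c₃, h₃⟩ := id hs₃
      obtain ⟨z₄, c₄, h₄⟩ := id hs₄
      have hKz := hKs ((z₁, z₂), (z₃, z₄)) s₁ s₂ s₃ s₄ h₁ h₂ h₃ h₄
      have hmul : (s₁ - s₂) * t = s₃ - s₄ := hD.eq_of_apply
        (hD.mul_mem _ (hD.sub_mem _ (hYD hs₁) _ (hYD hs₂)) _ ht)
        (hD.sub_mem _ (hYD hs₃) _ (hYD hs₄)) hea ha heq
      refine ⟨((z₁, z₂), (z₃, z₄)), ⟨⟨c₁, c₂⟩, c₃, c₄⟩, ?_, ⟨heb t ht a, heb t ht v⟩,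
        (hKz _ _).2 heq, (hKz _ _).2 (DFunLike.congr_fun hmul v)⟩
      rintro ⟨y, hy1, hy2⟩
      exact hne (hD.eq_of_apply (hYD hs₁) (hYD hs₂) hea ha
        (((h₁ _ _).1 hy1).trans ((h₂ _ _).1 hy2).symm))
  -- Functionality of `E` in its last coordinate passes to a definable `F ⊇ E`. Over `p ∈ D a` the
  -- true value is already in `F`, so there `F` and `E` coincide.
  obtain ⟨F, hF, hEF, hFu⟩ := hE.exists_dfn hM (Θ := (V × V) × (V × V)) (r := 2)
    (π := ![fun θ => (θ.1.1, θ.1.2, θ.2.1), fun θ => (θ.1.1, θ.1.2, θ.2.2)])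
    (fun i => by fin_cases i <;> dsimp <;> fun_prop)
    (Ψ := fun θ => θ.2.1 = θ.2.2) (.eq (by fun_prop) (by fun_prop)) (by
      rintro ⟨⟨p, v⟩, ⟨w, w'⟩⟩ h
      obtain ⟨t, ht, h1, h2⟩ := (hED _ _ _).1 (h 0)
      obtain ⟨t', ht', h1', h2'⟩ := (hED _ _ _).1 (h 1)
      rw [hD.eq_of_apply ht ht' hea ha (h1.symm.trans h1')] at h2
      exact h2.trans h2'.symm)
  refine ((hB.comp (f := fun p : V × V × V => p.1) (by fun_prop)).and hF).congr ?_
  rintro ⟨p, v, w⟩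
  constructor
  · rintro ⟨hp, hFp⟩
    obtain ⟨t, ht, rfl⟩ := (hBD p).1 hp
    have := hFu ((t a, v), (w, t v)) fun i => by
      fin_cases i
      exacts [hFp, hEF _ ((hED _ _ _).2 ⟨t, ht, rfl, rfl⟩)]
    exact ⟨t, ht, rfl, this⟩
  · rintro ⟨t, ht, h1, h2⟩
    exact ⟨(hBD p).2 ⟨t, ht, h1⟩, hEF _ ((hED _ _ _).2 ⟨t, ht, h1, h2⟩)⟩

end Division

/-! ### Definable subgroups of `V` as an instance of `GroupDim`. -/

section GroupDim

variable {L : FirstOrder.Language.{u, v}} {M : Type w} [L.Structure M] {n : ℕ}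
variable (V : Set (Fin n → M)) [AddCommGroup V] [hV : DefGroup L V]

variable (L) in
/-- The ring of definable endomorphisms. -/
def defEndRing : Subring (AddMonoid.End V) where
  carrier := defEnd L V
  mul_mem' {_ _} hf hg := mem_defEnd_iff.2
    ((mem_defEnd_iff.1 hf).comp (mem_defEnd_iff.1 hg))
  one_mem' := mem_defEnd_iff.2 DFun.id
  add_mem' {_ _} hf hg := mem_defEnd_iff.2
    ((mem_defEnd_iff.1 hf).add (mem_defEnd_iff.1 hg))
  zero_mem' := mem_defEnd_iff.2 (DFun.const 0)
  neg_mem' {_} hf := mem_defEnd_iff.2 (mem_defEnd_iff.1 hf).neg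

lemma mem_defEndRing {f : AddMonoid.End V} : f ∈ defEndRing L V ↔ DFun L M (fun x => f x) :=
  mem_defEnd_iff

variable {V}

lemma dfn_sup {H W : AddSubgroup V} (hH : Dfn L M (fun x => x ∈ H))
    (hW : Dfn L M (fun x => x ∈ W)) : Dfn L M (fun x => x ∈ H ⊔ W) := by
  have h : Dfn L M (fun x : V => ∃ p : V × V, (p.1 ∈ H ∧ p.2 ∈ W) ∧ p.1 + p.2 = x) :=
    .ex (((hH.comp (by fun_prop)).and (hW.comp (by fun_prop))).and
      (.eq (by fun_prop) (by fun_prop)))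
  refine h.congr fun x => AddSubgroup.mem_sup.symm |> Iff.trans ⟨?_, ?_⟩
  · rintro ⟨p, ⟨h1, h2⟩, h3⟩
    exact ⟨p.1, h1, p.2, h2, h3⟩
  · rintro ⟨y, h1, z, h2, h3⟩
    exact ⟨(y, z), ⟨h1, h2⟩, h3⟩

lemma dfn_map {W : AddSubgroup V} {f : AddMonoid.End V} (hW : Dfn L M (fun x => x ∈ W))
    (hf : DFun L M (fun x => f x)) : Dfn L M (fun y => y ∈ W.map (f : V →+ V)) :=
  .ex (P := fun y x => x ∈ W ∧ f x = y) ((hW.comp (by fun_prop)).and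
    (.eq (hf.comp (by fun_prop)) (by fun_prop)))

/-- A definable homomorphism solving `u y = h x` with `y` in a definable subgroup. -/
lemma exists_definable_quotient {W : AddSubgroup V} {u h : AddMonoid.End V}
    (hW : Dfn L M (fun x => x ∈ W)) (hu : DFun L M (fun x => u x)) (hh : DFun L M (fun x => h x))
    (hex : ∀ x, ∃! y, y ∈ W ∧ u y = h x) :
    ∃ k ∈ defEndRing L V, ∀ x, k x ∈ W ∧ u (k x) = h x := by
  choose k hk huniq using hex
  let k' : AddMonoid.End V := AddMonoidHom.mk' k fun x y =>
    (huniq (x + y) (k x + k y) ⟨W.add_mem (hk x).1 (hk y).1, by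
      rw [map_add, map_add, (hk x).2, (hk y).2]⟩).symm
  refine ⟨k', (mem_defEndRing V).2 ?_, hk⟩
  have : Dfn L M (fun p : V × V => p.2 ∈ W ∧ u p.2 = h p.1) :=
    (hW.comp (by fun_prop)).and (.eq (hu.comp (by fun_prop)) (hh.comp (by fun_prop)))
  exact this.congr fun p => ⟨fun h => huniq p.1 p.2 h, fun h => by
    rw [h]
    exact hk p.1⟩

/-- The dimension on the definable subgroups of `V`. -/
noncomputable def groupDim {dim : ∀ σ : ImagSort L M, Set σ.Elt → WithBot ℕ}
    (hdim : IsDimension dim) : GroupDim V where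
  Def W := Dfn L M (fun x => x ∈ W)
  Hom := defEndRing L V
  dim W := vdim dim (W : Set V)
  def_bot := (dfn_eq_const (0 : V)).congr fun x => AddSubgroup.mem_bot.symm
  def_top := (Dfn.const True).congr fun x => by simp
  def_sup := dfn_sup
  def_inf h h' := (h.and h').congr fun x => AddSubgroup.mem_inf.symm
  def_map hW hf := dfn_map hW ((mem_defEndRing V).1 hf)
  def_comap hW hf := hW.comp ((mem_defEndRing V).1 hf)
  dim_mono hH hW h := hdim.vdim_mono hH hW h
  dim_lt := hdim.vdim_lt_of_relIndex
  dim_map {W f} hW hf := by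
    have hf' := (mem_defEndRing V).1 hf
    have hgr : Dfn L M (fun p : V × V => p.1 ∈ (W : Set V) ∧ f p.1 = p.2) :=
      (hW.comp (by fun_prop)).and (.eq (hf'.comp (by fun_prop)) (by fun_prop))
    have hker : Dfn L M (fun x => x ∈ W ⊓ AddMonoidHom.ker (f : V →+ V)) :=
      hW.and (.eq hf' (by fun_prop))
    refine hdim.vdim_add_le hW (dfn_map hW hf') (f := fun x => f x)
      (fun x hx => ⟨x, hx, rfl⟩) (fun y hy => hy) ⟨0, W.zero_mem⟩ hgr _ ?_
    rintro _ ⟨x, hx, rfl⟩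
    refine hdim.vdim_image_le (X := {y | y ∈ (W : Set V) ∧ f y = f x})
      (hgr.comp (f := fun y => (y, f x)) (by fun_prop)) hker (f := fun y => x - y)
      (fun y hy => ⟨W.sub_mem hx hy.1, ?_⟩) (fun y hy => ⟨x - y, ⟨W.sub_mem hx hy.1, ?_⟩, by simp⟩)
      ?_
    · have : f (x - y) = 0 := by rw [map_sub, hy.2, sub_self]
      exact this
    · have : f y = 0 := hy.2
      rw [map_sub, this, sub_zero]
    · exact (Dfn.comp hgr (f := fun p : V × V => (p.1, f x)) (by fun_prop)).and
        (.eq (by fun_prop) (by fun_prop))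
  finite_of_dim := hdim.vdim_finite
  exists_div hW hu hh hex := exists_definable_quotient hW ((mem_defEndRing V).1 hu)
    ((mem_defEndRing V).1 hh) hex

end GroupDim

/-! ### Orbits of a division ring. -/

section Orbit

variable {M : Type w} {n : ℕ} {V : Set (Fin n → M)} [AddCommGroup V]
variable {D : Set (AddMonoid.End V)} {e : AddMonoid.End V}

/-- The orbit of a vector under a division ring of endomorphisms. -/
def IsEndDivision.orbit (hD : IsEndDivision D e) (b : V) : AddSubgroup V where
  carrier := {x | ∃ d ∈ D, x = d b}
  add_mem' := by
    rintro _ _ ⟨d, hd, rfl⟩ ⟨d', hd', rfl⟩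
    exact ⟨d + d', hD.add_mem _ hd _ hd', rfl⟩
  zero_mem' := ⟨0, by simpa using hD.sub_mem _ hD.unit_mem _ hD.unit_mem, rfl⟩
  neg_mem' := by
    rintro _ ⟨d, hd, rfl⟩
    refine ⟨0 - d, hD.sub_mem _ (by simpa using hD.sub_mem _ hD.unit_mem _ hD.unit_mem) _ hd, ?_⟩
    rw [zero_sub]
    rfl

lemma IsEndDivision.mem_of_apply_mem (hD : IsEndDivision D e) {W : AddSubgroup V}
    (hW : ∀ d ∈ D, ∀ x ∈ W, d x ∈ W) {b : V} (hb : e b = b) {d : AddMonoid.End V} (hd : d ∈ D)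
    (h0 : d ≠ 0) (h : d b ∈ W) : b ∈ W := by
  obtain ⟨d', hd', h'⟩ := hD.exists_inv d hd h0
  rw [← hb, ← h']
  exact hW d' hd' _ h

/-- Distinct `d` give distinct classes of `d b` modulo `W`, since a non-zero difference sending `b`
into `W` could be inverted. -/
lemma IsEndDivision.relIndex_orbit (hD : IsEndDivision D e) (hinf : D.Infinite)
    {W : AddSubgroup V} (hW : ∀ d ∈ D, ∀ x ∈ W, d x ∈ W) {b : V} (hb : e b = b) (hbW : b ∉ W) :
    W.relIndex (W ⊔ hD.orbit b) = 0 := by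
  have := hinf.to_subtype
  refine AddSubgroup.index_eq_zero_iff_infinite.2 ?_
  have hmem : ∀ d : D, (d : AddMonoid.End V) b ∈ W ⊔ hD.orbit b := fun d =>
    AddSubgroup.mem_sup_right ⟨d, d.2, rfl⟩
  refine Infinite.of_injective (fun d : D => QuotientAddGroup.mk (⟨_, hmem d⟩ :
    (W ⊔ hD.orbit b : AddSubgroup V))) fun d d' h => ?_
  have h' := QuotientAddGroup.eq.1 h
  rw [AddSubgroup.mem_addSubgroupOf] at h'
  by_contra hne
  refine hbW (hD.mem_of_apply_mem hW hb (hD.sub_mem _ d'.2 _ d.2)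
    (sub_ne_zero.2 fun h => hne (Subtype.ext h.symm)) ?_)
  have h2 : -((d : AddMonoid.End V) b) + (d' : AddMonoid.End V) b ∈ W := h'
  rwa [neg_add_eq_sub] at h2

lemma IsEndDivision.sup_orbit_inv (hD : IsEndDivision D e) {W : AddSubgroup V}
    (hW : ∀ d ∈ D, ∀ x ∈ W, d x ∈ W) (b : V) :
    ∀ d ∈ D, ∀ x ∈ W ⊔ hD.orbit b, d x ∈ W ⊔ hD.orbit b := by
  intro d hd x hx
  obtain ⟨y, hy, _, ⟨d', hd', rfl⟩, rfl⟩ := AddSubgroup.mem_sup.1 hx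
  rw [map_add]
  exact AddSubgroup.mem_sup.2 ⟨_, hW d hd y hy, _, ⟨d * d', hD.mul_mem _ hd _ hd', rfl⟩, rfl⟩

end Orbit

/-! ### From unbounded `S` to unbounded `T`. -/

section Unbounded

variable {L : FirstOrder.Language.{u, v}} {M : Type w} [L.Structure M] {κ : Cardinal.{w}}
variable {n : ℕ} {V : Set (Fin n → M)} [AddCommGroup V] [hV : DefGroup L V]

/-- The family `e X e`. -/
def EndFamily.corner (X : EndFamily L κ V) {e : AddMonoid.End V} (he : DFun L M (fun x => e x)) :
    EndFamily L κ V where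
  arity := X.arity
  code := X.code
  graph z x y := ∃ u, X.graph z (e x) u ∧ e u = y
  tdfn_code := X.tdfn_code
  dfn_graph := .ex (.and
    (Dfn.rel₃ X.dfn_graph (f := fun q : ((Fin X.arity → M) × V × V) × V => q.1.1) (by fun_prop)
      (g := fun q => e q.1.2.1) (he.comp (by fun_prop)) (h := fun q => q.2) (by fun_prop))
    (.eq (he.comp (by fun_prop)) (by fun_prop)))
  exists_end z hz := by
    obtain ⟨s, hs⟩ := X.exists_end z hz
    refine ⟨e * s * e, fun x y => ?_⟩
    simp only [hs, exists_eq_left']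
    rfl

lemma EndFamily.corner_carrier (X : EndFamily L κ V) {e : AddMonoid.End V}
    (he : DFun L M (fun x => e x)) : (X.corner he).carrier = (fun s => e * s * e) '' X.carrier := by
  ext f
  constructor
  · rintro ⟨z, hz, hf⟩
    obtain ⟨s, hs⟩ := X.exists_end z hz
    exact ⟨s, ⟨z, hz, hs⟩, end_ext fun x => ((hf x _).1 ⟨s (e x), (hs _ _).2 rfl, rfl⟩).symm⟩
  · rintro ⟨s, ⟨z, hz, hs⟩, rfl⟩
    refine ⟨z, hz, fun x y => ?_⟩
    change (∃ u, X.graph z (e x) u ∧ e u = y) ↔ _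
    simp only [hs, exists_eq_left']
    rfl

lemma IsMonster.mk_fin_fun_lt (hM : IsMonster L M κ) {D : Type w} (hD : #D < κ) (k : ℕ) :
    #(Fin k → D) < κ := by
  have h1 : #(Fin k → D) = #D ^ k := by simp
  rw [h1]
  calc #D ^ k ≤ (max #D ℵ₀) ^ k := by
        exact_mod_cast power_le_power_right (le_max_left _ _)
    _ ≤ max #D ℵ₀ := power_nat_le (le_max_right _ _)
    _ < κ := max_lt hD hM.uncountable

open GroupDim in
/-- If `S` is unbounded then so is its centraliser. -/
lemma unbounded_centralizer (hM : IsMonster L M κ)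
    {dim : ∀ σ : ImagSort L M, Set σ.Elt → WithBot ℕ} (hdim : IsDimension dim)
    {S T : Subring (AddMonoid.End V)} (hP : (groupDim (V := V) hdim).IsPair S T)
    (hS : IsInvariantSet L κ (S : Set (AddMonoid.End V))) (hunb : κ ≤ #S)
    (hNF : ∀ N : AddSubgroup V, (N : Set V).Finite → Inv T N → N = ⊥) : κ ≤ #T := by
  classical
  set G := groupDim (V := V) hdim with hG
  obtain ⟨e, heS, he0, hee, hediv⟩ := hP.exists_primitive hNF
  obtain ⟨m, a, b, ha, hb, hab⟩ := hP.exists_sum_eq_one hNF heS he0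
  have heF : DFun L M (fun x => e x) := (mem_defEndRing V).1 (hP.S_le heS)
  let D : Set (AddMonoid.End V) := {d | d ∈ S ∧ e * d = d ∧ d * e = d}
  have hcorner : ∀ s ∈ S, e * s * e ∈ D := fun s hs =>
    ⟨S.mul_mem (S.mul_mem heS hs) heS, by simp only [← mul_assoc, hee],
      by simp only [mul_assoc, hee]⟩
  have hD : IsEndDivision D e :=
    { add_mem := fun d hd d' hd' => ⟨S.add_mem hd.1 hd'.1, by rw [mul_add, hd.2.1, hd'.2.1],
        by rw [add_mul, hd.2.2, hd'.2.2]⟩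
      sub_mem := fun d hd d' hd' => ⟨S.sub_mem hd.1 hd'.1, by rw [mul_sub, hd.2.1, hd'.2.1],
        by rw [sub_mul, hd.2.2, hd'.2.2]⟩
      mul_mem := fun d hd d' hd' => ⟨S.mul_mem hd.1 hd'.1, by rw [← mul_assoc, hd.2.1],
        by rw [mul_assoc, hd'.2.2]⟩
      unit_mem := ⟨heS, hee, hee⟩
      unit_mul := fun d hd => hd.2.1
      mul_unit := fun d hd => hd.2.2
      exists_inv := fun d hd h0 => by
        obtain ⟨d', h1, h2, h3, h4⟩ := hediv d hd.1 hd.2.1 hd.2.2 h0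
        exact ⟨d', ⟨h1, h2, h3⟩, h4⟩ }
  -- The matrix of corner elements `e * (b i * s * a j) * e` determines `s`, so `S` embeds in a
  -- finite power of `D`.
  have hDunb : κ ≤ #D := by
    by_contra! hlt
    refine (hM.mk_fin_fun_lt (hM.mk_fin_fun_lt hlt m) m).not_ge (hunb.trans ?_)
    refine mk_le_of_injective (f := fun (s : S) (i j : Fin m) =>
      (⟨e * (b i * s * a j) * e, hcorner _ (S.mul_mem (S.mul_mem (hb i) s.2) (ha j))⟩ : D))
      fun s s' h => Subtype.ext ?_
    have key : ∀ s : AddMonoid.End V,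
        ∑ i, ∑ j, a i * (e * (b i * s * a j) * e) * b j = s := fun s => by
      calc ∑ i, ∑ j, a i * (e * (b i * s * a j) * e) * b j
          = (∑ i, a i * e * b i) * (s * ∑ j, a j * e * b j) := by
            simp only [Finset.mul_sum, Finset.sum_mul, mul_assoc]
            rw [Finset.sum_comm]
        _ = s := by rw [hab, one_mul, mul_one]
    rw [← key s, ← key s']
    refine Finset.sum_congr rfl fun i _ => Finset.sum_congr rfl fun j _ => ?_
    have h' : e * (b i * (s : AddMonoid.End V) * a j) * e =
        e * (b i * (s' : AddMonoid.End V) * a j) * e :=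
      congrArg Subtype.val (congrFun (congrFun h i) j)
    rw [h']
  have hDinf : D.Infinite := infinite_coe_iff.1
    (infinite_iff.2 (hM.uncountable.le.trans hDunb))
  obtain ⟨ι, X, hι, hSX⟩ := exists_families hS
  have hDX : D = ⋃ i, ((X i).corner heF).carrier := by
    simp only [EndFamily.corner_carrier]
    rw [← image_iUnion, ← hSX]
    ext d
    constructor
    · intro hd
      exact ⟨d, hd.1, by change e * d * e = d; rw [hd.2.1, hd.2.2]⟩
    · rintro ⟨s, hs, rfl⟩
      exact hcorner s hs
  obtain ⟨x₀, hx₀⟩ : ∃ x, e x ≠ 0 := by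
    by_contra! h
    exact he0 (end_ext h)
  set c := e x₀
  have hec : e c = c := DFunLike.congr_fun hee x₀
  have hEv := hD.dfn_eval hdim hM (hP.S_le heS) hι hDX hDunb hec hx₀
  have horb : ∀ y, Dfn L M (fun x => x ∈ hD.orbit y) := fun y => by
    have : Dfn L M (fun x : V => ∃ p : V, ∃ t ∈ D, p = t c ∧ x = t y) :=
      .ex (hEv.comp (f := fun q : V × V => (q.2, y, q.1)) (by fun_prop))
    refine this.congr fun x => ⟨?_, ?_⟩
    · rintro ⟨-, t, ht, -, h⟩
      exact ⟨t, ht, h⟩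
    · rintro ⟨t, ht, h⟩
      exact ⟨t c, t, ht, rfl, h⟩
  -- `W` acts as a definable hyperplane avoiding `c`. If `e y ∉ W`, adding its orbit increases the
  -- dimension and so captures `c`; solving for `e y` puts it in `W + D c`.
  obtain ⟨W, ⟨hWd, hWD, hcW⟩, hWmax⟩ := exists_max_of_bounded
    (fun W : AddSubgroup V => G.Def W ∧ (∀ d ∈ D, ∀ x ∈ W, d x ∈ W) ∧ c ∉ W) G.dim (G.dim ⊤)
    ⟨⊥, G.def_bot, fun d _ x hx => by rw [AddSubgroup.mem_bot] at *; rw [hx, map_zero],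
      fun h => hx₀ (AddSubgroup.mem_bot.1 h)⟩ fun W hW => G.dim_mono hW.1 G.def_top le_top
  have hspan : ∀ y, ∃ w ∈ W, ∃ d ∈ D, e y = w + d c := by
    intro y
    by_contra! hcon
    have hey : e (e y) = e y := DFunLike.congr_fun hee y
    have hyW : e y ∉ W := fun h => hcon (e y) h 0
      (by simpa using hD.sub_mem _ hD.unit_mem _ hD.unit_mem) (add_zero _).symm
    have hWd' : G.Def (W ⊔ hD.orbit (e y)) := dfn_sup hWd (horb (e y))
    refine (G.dim_lt hWd hWd' le_sup_left (hD.relIndex_orbit hDinf hWD hey hyW)).not_ge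
      (hWmax _ ⟨hWd', hD.sup_orbit_inv hWD _, fun h => ?_⟩)
    obtain ⟨w, hw, _, ⟨d, hd, rfl⟩, hwd⟩ := AddSubgroup.mem_sup.1 h
    have hd0 : d ≠ 0 := by
      rintro rfl
      exact hcW (hwd ▸ (add_zero w).symm ▸ hw)
    obtain ⟨d', hd', hdd⟩ := hD.exists_inv d hd hd0
    refine hcon (- d' w) (W.neg_mem (hWD d' hd' w hw)) d' hd' ?_
    have h1 : d' (d (e y)) = e y := (DFunLike.congr_fun hdd (e y)).trans hey
    rw [← hwd, map_add, h1, neg_add_cancel_left]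
  have huniq : ∀ w ∈ W, ∀ w' ∈ W, ∀ d ∈ D, ∀ d' ∈ D, w + d c = w' + d' c → d = d' := by
    intro w hw w' hw' d hd d' hd' h
    by_contra hne
    refine hcW (hD.mem_of_apply_mem hWD hec (hD.sub_mem _ hd _ hd') (sub_ne_zero.2 hne) ?_)
    have h' : (d - d') c = w' - w := by
      change d c - d' c = w' - w
      rw [sub_eq_sub_iff_add_eq_add, add_comm, h, add_comm]
    rw [h']
    exact W.sub_mem hw' hw
  choose w hw d hd hwd using hspan
  -- For each `x` in `e V`, the map `w + d c ↦ d x` is definable and commutes with `D`; it extends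
  -- to an element of `T`.
  have hext : ∀ x, e x = x → ∃ t ∈ T, t c = x := by
    intro x hx
    let p : AddMonoid.End V := AddMonoidHom.mk' (fun y => d y x) fun y y' => by
      have := huniq _ (hw (y + y')) _ (W.add_mem (hw y) (hw y')) _ (hd (y + y')) _
        (hD.add_mem _ (hd y) _ (hd y')) (by
          rw [← hwd, map_add, hwd, hwd, add_add_add_comm]
          rfl)
      rw [this]
      rfl
    have hpv : ∀ y, ∀ w' ∈ W, ∀ d' ∈ D, e y = w' + d' c → p y = d' x := by
      intro y w' hw' d' hd' h
      change d y x = d' x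
      rw [huniq _ (hw y) w' hw' _ (hd y) d' hd' ((hwd y).symm.trans h)]
    have hpF : p ∈ defEndRing L V := by
      refine (mem_defEndRing V).2 ?_
      have h : Dfn L M (fun q : V × V => ∃ r : V × V, (r.1 ∈ W ∧ e q.1 = r.1 + r.2) ∧
          ∃ t ∈ D, r.2 = t c ∧ q.2 = t x) :=
        .ex (((hWd.comp (by fun_prop)).and (.eq (heF.comp (by fun_prop)) (by fun_prop))).and
          (hEv.comp (f := fun s : (V × V) × V × V => (s.2.2, x, s.1.2)) (by fun_prop)))
      refine h.congr fun q => ⟨?_, fun hq => ?_⟩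
      · rintro ⟨r, ⟨h1, h2⟩, t, ht, h3, h4⟩
        rw [h4]
        exact (hpv q.1 r.1 h1 t ht (h3 ▸ h2)).symm
      · exact ⟨(w q.1, d q.1 c), ⟨hw q.1, hwd q.1⟩, d q.1, hd q.1, rfl, hq⟩
    have hep : e * p = p := end_ext fun y => DFunLike.congr_fun (hD.unit_mul _ (hd y)) x
    have hpe : p * e = p := end_ext fun y =>
      hpv (e y) (w y) (hw y) (d y) (hd y) ((DFunLike.congr_fun hee y).trans (hwd y))
    have hcomm : ∀ s ∈ S, e * s * e * p = p * (e * s * e) := by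
      intro s hs
      have hr := hcorner s hs
      refine end_ext fun y => ?_
      generalize e * s * e = r at hr
      refine (hpv (r y) (r (w y)) (hWD r hr _ (hw y)) (r * d y) (hD.mul_mem _ hr _ (hd y)) ?_).symm
      have h1 : e (r y) = r (e y) :=
        (DFunLike.congr_fun (hD.unit_mul r hr) y).trans
          (DFunLike.congr_fun (hD.mul_unit r hr) y).symm
      rw [h1, hwd, map_add]
      rfl
    refine ⟨_, hP.extend_mem ha hb hab hpF hep hpe hcomm, ?_⟩
    have hpc : p c = x := (hpv c 0 W.zero_mem e hD.unit_mem (by rw [zero_add])).trans hx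
    have hsum : (∑ i, a i * p * b i) * e = (∑ i, a i * e * b i) * (e * p) := by
      rw [hep, Finset.sum_mul, Finset.sum_mul]
      refine Finset.sum_congr rfl fun i _ => ?_
      have := hcomm (b i) (hb i)
      calc a i * p * b i * e = a i * (p * e) * b i * e := by rw [hpe]
        _ = a i * (p * (e * b i * e)) := by simp only [mul_assoc]
        _ = a i * (e * b i * e * p) := by rw [this]
        _ = a i * e * b i * (e * p) := by simp only [mul_assoc]
        _ = a i * e * b i * p := by rw [hep]
    have h2 := DFunLike.congr_fun hsum c
    rw [hab, one_mul, hep] at h2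
    have h3 : (∑ i, a i * p * b i) (e c) = p c := h2
    rw [← hpc, ← h3, hec]
  choose t ht htc using hext
  refine hDunb.trans (mk_le_of_injective (f := fun r : D => (⟨t ((r : AddMonoid.End V) c)
    (DFunLike.congr_fun (hD.unit_mul r r.2) c), ht _ _⟩ : T)) fun r r' h => ?_)
  refine Subtype.ext (hD.eq_of_apply r.2 r'.2 hec hx₀ ?_)
  have h' := congrArg Subtype.val h
  exact (htc _ _).symm.trans ((DFunLike.congr_fun h' c).trans (htc _ _))

end Unbounded

/-! ### Definable linear maps and definable sets of endomorphisms. -/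

section DefinableMaps

variable {L : FirstOrder.Language.{u, v}} {M : Type w} [L.Structure M]

variable (L M) in
instance DSort.pi (ι : Type) [Finite ι] (Γ : Type*) [hΓ : DSort L M Γ] : DSort L M (ι → Γ) where
  idx := ι × hΓ.idx
  fin := inferInstance
  emb w p := hΓ.emb (w p.1) p.2
  inj w w' h := funext fun i => hΓ.inj (funext fun j => congrFun h (i, j))
  rng := by
    have : IsDef L (⋂ i : ι, {w : ι × hΓ.idx → M | w ∘ (fun j => (i, j)) ∈ range hΓ.emb}) :=
      definable_iInter_of_finite fun i => hΓ.rng.preimage_comp (fun j => (i, j))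
    refine (congrArg (IsDef L) (Set.ext fun w => ⟨fun h => ?_, ?_⟩)).mp this
    · choose x hx using mem_iInter.1 h
      exact ⟨x, funext fun p => congrFun (hx p.1) p.2⟩
    · rintro ⟨x, rfl⟩
      exact mem_iInter.2 fun i => ⟨x i, rfl⟩

@[fun_prop] lemma DFun.proj {ι : Type} [Finite ι] {Γ : Type*} [DSort L M Γ] (i : ι) :
    DFun L M (fun w : ι → Γ => w i) :=
  .of_subst _ (fun j => (i, j)) fun _ => rfl

variable (L M) in
/-- Every sort is in definable bijection with a definable set of tuples. -/
lemma DSort.exists_equiv (Γ : Type*) [hΓ : DSort L M Γ] :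
    ∃ (k : ℕ) (P : Set (Fin k → M)) (_ : Fact (IsDef L P)) (e : P ≃ Γ), DFun L M e := by
  obtain ⟨k, ⟨i⟩⟩ := Finite.exists_equiv_fin hΓ.idx
  let P : Set (Fin k → M) := {w | w ∘ i ∈ range hΓ.emb}
  have hP : Fact (IsDef L P) := ⟨hΓ.rng.preimage_comp i⟩
  let g : P → Γ := fun p => p.2.choose
  have hg : ∀ p, hΓ.emb (g p) = p ∘ i := fun p => p.2.choose_spec
  refine ⟨k, P, hP, Equiv.ofBijective g ⟨fun p q h => Subtype.ext ?_, fun x => ?_⟩, ?_⟩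
  · have := (hg p).symm.trans ((congrArg hΓ.emb h).trans (hg q))
    exact i.surjective.injective_comp_right this
  · refine ⟨⟨hΓ.emb x ∘ i.symm, x, ?_⟩, hΓ.inj ?_⟩
    · rw [Function.comp_assoc, i.symm_comp_self, Function.comp_id]
    · rw [hg, Function.comp_assoc, i.symm_comp_self, Function.comp_id]
  · exact .of_subst _ i hg

variable {n : ℕ} {V : Set (Fin n → M)} [AddCommGroup V] [hV : DefGroup L V]

lemma isDefSetOfEnd_of_dfun {Γ : Type*} [DSort L M Γ] {S : Set (AddMonoid.End V)} (e : Γ ≃ S)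
    (he : DFun L M (fun p : Γ × V => (e p.1 : AddMonoid.End V) p.2)) : IsDefSetOfEnd L S := by
  obtain ⟨k, P, hP, i, hi⟩ := DSort.exists_equiv L M Γ
  refine ⟨k, P, i.trans e, hP.out, isDefMap₂_iff.2 ?_⟩
  exact he.comp (g := fun p : P × V => (i p.1, p.2)) ((hi.comp .fst).pair .snd)

lemma DFun.sum {Γ : Type*} [DSort L M Γ] {ι : Type*} (s : Finset ι) {f : ι → Γ → V}
    (hf : ∀ i, DFun L M (f i)) : DFun L M (fun x => ∑ i ∈ s, f i x) := by
  classical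
  induction s using Finset.induction_on with
  | empty => exact DFun.const 0
  | insert i s hi ih =>
    simp only [Finset.sum_insert hi]
    exact (hf i).add ih

/-- The linear map with given values at a basis depends definably on these values. -/
lemma dfun_constr {K : Type*} [DSort L M K] [DivisionRing K] [Module K V]
    (hsmul : DFun L M (fun p : K × V => p.1 • p.2)) {ι : Type} [Fintype ι]
    (b : Module.Basis ι K V) : DFun L M (fun p : (ι → V) × V => b.constr ℕ p.1 p.2) := by
  -- Quantifying over the coordinates avoids having to show that the coordinate functions are
  -- definable.
  have h : Dfn L M (fun p : ((ι → V) × V) × V => ∃ c : ι → K,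
      p.1.2 = ∑ i, c i • b i ∧ p.2 = ∑ i, c i • p.1.1 i) := by
    refine .ex (.and (.eq (by fun_prop) (.sum _ fun i => ?_))
      (.eq (by fun_prop) (.sum _ fun i => ?_)))
    · exact hsmul.comp (g := fun q : (((ι → V) × V) × V) × (ι → K) => (q.2 i, b i)) (by fun_prop)
    · exact hsmul.comp (g := fun q : (((ι → V) × V) × V) × (ι → K) => (q.2 i, q.1.1.1 i))
        (by fun_prop)
  refine h.congr fun p => ⟨?_, fun h => ⟨b.repr p.1.2, (b.sum_repr _).symm, ?_⟩⟩
  · rintro ⟨c, hc, hp⟩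
    simp only [hc, hp, map_sum, map_smul, b.constr_basis]
  · exact Eq.trans h (b.constr_apply_fintype ℕ _ _)

end DefinableMaps

/-! ### The definable skew-field and finite linear dimension. -/

section SkewField

variable {L : FirstOrder.Language.{u, v}} {M : Type w} [L.Structure M]
variable {n : ℕ} {V : Set (Fin n → M)} [AddCommGroup V] [hV : DefGroup L V]
variable {T : Subring (AddMonoid.End V)}

/-- An infinite definable division ring of endomorphisms has finite linear dimension. -/
lemma exists_finset_spanning {dim : ∀ σ : ImagSort L M, Set σ.Elt → WithBot ℕ}
    (hdim : IsDimension dim) (hD : IsEndDivision (T : Set (AddMonoid.End V)) 1) [Infinite T]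
    (horb : ∀ b, Dfn L M (fun x => x ∈ hD.orbit b)) :
    ∃ F : Finset V, ∀ W : AddSubgroup V, (∀ t ∈ T, ∀ x ∈ W, t x ∈ W) → ↑F ⊆ (W : Set V) →
      W = ⊤ := by
  classical
  let G := groupDim (V := V) hdim
  -- Among definable finitely generated `T`-subspaces take one of largest dimension; a vector
  -- outside it would contribute an orbit and increase the dimension.
  obtain ⟨W, ⟨hWd, hWT, F, hF⟩, hmax⟩ := exists_max_of_bounded
    (fun W : AddSubgroup V => G.Def W ∧ (∀ t ∈ T, ∀ x ∈ W, t x ∈ W) ∧ ∃ F : Finset V,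
      ∀ W' : AddSubgroup V, (∀ t ∈ T, ∀ x ∈ W', t x ∈ W') → ↑F ⊆ (W' : Set V) → W ≤ W')
    G.dim (G.dim ⊤)
    ⟨⊥, G.def_bot, fun t _ x hx => by rw [AddSubgroup.mem_bot] at *; rw [hx, map_zero],
      ∅, fun W' _ _ => bot_le⟩ fun W hW => G.dim_mono hW.1 G.def_top le_top
  refine ⟨F, fun W' hW' hFW' => top_le_iff.1 fun x _ => hF W' hW' hFW' ?_⟩
  by_contra hx
  have hd : G.Def (W ⊔ hD.orbit x) := dfn_sup hWd (horb x)
  refine (G.dim_lt hWd hd le_sup_left (hD.relIndex_orbit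
    (infinite_coe_iff.1 ‹Infinite T›) hWT rfl hx)).not_ge
    (hmax _ ⟨hd, hD.sup_orbit_inv hWT x, insert x F, fun W'' hW'' hFW'' => ?_⟩)
  rw [Finset.coe_insert, insert_subset_iff] at hFW''
  refine sup_le (hF W'' hW'' hFW''.2) ?_
  rintro _ ⟨t, ht, rfl⟩
  exact hW'' t ht x hFW''.1

/-- A definable division ring of endomorphisms is isomorphic to a definable skew-field. -/
lemma exists_skewField (hD : IsEndDivision (T : Set (AddMonoid.End V)) 1) {a : V} (ha : a ≠ 0)
    (hT : Dfn L M (fun p : V × V × V => ∃ t ∈ T, p.1 = t a ∧ p.2.2 = t p.2.1)) :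
    ∃ (K : Set (Fin n → M)) (_ : Fact (IsDef L K)) (_ : DivisionRing K) (σ : K ≃+* T),
      IsDefMap₂ L (fun x y : K => x + y) ∧ IsDefMap₂ L (fun x y : K => x * y) ∧
      DFun L M (fun p : K × V => (σ p.1 : AddMonoid.End V) p.2) := by
  -- The skew-field lives on the orbit of `a`, with `t` coded by `t a`.
  let K : Set (Fin n → M) := Subtype.val '' {p : V | ∃ t ∈ T, p = t a}
  have hK : Fact (IsDef L K) := by
    have h : Dfn L M (fun p : V => ∃ t ∈ T, p = t a) := by
      have : Dfn L M (fun p : V => ∃ t ∈ T, p = t a ∧ p = t a) :=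
        hT.comp (f := fun p => (p, a, p)) (by fun_prop)
      simpa only [and_self] using this
    exact ⟨h⟩
  have hinj : ∀ t t' : T, (t : AddMonoid.End V) a = (t' : AddMonoid.End V) a → t = t' :=
    fun t t' h => Subtype.ext (hD.eq_of_apply t.2 t'.2 (a := a) rfl ha h)
  let i : T ≃ K := Equiv.ofBijective
    (fun t => ⟨((t : AddMonoid.End V) a : V), _, ⟨t, t.2, rfl⟩, rfl⟩)
    ⟨fun t t' h => hinj t t' (Subtype.ext (congrArg (fun x : K => (x : Fin n → M)) h)), by
      rintro ⟨_, _, ⟨t, ht, rfl⟩, rfl⟩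
      exact ⟨⟨t, ht⟩, rfl⟩⟩
  have : Nontrivial T := ⟨0, 1, fun h => ha (DFunLike.congr_fun (congrArg Subtype.val h) a).symm⟩
  have hdiv : ∀ t : T, IsUnit t ∨ t = 0 := fun t => by
    by_cases h0 : t = 0
    · exact .inr h0
    -- Only left inverses are given; a left inverse of the left inverse makes it two-sided.
    have hl : ∀ t : T, t ≠ 0 → ∃ t' : T, t' ≠ 0 ∧ t' * t = 1 := fun t h0 => by
      obtain ⟨t', ht', h⟩ := hD.exists_inv t t.2 fun h => h0 (Subtype.ext h)
      have h' : (⟨t', ht'⟩ : T) * t = 1 := Subtype.ext h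
      exact ⟨_, left_ne_zero_of_mul_eq_one h', h'⟩
    obtain ⟨t', h0', h⟩ := hl t h0
    obtain ⟨t'', -, h'⟩ := hl t' h0'
    exact .inl ⟨⟨t, t', by rw [← left_inv_eq_right_inv h' h, h'], h⟩, rfl⟩
  let : DivisionRing T := DivisionRing.ofIsUnitOrEqZero hdiv
  let : DivisionRing K := i.symm.divisionRing
  let σ : K ≃+* T := i.symm.ringEquiv
  let j : K → V := fun x => ⟨x, by obtain ⟨_, ⟨y, -, rfl⟩⟩ := x; exact y.2⟩
  have hj : DFun L M j := .of_subst _ id fun _ => rfl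
  have hji : Function.Injective j := fun x y h => Subtype.ext (congrArg (fun x : V => (x : Fin n → M)) h)
  have hjσ : ∀ x, j x = (σ x : AddMonoid.End V) a := fun x =>
    Subtype.ext (congrArg Subtype.val (i.apply_symm_apply x)).symm
  have hev : DFun L M (fun p : K × V => (σ p.1 : AddMonoid.End V) p.2) := by
    refine (hT.comp (f := fun q : (K × V) × V => (j q.1.1, q.1.2, q.2)) (by fun_prop)).congr
      fun q => ⟨?_, fun h => ⟨_, (σ q.1.1).2, hjσ _, h⟩⟩
    rintro ⟨t, ht, h1, h2⟩
    have h3 := hinj (σ q.1.1) ⟨t, ht⟩ ((hjσ _).symm.trans h1)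
    exact h2.trans (DFunLike.congr_fun (congrArg Subtype.val h3) _).symm
  refine ⟨K, hK, inferInstance, σ, isDefMap₂_iff.2 ?_, isDefMap₂_iff.2 ?_, hev⟩
  · have h : Dfn L M (fun q : (K × K) × K => j q.2 = j q.1.1 + j q.1.2) :=
      .eq (by fun_prop) (by fun_prop)
    refine h.congr fun q => ?_
    have : j (q.1.1 + q.1.2) = j q.1.1 + j q.1.2 := by
      simp only [hjσ, map_add]
      rfl
    rw [← this, hji.eq_iff]
  · have h : Dfn L M (fun q : (K × K) × K => j q.2 = (σ q.1.1 : AddMonoid.End V) (j q.1.2)) :=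
      .eq (by fun_prop) (hev.comp (g := fun q : (K × K) × K => (q.1.1, j q.1.2)) (by fun_prop))
    refine h.congr fun q => ?_
    have : j (q.1.1 * q.1.2) = (σ q.1.1 : AddMonoid.End V) (j q.1.2) := by
      simp only [hjσ, map_mul]
      rfl
    rw [← this, hji.eq_iff]

end SkewField

end ZilberLemma

/-! ### Assembly of the theorem. -/

open ZilberLemma in
theorem mainTheorem1
    (L : FirstOrder.Language.{u, v}) (M : Type w) [L.Structure M]
    -- `M` is a monster model: bounded, or small, means of cardinality less than `κ`
    (κ : Cardinal.{w}) (hκ : κ.IsRegular) (hκ_unc : Cardinal.aleph0 < κ)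
    (hκ_L : Cardinal.lift.{w} L.card < Cardinal.lift.{max u v} κ)
    (hM : IsSaturated L M κ) (hdim : IsFiniteDimensional L M)
    -- a definable, connected, abelian group
    (n : ℕ) (V : Set (Fin n → M)) [AddCommGroup V]
    (hV : IsDef L V) (hV_add : IsDefMap₂ L (fun x y : V => x + y))
    (hV_conn : IsConnectedSubgroup L (⊤ : AddSubgroup V))
    -- invariant rings of definable endomorphisms
    (S T : Subring (AddMonoid.End V))
    (hS_def : (S : Set (AddMonoid.End V)) ⊆ defEnd L V)
    (hT_def : (T : Set (AddMonoid.End V)) ⊆ defEnd L V)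
    (hS_inv : IsInvariantSet L κ (S : Set (AddMonoid.End V)))
    (hT_inv : IsInvariantSet L κ (T : Set (AddMonoid.End V)))
    (hirr : IsIrreducibleUnder L (S : Set (AddMonoid.End V)))
    (hCS : defCentralizer L (S : Set (AddMonoid.End V)) = T)
    (hCT : defCentralizer L (T : Set (AddMonoid.End V)) = S)
    (hS_inf : Infinite S) (hT_inf : Infinite T)
    (hunb : κ ≤ Cardinal.mk S ∨ κ ≤ Cardinal.mk T) :
    ∃ (m : ℕ) (K : Set (Fin m → M)) (_ : DivisionRing K) (_ : Module K V),
      -- `K` is a definable skew-field, and `V` a definable `K`-vector space of finite dimension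
      IsDef L K ∧ IsDefMap₂ L (fun a b : K => a + b) ∧ IsDefMap₂ L (fun a b : K => a * b) ∧
      IsDefMap₂ L (fun (a : K) (x : V) => a • x) ∧ FiniteDimensional K V ∧
      -- `S` is the ring of `K`-linear endomorphisms, `T` the ring of scalars, both definable
      (S : Set (AddMonoid.End V)) =
        Set.range (fun f : Module.End K V => (f.toAddMonoidHom : AddMonoid.End V)) ∧
      T = (Module.toAddMonoidEnd K V).range ∧
      IsDefSetOfEnd L (S : Set (AddMonoid.End V)) ∧
      IsDefSetOfEnd L (T : Set (AddMonoid.End V)) := by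
  have : DefGroup L V := ⟨hV, hV_add⟩
  have hMon : IsMonster L M κ := ⟨hκ, hκ_unc, hM⟩
  obtain ⟨dim, hdim⟩ := hdim
  have hmemT : ∀ {f}, f ∈ T ↔ f ∈ defEnd L V ∧ ∀ s ∈ S, s * f = f * s := fun {f} =>
    (Set.ext_iff.1 hCS f).symm
  have hP : (groupDim (V := V) hdim).IsPair S T :=
    { conn := hV_conn
      S_le := hS_def
      T_le := hT_def
      comm := fun s hs t ht => (hmemT.1 ht).2 s hs
      mem_T := fun f hf h => hmemT.2 ⟨hf, h⟩
      mem_S := fun f hf h => (Set.ext_iff.1 hCT f).1 ⟨hf, h⟩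
      irr := hirr
      S_inf := hS_inf
      T_inf := hT_inf }
  have hNF := eq_bot_of_finite_inv hMon hP hS_inv hT_inv hunb
  have hTunb : κ ≤ Cardinal.mk T := hunb.elim
    (fun h => unbounded_centralizer hMon hdim hP hS_inv h hNF) id
  have hD : IsEndDivision (T : Set (AddMonoid.End V)) 1 :=
    { add_mem := fun _ h _ h' => T.add_mem h h'
      sub_mem := fun _ h _ h' => T.sub_mem h h'
      mul_mem := fun _ h _ h' => T.mul_mem h h'
      unit_mem := T.one_mem
      unit_mul := fun d _ => one_mul d
      mul_unit := fun d _ => mul_one d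
      exists_inv := fun t ht h0 => by
        obtain ⟨t', ht', h, -⟩ := hP.exists_inv hNF ht h0
        exact ⟨t', ht', h⟩ }
  obtain ⟨ι, X, hι, hX⟩ := exists_families hT_inv
  have hEv : ∀ a : V, a ≠ 0 →
      Dfn L M (fun p : V × V × V => ∃ t ∈ T, p.1 = t a ∧ p.2.2 = t p.2.1) := fun a ha =>
    hD.dfn_eval hdim hMon (hT_def T.one_mem) hι hX hTunb rfl ha
  obtain ⟨a, ha⟩ : ∃ a : V, a ≠ 0 := by
    obtain ⟨t, ht⟩ := exists_ne (0 : T)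
    by_contra! h
    exact ht (Subtype.ext (end_ext fun x => by rw [h x]; exact map_zero _))
  have horb : ∀ b, Dfn L M (fun x => x ∈ hD.orbit b) := fun b => by
    have : Dfn L M (fun x : V => ∃ p : V, ∃ t ∈ T, p = t a ∧ x = t b) :=
      .ex ((hEv a ha).comp (f := fun q : V × V => (q.2, b, q.1)) (by fun_prop))
    refine this.congr fun x => ⟨?_, ?_⟩
    · rintro ⟨-, t, ht, -, h⟩
      exact ⟨t, ht, h⟩
    · rintro ⟨t, ht, h⟩
      exact ⟨t a, t, ht, rfl, h⟩
  obtain ⟨F, hF⟩ := exists_finset_spanning hdim hD horb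
  obtain ⟨K, hK, hdivK, σ, hadd, hmul, hev⟩ := exists_skewField hD ha (hEv a ha)
  let : Module K V := Module.compHom V (T.subtype.comp σ.toRingHom)
  have hsmul : ∀ (k : K) (x : V), k • x = (σ k : AddMonoid.End V) x := fun _ _ => rfl
  have hfin : FiniteDimensional K V := by
    refine ⟨F, (Submodule.toAddSubgroup_injective (R := K) (M := V)) ?_⟩
    refine hF _ (fun t ht x hx => ?_) Submodule.subset_span
    have := (Submodule.span K (F : Set V)).smul_mem (σ.symm ⟨t, ht⟩) hx
    rwa [hsmul, σ.apply_symm_apply] at this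
  have hcon := dfun_constr hev (Module.finBasis K V)
  have hSr : (S : Set (AddMonoid.End V)) =
      Set.range (fun f : Module.End K V => (f.toAddMonoidHom : AddMonoid.End V)) := by
    refine Set.Subset.antisymm (fun s hs => ?_) ?_
    · exact ⟨{ toFun := s, map_add' := map_add s,
               map_smul' := fun k x => hP.comm_apply hs (σ k).2 x }, rfl⟩
    · rintro _ ⟨f, rfl⟩
      -- A linear map is definable from its values on a finite basis, and linearity is commutation
      -- with `T`; the double centraliser condition then applies.
      refine hP.mem_S _ (mem_defEnd_iff.2 ?_) fun t ht => end_ext fun x => ?_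
      · have h := hcon.comp (g := fun x : V => (fun i => f (Module.finBasis K V i), x))
          (.pair (.const _) .id)
        simp only [Module.Basis.constr_self] at h
        exact h
      · have := f.map_smul (σ.symm ⟨t, ht⟩) x
        simp only [hsmul, σ.apply_symm_apply] at this
        exact this.symm
  refine ⟨n, K, hdivK, inferInstance, hK.out, hadd, hmul, isDefMap₂_iff.2 hev, hfin, hSr, ?_,
    ?_, ?_⟩
  · ext t
    constructor
    · intro ht
      exact ⟨σ.symm ⟨t, ht⟩, end_ext fun x => by
        change (σ (σ.symm ⟨t, ht⟩) : AddMonoid.End V) x = t x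
        rw [σ.apply_symm_apply]⟩
    · rintro ⟨k, rfl⟩
      exact (σ k).2
  · rw [hSr]
    refine isDefSetOfEnd_of_dfun (((Module.finBasis K V).constr ℕ).toEquiv.trans
      (Equiv.ofInjective _ fun f g h => ?_)) hcon
    exact LinearMap.ext fun x => DFunLike.congr_fun h x
  · exact isDefSetOfEnd_of_dfun (σ.toEquiv : K ≃ T) hev
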